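/- All graphs are finite and simple. A \emph{D3 reduction} of a graph is one of the following two operations. (D3a) Let $p,q,r$ be three degree-three vertices that induce a triangle and whose neighbors outside $\{p,q,r\}$ are all distinct; replace $p,q,r$ by a single vertex with the same three outside neighbors. (D3b) Let $p,q,r$ be three degree-three vertices that induce a path with middle vertex $q$, and suppose that some vertex $s$ is adjacent to all three of $p,q,r$; delete $q$ and add the edge $pr$. A graph is \emph{D3-reducible} if it can be reduced to $K_4$ by a finite (possibly empty) sequence of D3 reductions. A \emph{wheel graph} is the graph of a pyramid over an $n$-gon, $n\ge 3$: a cycle of $n$ vertices together with one further vertex adjacent to all of them (so $K_4$, the graph of the tetrahedron, is the case $n=3$). \emph{Gluing.} Let $(P_i)_{i\in I}$ be a nonempty finite collection of polyhedral (that is, 3-vertex-connected planar) graphs, and let $T$ be a tree with vertex set $I$. For each edge $ij$ of $T$ choose a triangular face of (the planar embedding of) $P_i$, a triangular face of $P_j$, and a bijection between the three vertices of the one and the three vertices of the other, such that for each $i$ the faces of $P_i$ chosen for different edges of $T$ at $i$ are different. The glued graph is obtained from the disjoint union of the $P_i$ by identifying, for each edge of $T$, the pairs of vertices matched by the bijection;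 its edges are the images of the edges of the $P_i$ (no edges are removed). \textbf{Theorem.} A graph $G$ is the planar dual of a D3-reducible graph if and only if $G$ is isomorphic to a graph constructed by gluing together, as above, a nonempty finite collection of wheel graphs. -/

import Mathlib

universe u v w

/-! ### D3 reductions -/

namespace D3

/-- The vertex `x` has exactly three neighbours. -/
def DegreeThree {V : Type u} (G : SimpleGraph V) (x : V) : Prop :=
  (G.neighborSet x).ncard = 3

/-- The triangle reduction applies to `p`, `q`, `r`: they are three degree-three vertices
inducing a triangle, and their neighbours outside `{p, q, r}` are all distinct. -/
structure TriangleReducible {V : Type u} (G : SimpleGraph V) (p q r : V) : Prop where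
  degree_p : DegreeThree G p
  degree_q : DegreeThree G q
  degree_r : DegreeThree G r
  adj_pq : G.Adj p q
  adj_qr : G.Adj q r
  adj_pr : G.Adj p r
  outside_distinct : ∀ x, x ≠ p → x ≠ q → x ≠ r →
    ¬ (G.Adj p x ∧ G.Adj q x) ∧ ¬ (G.Adj q x ∧ G.Adj r x) ∧ ¬ (G.Adj p x ∧ G.Adj r x)

/-- The result of the triangle reduction: `p`, `q`, `r` are deleted, and a new vertex `none` is
joined to all their former neighbours outside `{p, q, r}`. -/
def triangleReduce {V : Type u} (G : SimpleGraph V) (p q r : V) :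
    SimpleGraph (Option {x : V // x ≠ p ∧ x ≠ q ∧ x ≠ r}) where
  Adj
    | none, none => False
    | none, some x => G.Adj p x ∨ G.Adj q x ∨ G.Adj r x
    | some x, none => G.Adj p x ∨ G.Adj q x ∨ G.Adj r x
    | some x, some y => G.Adj x y
  symm := by
    constructor
    rintro (_ | x) (_ | y) h
    · exact h
    · exact h
    · exact h
    · exact G.adj_symm h
  loopless := by
    constructor
    rintro (_ | x) h
    · exact h
    · exact G.irrefl h

/-- The path reduction applies to `p`, `q`, `r` with apex `s`: the three vertices have degree
three and induce a path with middle vertex `q`, and `s` is adjacent to all of them. -/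
structure PathReducible {V : Type u} (G : SimpleGraph V) (p q r s : V) : Prop where
  degree_p : DegreeThree G p
  degree_q : DegreeThree G q
  degree_r : DegreeThree G r
  adj_pq : G.Adj p q
  adj_qr : G.Adj q r
  ne_pr : p ≠ r
  not_adj_pr : ¬ G.Adj p r
  adj_ps : G.Adj p s
  adj_qs : G.Adj q s
  adj_rs : G.Adj r s

/-- The result of the path reduction: `q` is deleted and the edge `pr` is added. -/
def pathReduce {V : Type u} (G : SimpleGraph V) (p q r : V) : SimpleGraph {x : V // x ≠ q} :=
  (G ⊔ SimpleGraph.edge p r).induce {x | x ≠ q}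

/-- The graphs that can be reduced to (a copy of) `K₄` by a finite sequence of reductions. -/
inductive Reducible : ∀ {V : Type u}, SimpleGraph V → Prop
  | complete {V : Type u} (G : SimpleGraph V) :
      Nonempty (G ≃g (⊤ : SimpleGraph (Fin 4))) → Reducible G
  | triangle {V : Type u} (G : SimpleGraph V) (p q r : V) :
      TriangleReducible G p q r → Reducible (triangleReduce G p q r) → Reducible G
  | path {V : Type u} (G : SimpleGraph V) (p q r s : V) :
      PathReducible G p q r s → Reducible (pathReduce G p q r) → Reducible G

/-! ### Embeddings in the sphere and planar duals -/

/-- A rotation system of `G`: a cyclic order on the darts (directed edges) leaving each vertex,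
given as a permutation `rot` of all darts whose cycles are exactly the sets of darts with a common
tail. This is an embedding of a connected graph in a closed oriented surface, up to
orientation-preserving homeomorphism. -/
structure RotationSystem {V : Type u} (G : SimpleGraph V) where
  rot : Equiv.Perm G.Dart
  rot_fst : ∀ d, (rot d).fst = d.fst
  rot_cyclic : ∀ d e : G.Dart, d.fst = e.fst → rot.SameCycle d e

namespace RotationSystem

variable {V : Type u} {G : SimpleGraph V}

/-- The permutation that walks along the boundaries of the faces: arriving at the head of `d`,
turn back and leave along the next dart in the rotation there. -/
def faceNext (R : RotationSystem G) : Equiv.Perm G.Dart :=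
  (SimpleGraph.Dart.symm_involutive (G := G)).toPerm.trans R.rot

/-- The faces of a rotation system are the cycles of `faceNext`. -/
def Face (R : RotationSystem G) : Type u :=
  Quotient (Equiv.Perm.SameCycle.setoid R.faceNext)

/-- The face whose boundary walk runs along the dart `d`. -/
def face (R : RotationSystem G) (d : G.Dart) : R.Face :=
  Quotient.mk (Equiv.Perm.SameCycle.setoid R.faceNext) d

/-- The rotation system is an embedding of a finite connected graph (with at least one edge) in
the sphere: Euler's formula `|V| - |E| + |F| = 2` holds. -/
structure IsPlanar (R : RotationSystem G) : Prop where
  finite : Finite V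
  connected : G.Connected
  euler : Nat.card V + Nat.card R.Face = Nat.card G.edgeSet + 2

end RotationSystem

/-- `G` is a planar dual of `G'`: for some planar embedding `R` of `G'`, the vertices of `G`
correspond to the faces of `R`, and the edges of `G` correspond to the edges of `G'`, each edge
of `G` joining the two faces on the two sides of the corresponding edge of `G'`. The
correspondence of edges is given on darts and commutes with reversal. -/
def IsPlanarDual {V : Type u} {V' : Type v} (G : SimpleGraph V) (G' : SimpleGraph V') : Prop :=
  ∃ R : RotationSystem G', R.IsPlanar ∧
    ∃ (F : R.Face ≃ V) (δ : G'.Dart ≃ G.Dart),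
      (∀ d, δ d.symm = (δ d).symm) ∧ ∀ d, (δ d).fst = F (R.face d)

/-- `T` is the vertex set of a triangular face in a planar embedding of `G`. (The planar embedding
of a 3-connected planar graph is unique up to reflection.) -/
def IsTriangularFace {V : Type u} (G : SimpleGraph V) (T : Set V) : Prop :=
  ∃ R : RotationSystem G, R.IsPlanar ∧
    ∃ d : G.Dart, R.faceNext (R.faceNext (R.faceNext d)) = d ∧
      T = {d.fst, (R.faceNext d).fst, (R.faceNext (R.faceNext d)).fst}

/-! ### Wheels and gluing -/

/-- The wheel with hub `none` and a rim cycle of `n` vertices. -/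
def wheel (n : ℕ) : SimpleGraph (Option (Fin n)) where
  Adj
    | none, none => False
    | none, some _ => True
    | some _, none => True
    | some i, some j => (SimpleGraph.cycleGraph n).Adj i j
  symm := by
    constructor
    rintro (_ | i) (_ | j) h
    · exact h
    · exact h
    · exact h
    · exact (SimpleGraph.cycleGraph n).adj_symm h
  loopless := by
    constructor
    rintro (_ | i) h
    · exact h
    · exact (SimpleGraph.cycleGraph n).irrefl h

/-- `G` is a wheel graph, that is, the graph of a pyramid over an `n`-gon with `n ≥ 3`
(a tetrahedron if `n = 3`). -/
def IsWheel {V : Type u} (G : SimpleGraph V) : Prop :=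
  ∃ n : ℕ, 3 ≤ n ∧ Nonempty (G ≃g wheel n)

/-- A pattern for gluing a family of polyhedral graphs `P i` along triangular faces. The gluing
steps are the edges of a tree on the index set. The step along the edge `ij` identifies a
triangular face of `P i`, with vertices `face (ij) 0, 1, 2`, with a triangular face of `P j`, with
vertices `face (ji) 0, 1, 2`, in this order. Each face of each `P i` takes part in at most one
step. -/
structure Gluing {ι : Type v} {X : ι → Type w} (P : ∀ i, SimpleGraph (X i)) where
  tree : SimpleGraph ι
  isTree : tree.IsTree
  face : ∀ {i j : ι}, tree.Adj i j → Fin 3 → X i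
  isTriangularFace : ∀ {i j : ι} (h : tree.Adj i j),
    IsTriangularFace (P i) (Set.range (face h))
  face_used_once : ∀ {i j k : ι} (h : tree.Adj i j) (h' : tree.Adj i k),
    Set.range (face h) = Set.range (face h') → j = k

namespace Gluing

variable {ι : Type v} {X : ι → Type w} {P : ∀ i, SimpleGraph (X i)}

/-- The elementary identifications of vertices made by the gluing steps. -/
def Identified (Γ : Gluing P) (x y : Σ i, X i) : Prop :=
  ∃ (i j : ι) (h : Γ.tree.Adj i j) (m : Fin 3),
    x = ⟨i, Γ.face h m⟩ ∧ y = ⟨j, Γ.face h.symm m⟩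

/-- The vertices of the glued graph: the disjoint union of the vertex sets of the pieces, modulo
the equivalence relation generated by the identifications. -/
def Vertex (Γ : Gluing P) : Type (max v w) :=
  Quot Γ.Identified

/-- The image in the glued graph of the vertex `x` of the piece `P i`. -/
def vertex (Γ : Gluing P) (i : ι) (x : X i) : Γ.Vertex :=
  Quot.mk Γ.Identified ⟨i, x⟩

/-- The glued graph: its edges are the images of the edges of the pieces. -/
def graph (Γ : Gluing P) : SimpleGraph Γ.Vertex where
  Adj a b := a ≠ b ∧ ∃ (i : ι) (x y : X i), (P i).Adj x y ∧ a = Γ.vertex i x ∧ b = Γ.vertex i y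
  symm := by
    constructor
    rintro a b ⟨hab, i, x, y, hxy, ha, hb⟩
    exact ⟨hab.symm, i, y, x, hxy.symm, hb, ha⟩
  loopless := by
    constructor
    rintro a ⟨haa, _⟩
    exact haa rfl

end Gluing

end D3

namespace D3

/-! ### Labelled maps on the sphere -/

/-! Run the reductions backwards and watch the dual. Undoing (D3a) truncates a vertex of degree
three; dually, a new vertex is joined to the three corners of a triangular face, so a tetrahedron is
glued on. Undoing (D3b) puts a new vertex on an edge of a triangular face, both ends of that edge
having degree three, and joins it to the opposite corner. Dually, there is a vertex `x` of degree
three with neighbours `a`, `b`, `c`, where `a` is adjacent to `b` and `c`; the edge `xb` is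
subdivided by a new vertex joined to `a`. In a wheel with hub `a` this subdivides a rim edge.

Starting from the tetrahedron, the dual therefore stays a tree of wheels (`WheelTree`). A vertex of
degree three lies in only one of the wheels (`WheelTree.eq_of_degreeThree`), so the second operation
enlarges one wheel and leaves the others alone. For the first operation one must know that the
triangle around a vertex of degree three is not yet shared by two wheels; this is the second half of
the invariant `PolyMap.IsWheelTree`. Conversely, each wheel arises from a tetrahedron by subdividing
rim edges, so a tree of wheels is built one wheel after another by attaching a tetrahedron at a free
triangle and growing it. The predicate `Realizes` records which triangles are still faces. Trees of
wheels inside a graph and gluing patterns are matched by `WheelTree.exists_gluing` and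
`Gluing.wheelTree`.

Both operations are carried out on embedded graphs with labelled vertices and faces (`PolyMap`),
where they preserve a list of polyhedrality conditions. A planar dual, however, is taken with
respect to an arbitrary embedding, so the embedding has to be unique up to reflection
(`PolyMap.rigid`). The argument is linear algebra. In a planar rotation system every circulation is
the difference of a function on the faces across the edges, by a dimension count with Euler's
formula (`RotationSystem.IsPlanar.exists_potential`). Apply this, in a second embedding, to the
boundary of a face `f` of the first. The resulting function jumps by one across the boundary of `f`
and is constant elsewhere, because the vertices off `f` are connected. It follows that two
consecutive darts at a corner of `f` are consecutive in the second embedding as well, up to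
orientation, and that the orientation is the same at both ends of every edge. -/

/-- Two elements are in the same orbit of the equivalence closure of the graph of `f`. -/
abbrev SameOrbit {D : Type*} (f : D → D) : D → D → Prop :=
  Relation.EqvGen fun a b => f a = b

theorem SameOrbit.apply {D : Type*} (f : D → D) (a : D) : SameOrbit f a (f a) :=
  .rel _ _ rfl

theorem SameOrbit.iff {D : Type*} {f : D → D} {P : D → Prop} (h : ∀ a, P a ↔ P (f a)) {a b : D}
    (hab : SameOrbit f a b) : P a ↔ P b := by
  induction hab with
  | rel a b hab => rw [← hab]; exact h a
  | refl => exact Iff.rfl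
  | symm _ _ _ ih => exact ih.symm
  | trans _ _ _ _ _ ih ih' => exact ih.trans ih'

theorem SameOrbit.eq {D X : Type*} {f : D → D} {P : D → X} (h : ∀ a, P (f a) = P a) {a b : D}
    (hab : SameOrbit f a b) : P a = P b := by
  induction hab with
  | rel a b hab => rw [← hab, h]
  | refl => rfl
  | symm _ _ _ ih => exact ih.symm
  | trans _ _ _ _ _ ih ih' => exact ih.trans ih'

theorem SameOrbit.sameCycle {D : Type*} {f : Equiv.Perm D} {a b : D} (hab : SameOrbit f a b) :
    f.SameCycle a b := by
  induction hab with
  | rel a b hab => rw [← hab]; exact Equiv.Perm.sameCycle_apply_right.2 (.refl _ _)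
  | refl => exact .refl _ _
  | symm _ _ _ ih => exact ih.symm
  | trans _ _ _ _ _ ih ih' => exact ih.trans ih'

/-- Any two elements outside `S` are joined by a chain of `adj`-steps outside `S`. -/
def Joined {V : Type*} (adj : V → V → Prop) (S : Set V) : Prop :=
  ∀ a b, a ∉ S → b ∉ S → Relation.EqvGen (fun a b => a ∉ S ∧ b ∉ S ∧ adj a b) a b

/-- A polyhedral map on the sphere: darts `D`, reversal `rev`, rotation `rot` around the tail
vertex, with vertices labelled by `V` and faces labelled by `F`. -/
structure PolyMap (D V F : Type) where
  finite : Finite D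
  rev : D → D
  rot : Equiv.Perm D
  tail : D → V
  left : D → F
  rev_rev : ∀ d, rev (rev d) = d
  tail_rot : ∀ d, tail (rot d) = tail d
  left_rot : ∀ d, left (rot d) = left (rev d)
  tail_orbit : ∀ d e, tail d = tail e → SameOrbit rot d e
  left_orbit : ∀ d e, left d = left e → SameOrbit (fun a => rot (rev a)) d e
  tail_surjective : Function.Surjective tail
  left_surjective : Function.Surjective left
  -- Polyhedrality. No vertex has degree one or two, a vertex and a face meet in at most one corner,
  -- a face through both ends of an edge contains the edge, and two faces share at most one edge.
  rot_rot_ne : ∀ d, rot (rot d) ≠ d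
  corner : ∀ d e, tail d = tail e → left d = left e → d = e
  chord : ∀ d f, (∃ e, tail e = tail d ∧ left e = f) → (∃ e, tail e = tail (rev d) ∧ left e = f) →
    left d = f ∨ left (rev d) = f
  left_injective : ∀ d e, left d = left e → left (rev d) = left (rev e) → d = e
  joined_empty : Joined (fun a b => ∃ d, tail d = a ∧ tail (rev d) = b) ∅
  -- The condition on faces is what uniqueness of the embedding needs. The one on vertices keeps it
  -- alive under truncation: off the new triangle one sees the old graph without the truncated
  -- vertex.
  joined_vertex : ∀ v, Joined (fun a b => ∃ d, tail d = a ∧ tail (rev d) = b) {v}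
  joined_face : ∀ f, Joined (fun a b => ∃ d, tail d = a ∧ tail (rev d) = b)
    {v | ∃ d, tail d = v ∧ left d = f}
  euler : 2 * (Nat.card V + Nat.card F) = Nat.card D + 4

namespace PolyMap

variable {D V F : Type} (M : PolyMap D V F)

/-- The vertex `v` lies on the face `f`. -/
def Inc (v : V) (f : F) : Prop := ∃ d, M.tail d = v ∧ M.left d = f

/-- The next dart along the face to the left. -/
def next (d : D) : D := M.rot (M.rev d)

theorem inc_left (d : D) : M.Inc (M.tail d) (M.left d) := ⟨d, rfl, rfl⟩

theorem rev_injective : Function.Injective M.rev :=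
  (show Function.Involutive M.rev from M.rev_rev).injective

theorem left_next (d : D) : M.left (M.next d) = M.left d := by
  rw [next, M.left_rot, M.rev_rev]

theorem tail_next (d : D) : M.tail (M.next d) = M.tail (M.rev d) := M.tail_rot _

theorem inc_left_rev (d : D) : M.Inc (M.tail (M.rev d)) (M.left d) :=
  ⟨M.next d, M.tail_next d, M.left_next d⟩

theorem inc_rev (d : D) : M.Inc (M.tail d) (M.left (M.rev d)) :=
  ⟨M.rot d, M.tail_rot d, M.left_rot d⟩

theorem rot_ne (d : D) : M.rot d ≠ d := fun h => M.rot_rot_ne d (by rw [h, h])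

/-- With equal sides, `d` and `rot d` would be two corners of one vertex on one face. -/
theorem left_rev_ne (d : D) : M.left (M.rev d) ≠ M.left d := fun h =>
  M.rot_ne d (M.corner _ _ (M.tail_rot d) ((M.left_rot d).trans h))

theorem rev_ne (d : D) : M.rev d ≠ d := fun h => M.left_rev_ne d (by rw [h])

/-- By `corner`, a loop would be its own successor along both sides, so its two darts would be
exchanged by `rot`, against `rot_rot_ne`. -/
theorem tail_rev_ne (d : D) : M.tail (M.rev d) ≠ M.tail d := fun h => by
  have h1 : M.next d = d := M.corner _ _ ((M.tail_next d).trans h) (M.left_next d)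
  have h2 : M.next (M.rev d) = M.rev d := M.corner _ _
    ((M.tail_next _).trans (by rw [M.rev_rev, h])) (M.left_next _)
  rw [next, M.rev_rev] at h2
  apply M.rot_rot_ne d
  rw [h2]
  exact h1

/-- By `chord`, two parallel edges have the same two faces on their sides; by `corner`, those sides
are interchanged, and then `rot` swaps the two darts, which would make a vertex of degree two. -/
theorem tail_injective {d e : D} (h : M.tail d = M.tail e)
    (h' : M.tail (M.rev d) = M.tail (M.rev e)) : d = e := by
  by_contra hne
  have c1 := M.chord e (M.left d) (h ▸ M.inc_left d) (h' ▸ M.inc_left_rev d)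
  have c2 := M.chord e (M.left (M.rev d)) (h ▸ M.inc_rev d) (h' ▸ M.inc_left (M.rev d))
  have n1 : M.left e ≠ M.left d := fun h1 => hne (M.corner _ _ h h1.symm)
  have n2 : M.left (M.rev e) ≠ M.left (M.rev d) := fun h1 =>
    hne (M.rev_injective (M.corner _ _ h' h1.symm))
  have c1 := c1.resolve_left n1
  have c2 := c2.resolve_right n2
  have e1 : M.rot d = e := M.corner _ _ ((M.tail_rot d).trans h) ((M.left_rot d).trans c2.symm)
  have e2 : M.rot e = d := M.corner _ _ ((M.tail_rot e).trans h.symm) ((M.left_rot e).trans c1)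
  exact M.rot_rot_ne d (by rw [e1, e2])

/-- The graph of the vertices. -/
def primal : SimpleGraph V where
  Adj a b := ∃ d, M.tail d = a ∧ M.tail (M.rev d) = b
  symm := ⟨by rintro _ _ ⟨d, rfl, rfl⟩; exact ⟨M.rev d, rfl, by rw [M.rev_rev]⟩⟩
  loopless := ⟨by rintro _ ⟨d, rfl, h⟩; exact M.tail_rev_ne d h⟩

/-- The graph of the faces. -/
def dual : SimpleGraph F where
  Adj a b := ∃ d, M.left d = a ∧ M.left (M.rev d) = b
  symm := ⟨by rintro _ _ ⟨d, rfl, rfl⟩; exact ⟨M.rev d, rfl, by rw [M.rev_rev]⟩⟩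
  loopless := ⟨by rintro _ ⟨d, rfl, h⟩; exact M.left_rev_ne d h⟩

theorem primal_adj {a b : V} : M.primal.Adj a b ↔ ∃ d, M.tail d = a ∧ M.tail (M.rev d) = b :=
  Iff.rfl

theorem dual_adj {a b : F} : M.dual.Adj a b ↔ ∃ d, M.left d = a ∧ M.left (M.rev d) = b := Iff.rfl

theorem primal_adj_rev (d : D) : M.primal.Adj (M.tail d) (M.tail (M.rev d)) := ⟨d, rfl, rfl⟩

theorem dual_adj_rev (d : D) : M.dual.Adj (M.left d) (M.left (M.rev d)) := ⟨d, rfl, rfl⟩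

/-- The vertex `v` has degree three. -/
def Tri (v : V) : Prop := ∀ d, M.tail d = v → M.rot (M.rot (M.rot d)) = d

variable {M}

theorem Tri.cases {d e : D} (h : M.Tri (M.tail d)) (he : M.tail e = M.tail d) :
    e = d ∨ e = M.rot d ∨ e = M.rot (M.rot d) := by
  refine (SameOrbit.iff (P := fun e => e = d ∨ e = M.rot d ∨ e = M.rot (M.rot d)) ?_
    (M.tail_orbit _ _ he.symm)).1 (.inl rfl)
  intro a
  have h3 := h d rfl
  constructor
  · rintro (rfl | rfl | rfl) <;> simp [h3]
  · rintro (h | h | h)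
    · right; right; apply M.rot.injective; rw [h, h3]
    · left; exact M.rot.injective h
    · right; left; exact M.rot.injective h

/-- The three faces around a vertex of degree three. -/
theorem Tri.inc_iff {d : D} (h : M.Tri (M.tail d)) {f : F} : M.Inc (M.tail d) f ↔
    f = M.left d ∨ f = M.left (M.rot d) ∨ f = M.left (M.rot (M.rot d)) := by
  constructor
  · rintro ⟨e, he, rfl⟩
    rcases h.cases he with rfl | rfl | rfl <;> simp
  · rintro (rfl | rfl | rfl)
    · exact ⟨_, rfl, rfl⟩
    · exact ⟨_, M.tail_rot _, rfl⟩
    · exact ⟨_, by rw [M.tail_rot, M.tail_rot], rfl⟩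

theorem Tri.degreeThree {v : V} (h : M.Tri v) : (M.primal.neighborSet v).ncard = 3 := by
  obtain ⟨d, rfl⟩ := M.tail_surjective v
  have : M.primal.neighborSet (M.tail d) = {M.tail (M.rev d), M.tail (M.rev (M.rot d)),
      M.tail (M.rev (M.rot (M.rot d)))} := by
    ext w
    simp only [SimpleGraph.mem_neighborSet, primal_adj, Set.mem_insert_iff,
      Set.mem_singleton_iff]
    constructor
    · rintro ⟨e, he, rfl⟩
      rcases h.cases he with rfl | rfl | rfl <;> simp
    · rintro (rfl | rfl | rfl)
      · exact ⟨_, rfl, rfl⟩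
      · exact ⟨_, M.tail_rot _, rfl⟩
      · exact ⟨_, by rw [M.tail_rot, M.tail_rot], rfl⟩
  rw [this, Set.ncard_eq_three]
  refine ⟨_, _, _, ?_, ?_, ?_, rfl⟩
  · intro h1
    exact M.rot_ne d (M.tail_injective (M.tail_rot d).symm h1).symm
  · intro h1
    exact M.rot_rot_ne d (M.tail_injective (by simp only [M.tail_rot]) h1).symm
  · intro h1
    exact M.rot_ne _ (M.tail_injective (by simp only [M.tail_rot]) h1).symm

theorem tri_of_ncard {v : V} (h : (M.primal.neighborSet v).ncard = 3) : M.Tri v := by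
  intro d hd
  by_contra hne
  have key : ∀ e, M.tail e = v → M.tail (M.rev e) ∈ M.primal.neighborSet v := by
    rintro e rfl
    exact M.primal_adj_rev e
  have hfin : (M.primal.neighborSet v).Finite := Set.finite_of_ncard_ne_zero (by omega)
  have hsub : ({M.tail (M.rev d), M.tail (M.rev (M.rot d)), M.tail (M.rev (M.rot (M.rot d))),
      M.tail (M.rev (M.rot (M.rot (M.rot d))))} : Set V) ⊆ M.primal.neighborSet v := by
    rintro w (rfl | rfl | rfl | rfl) <;> apply key <;> simp only [M.tail_rot, hd]
  have := Set.ncard_le_ncard hsub hfin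
  have ne : ∀ a b, M.tail a = v → M.tail b = v → a ≠ b → M.tail (M.rev a) ≠ M.tail (M.rev b) :=
    fun a b ha hb hab h => hab (M.tail_injective (ha.trans hb.symm) h)
  rw [Set.ncard_insert_of_notMem, Set.ncard_insert_of_notMem, Set.ncard_insert_of_notMem,
    Set.ncard_singleton] at this
  · omega
  · rw [Set.mem_singleton_iff]
    exact ne _ _ (by simp only [M.tail_rot, hd]) (by simp only [M.tail_rot, hd])
      (M.rot_ne _).symm
  · simp only [Set.mem_insert_iff, Set.mem_singleton_iff, not_or]
    refine ⟨ne _ _ ?_ ?_ (M.rot_ne _).symm, ne _ _ ?_ ?_ (M.rot_rot_ne _).symm⟩ <;>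
    simp only [M.tail_rot, hd]
  · simp only [Set.mem_insert_iff, Set.mem_singleton_iff, not_or]
    refine ⟨ne _ _ ?_ ?_ (M.rot_ne _).symm, ne _ _ ?_ ?_ (M.rot_rot_ne _).symm,
      ne _ _ ?_ ?_ (Ne.symm hne)⟩ <;>
    simp only [M.tail_rot, hd]

/-- Two vertices of degree three on the same faces are equal. -/
theorem Tri.eq_of_inc {v w : V} (hv : M.Tri v) (hw : M.Tri w)
    (h : ∀ f, M.Inc v f ↔ M.Inc w f) : v = w := by
  obtain ⟨d, rfl⟩ := M.tail_surjective v
  obtain ⟨e, rfl, he⟩ := (h (M.left d)).1 (M.inc_left d)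
  have l1 := M.left_rot d
  have l2 := M.left_rot (M.rot d)
  have l3 := M.left_rot (M.rot (M.rot d))
  have m1 := M.left_rot e
  have m2 := M.left_rot (M.rot e)
  have m3 := M.left_rot (M.rot (M.rot e))
  rw [hv d rfl] at l3
  rw [hw e rfl] at m3
  have d1 : M.left (M.rot d) ≠ M.left d := fun h => M.rot_ne d (M.corner _ _ (M.tail_rot d) h)
  have d2 : M.left (M.rot (M.rot d)) ≠ M.left d := fun h =>
    M.rot_rot_ne d (M.corner _ _ (by simp only [M.tail_rot]) h)
  have d3 : M.left (M.rot (M.rot d)) ≠ M.left (M.rot d) := fun h =>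
    M.rot_ne _ (M.corner _ _ (M.tail_rot _) h)
  -- The three common faces appear around the two vertices in the same or in the opposite cyclic
  -- order. In the same order, `d` and `e` have the same sides. In the opposite order, `d` and `rot
  -- d` are reversals of darts at the other vertex, hence parallel edges.
  rcases hw.inc_iff.1 ((h _).1 (hv.inc_iff.2 (.inr (.inl rfl)))) with h1 | h1 | h1
  · exact absurd (h1.trans he) d1
  · rw [M.left_injective d e he.symm (by rw [← l1, ← m1, h1])]
  · rcases hw.inc_iff.1 ((h _).1 (hv.inc_iff.2 (.inr (.inr rfl)))) with h2 | h2 | h2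
    · exact absurd (h2.trans he) d2
    · have a1 : M.rev d = M.rot (M.rot e) := M.left_injective _ _ (by rw [← l1, h1])
        (by rw [M.rev_rev, ← m3, he])
      have a2 : M.rev (M.rot d) = M.rot e := M.left_injective _ _ (by rw [← l2, h2])
        (by rw [M.rev_rev, ← m2, h1])
      exact absurd (M.tail_injective (d := d) (e := M.rot d) (M.tail_rot d).symm
        (by rw [a1, a2, M.tail_rot])).symm (M.rot_ne d)
    · exact absurd (h2.trans h1.symm) d3

end PolyMap

namespace PolyMap

/-! ### Truncating a vertex of degree three -/

section Trunc

open Classical in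
/-- The tails of the darts after truncating `t`: each dart at `t` gets its own vertex. -/
noncomputable def truncTail {D V F : Type} (M : PolyMap D V F) (t : V) :
    D ⊕ {d // M.tail d = t} × Bool → {v // v ≠ t} ⊕ {d // M.tail d = t}
  | .inl d => if h : M.tail d = t then .inr ⟨d, h⟩ else .inl ⟨M.tail d, h⟩
  | .inr e => .inr e.1

/-- The faces to the left of the darts after truncating `t`. -/
def truncLeft {D V F : Type} (M : PolyMap D V F) (t : V) :
    D ⊕ {d // M.tail d = t} × Bool → Option F
  | .inl d => some (M.left d)
  | .inr (e, false) => some (M.left (M.rot e.1))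
  | .inr (_, true) => none

variable {D V F : Type} (M : PolyMap D V F) (t : V)

/-- Rotation on the darts at `t`. -/
def rotAt : Equiv.Perm {d // M.tail d = t} :=
  M.rot.subtypePerm fun d => by rw [M.tail_rot]

theorem rotAt_coe (e : {d // M.tail d = t}) : (M.rotAt t e).1 = M.rot e.1 := rfl

/-- The reversal of darts after truncating `t`. -/
def truncRev : D ⊕ {d // M.tail d = t} × Bool → D ⊕ {d // M.tail d = t} × Bool
  -- The dart `(e, false)` runs along the new triangle from the corner `e` to the corner `rot e`,
  -- with the old face between these two darts on its left. The dart `(e, true)` runs to the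
  -- preceding corner, with the new face on its left.
  | .inl d => .inl (M.rev d)
  | .inr (e, false) => .inr (M.rotAt t e, true)
  | .inr (e, true) => .inr ((M.rotAt t).symm e, false)

open Classical in
/-- The rotation of darts after truncating `t`. -/
noncomputable def truncRot : Equiv.Perm (D ⊕ {d // M.tail d = t} × Bool) where
  toFun
    | .inl d => if h : M.tail d = t then .inr (⟨d, h⟩, false) else .inl (M.rot d)
    | .inr (e, false) => .inr (e, true)
    | .inr (e, true) => .inl e.1
  invFun
    | .inl d => if h : M.tail d = t then .inr (⟨d, h⟩, true) else .inl (M.rot.symm d)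
    | .inr (e, true) => .inr (e, false)
    | .inr (e, false) => .inl e.1
  left_inv := by
    rintro (d | ⟨e, _ | _⟩)
    · by_cases h : M.tail d = t <;> simp [h, M.tail_rot]
    · rfl
    · simp [e.2]
  right_inv := by
    rintro (d | ⟨e, _ | _⟩)
    · by_cases h : M.tail d = t
      · simp [h]
      · have : M.tail (M.rot.symm d) ≠ t := by rwa [← M.tail_rot, Equiv.apply_symm_apply]
        simp [h, this]
    · simp [e.2]
    · rfl

variable {M t}

theorem truncTail_inl_of_ne {d : D} (h : M.tail d ≠ t) :
    M.truncTail t (.inl d) = .inl ⟨M.tail d, h⟩ := by simp [truncTail, h]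

theorem truncTail_inl {d : D} (h : M.tail d = t) :
    M.truncTail t (.inl d) = .inr ⟨d, h⟩ := by simp [truncTail, h]

theorem truncTail_inr (e) : M.truncTail t (.inr e) = .inr e.1 := rfl

theorem truncRot_inl_of_ne {d : D} (h : M.tail d ≠ t) :
    M.truncRot t (.inl d) = .inl (M.rot d) := by simp [truncRot, h]

theorem truncRot_inl {d : D} (h : M.tail d = t) :
    M.truncRot t (.inl d) = .inr (⟨d, h⟩, false) := by simp [truncRot, h]

theorem truncRot_false (e) : M.truncRot t (.inr (e, false)) = .inr (e, true) := rfl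

theorem truncRot_true (e) : M.truncRot t (.inr (e, true)) = .inl e.1 := rfl

theorem truncRev_rev (x) : M.truncRev t (M.truncRev t x) = x := by
  rcases x with (d | ⟨e, _ | _⟩) <;> simp [truncRev, M.rev_rev]

theorem truncTail_rot (x) : M.truncTail t (M.truncRot t x) = M.truncTail t x := by
  rcases x with (d | ⟨e, _ | _⟩)
  · by_cases h : M.tail d = t
    · rw [truncRot_inl h, truncTail_inl h]; rfl
    · rw [truncRot_inl_of_ne h, truncTail_inl_of_ne h,
        truncTail_inl_of_ne (by rwa [M.tail_rot])]
      simp only [M.tail_rot]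
  · rfl
  · rw [truncRot_true, truncTail_inl e.2]; rfl

theorem truncLeft_rot (x) :
    M.truncLeft t (M.truncRot t x) = M.truncLeft t (M.truncRev t x) := by
  rcases x with (d | ⟨e, _ | _⟩)
  · by_cases h : M.tail d = t
    · rw [truncRot_inl h]; simp [truncLeft, truncRev, M.left_rot]
    · rw [truncRot_inl_of_ne h]; simp [truncLeft, truncRev, M.left_rot]
  · rfl
  · rw [truncRot_true]
    simp only [truncLeft, truncRev, ← rotAt_coe, Equiv.apply_symm_apply]

theorem trunc_orbit_inr (e : {d // M.tail d = t}) (b : Bool) :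
    SameOrbit (M.truncRot t) (.inl e.1) (.inr (e, b)) := by
  have h1 := SameOrbit.apply (M.truncRot t) (.inl e.1)
  rw [truncRot_inl e.2] at h1
  cases b
  · exact h1
  · exact h1.trans _ _ _ (SameOrbit.apply (M.truncRot t) (.inr (e, false)))

theorem trunc_orbit_inl {d e : D} (h : SameOrbit M.rot d e) (hd : M.tail d ≠ t) :
    SameOrbit (M.truncRot t) (.inl d) (.inl e) := by
  induction h with
  | rel a b hab =>
    rw [← hab, ← truncRot_inl_of_ne hd]
    exact SameOrbit.apply _ _
  | refl => exact .refl _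
  | symm a b h ih => exact .symm _ _ (ih (by rwa [SameOrbit.eq M.tail_rot h]))
  | trans a b c h _ ih ih' =>
    exact .trans _ _ _ (ih hd) (ih' (by rwa [← SameOrbit.eq M.tail_rot h]))

theorem trunc_tail_orbit (x y) (h : M.truncTail t x = M.truncTail t y) :
    SameOrbit (M.truncRot t) x y := by
  have key : ∀ x, (∃ d, M.tail d ≠ t ∧ x = .inl d) ∨ ∃ e : {d // M.tail d = t},
      M.truncTail t x = .inr e ∧ SameOrbit (M.truncRot t) (.inl e.1) x := by
    rintro (d | ⟨e, b⟩)
    · by_cases h : M.tail d = t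
      · exact .inr ⟨⟨d, h⟩, truncTail_inl h, .refl _⟩
      · exact .inl ⟨d, h, rfl⟩
    · exact .inr ⟨e, rfl, trunc_orbit_inr e b⟩
  rcases key x with ⟨d, hd, rfl⟩ | ⟨e, he, hx⟩ <;>
  rcases key y with ⟨d', hd', rfl⟩ | ⟨e', he', hy⟩
  · rw [truncTail_inl_of_ne hd, truncTail_inl_of_ne hd', Sum.inl.injEq, Subtype.mk.injEq] at h
    exact trunc_orbit_inl (M.tail_orbit _ _ h) hd
  · rw [truncTail_inl_of_ne hd, he'] at h; cases h
  · rw [truncTail_inl_of_ne hd', he] at h; cases h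
  · rw [he, he'] at h; cases h
    exact .trans _ _ _ (.symm _ _ hx) hy

/-- A step along an old face lifts to a single step, or to two steps where the face passes through
`t` and has gained an edge of the new triangle. -/
theorem trunc_face_inl {d e : D} (h : SameOrbit (fun a => M.rot (M.rev a)) d e) :
    SameOrbit (fun a => M.truncRot t (M.truncRev t a)) (.inl d) (.inl e) := by
  induction h with
  | rel a b hab =>
    subst hab
    by_cases h : M.tail (M.rev a) = t
    · have h1 := SameOrbit.apply (fun a => M.truncRot t (M.truncRev t a)) (.inl a)
      have h2 := SameOrbit.apply (fun a => M.truncRot t (M.truncRev t a)) (.inr (⟨_, h⟩, false))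
      simp only [truncRev, truncRot_inl h] at h1
      exact h1.trans _ _ _ h2
    · have h1 := SameOrbit.apply (fun a => M.truncRot t (M.truncRev t a)) (.inl a)
      simp only [truncRev, truncRot_inl_of_ne h] at h1
      exact h1
  | refl => exact .refl _
  | symm _ _ _ ih => exact .symm _ _ ih
  | trans _ _ _ _ _ ih ih' => exact .trans _ _ _ ih ih'

theorem rotAt_orbit (e e' : {d // M.tail d = t}) : SameOrbit (M.rotAt t) e e' := by
  have := M.tail_orbit e.1 e'.1 (e.2.trans e'.2.symm)
  have key : ∀ d d', SameOrbit M.rot d d' → ∀ (h : M.tail d = t) (h' : M.tail d' = t),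
      SameOrbit (M.rotAt t) ⟨d, h⟩ ⟨d', h'⟩ := by
    intro d d' hd
    induction hd with
    | rel a b hab => intro h h'; exact .rel _ _ (Subtype.ext hab)
    | refl => intro _ _; exact .refl _
    | symm _ _ _ ih => intro h h'; exact .symm _ _ (ih h' h)
    | trans _ _ _ h1 _ ih ih' =>
      intro h h'
      have h2 := (SameOrbit.eq M.tail_rot h1).symm.trans h
      exact .trans _ _ _ (ih h h2) (ih' h2 h')
  exact key _ _ this _ _

theorem trunc_left_orbit (x y) (h : M.truncLeft t x = M.truncLeft t y) :
    SameOrbit (fun a => M.truncRot t (M.truncRev t a)) x y := by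
  have key : ∀ x, (∃ e, x = .inr (e, true)) ∨ ∃ d, M.truncLeft t x = some (M.left d) ∧
      SameOrbit (fun a => M.truncRot t (M.truncRev t a)) (.inl d) x := by
    rintro (d | ⟨e, _ | _⟩)
    · exact .inr ⟨d, rfl, .refl _⟩
    · exact .inr ⟨M.rot e.1, rfl, .symm _ _ (.rel _ _ rfl)⟩
    · exact .inl ⟨e, rfl⟩
  rcases key x with ⟨e, rfl⟩ | ⟨d, hd, hx⟩ <;> rcases key y with ⟨e', rfl⟩ | ⟨d', hd', hy⟩
  · have := rotAt_orbit e e'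
    clear h
    induction this with
    | rel a b hab =>
      -- The new face is traversed against the rotation at `t`.
      refine .symm _ _ (.rel _ _ ?_)
      rw [← hab]
      simp [truncRev, truncRot_false]
    | refl => exact .refl _
    | symm _ _ _ ih => exact .symm _ _ ih
    | trans _ _ _ _ _ ih ih' => exact .trans _ _ _ ih ih'
  · rw [hd'] at h; cases h
  · rw [hd] at h; cases h
  · rw [hd, hd', Option.some.injEq] at h
    exact .trans _ _ _ (.symm _ _ hx) (.trans _ _ _ (trunc_face_inl (M.left_orbit _ _ h)) hy)

theorem trunc_inc_inl {v : {v // v ≠ t}} {f : Option F} :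
    (∃ x, M.truncTail t x = .inl v ∧ M.truncLeft t x = f) ↔ ∃ g, f = some g ∧ M.Inc v.1 g := by
  constructor
  · rintro ⟨d | ⟨e, b⟩, hx, rfl⟩
    · by_cases h : M.tail d = t
      · rw [truncTail_inl h] at hx; cases hx
      · rw [truncTail_inl_of_ne h] at hx; cases hx
        exact ⟨_, rfl, M.inc_left d⟩
    · cases hx
  · rintro ⟨g, rfl, d, hd, rfl⟩
    exact ⟨.inl d, by rw [truncTail_inl_of_ne (by rw [hd]; exact v.2)]; simp [hd], rfl⟩

theorem trunc_inc_inr {e : {d // M.tail d = t}} {f : Option F} :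
    (∃ x, M.truncTail t x = .inr e ∧ M.truncLeft t x = f) ↔
      f = none ∨ f = some (M.left e.1) ∨ f = some (M.left (M.rot e.1)) := by
  constructor
  · rintro ⟨d | ⟨e, _ | _⟩, hx, rfl⟩
    · by_cases h : M.tail d = t
      · rw [truncTail_inl h] at hx; cases hx
        exact .inr (.inl rfl)
      · rw [truncTail_inl_of_ne h] at hx; cases hx
    · cases hx; exact .inr (.inr rfl)
    · exact .inl rfl
  · rintro (rfl | rfl | rfl)
    · exact ⟨.inr (e, true), rfl, rfl⟩
    · exact ⟨.inl e.1, truncTail_inl e.2, rfl⟩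
    · exact ⟨.inr (e, false), rfl, rfl⟩

theorem trunc_rot_rot_ne (x) : M.truncRot t (M.truncRot t x) ≠ x := by
  rcases x with (d | ⟨e, _ | _⟩)
  · by_cases h : M.tail d = t
    · rw [truncRot_inl h, truncRot_false]; simp
    · rw [truncRot_inl_of_ne h, truncRot_inl_of_ne (by rwa [M.tail_rot])]
      simp [M.rot_rot_ne]
  · simp [truncRot_false, truncRot_true]
  · simp [truncRot_true, truncRot_inl e.2]

theorem trunc_corner (x y) (h : M.truncTail t x = M.truncTail t y)
    (h' : M.truncLeft t x = M.truncLeft t y) : x = y := by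
  have key : ∀ (d : D) (e : {d // M.tail d = t}), M.truncTail t (.inl d) = .inr e → d = e.1 := by
    intro d e h
    by_cases hd : M.tail d = t
    · rw [truncTail_inl hd] at h; cases h; rfl
    · rw [truncTail_inl_of_ne hd] at h; cases h
  rcases x with (d | ⟨e, _ | _⟩) <;> rcases y with (d' | ⟨e', _ | _⟩)
  · by_cases hd : M.tail d = t
    · rw [truncTail_inl hd] at h
      rw [key d' _ h.symm]
    · rw [truncTail_inl_of_ne hd] at h
      by_cases hd' : M.tail d' = t
      · rw [truncTail_inl hd'] at h; cases h
      · rw [truncTail_inl_of_ne hd', Sum.inl.injEq, Subtype.mk.injEq] at h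
        rw [M.corner d d' h (Option.some.inj h')]
  · have := key _ _ h
    subst this
    exact absurd (M.corner _ _ (M.tail_rot _).symm (Option.some.inj h')) (M.rot_ne _).symm
  · cases h'
  · have := key _ _ h.symm
    subst this
    exact absurd (M.corner _ _ (M.tail_rot _) (Option.some.inj h')) (M.rot_ne _)
  · cases h; rfl
  · cases h'
  · cases h'
  · cases h'
  · cases h; rfl

theorem trunc_left_injective (x y) (h : M.truncLeft t x = M.truncLeft t y)
    (h' : M.truncLeft t (M.truncRev t x) = M.truncLeft t (M.truncRev t y)) : x = y := by
  have key : ∀ e e' : {d // M.tail d = t}, M.left (M.rot e.1) = M.left (M.rot e'.1) → e = e' := by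
    intro e e' he
    exact Subtype.ext (M.rot.injective (M.corner _ _
      (by rw [M.tail_rot, M.tail_rot, e.2, e'.2]) he))
  rcases x with (d | ⟨e, _ | _⟩) <;> rcases y with (d' | ⟨e', _ | _⟩) <;>
    simp only [truncLeft, truncRev, Option.some.injEq, reduceCtorEq] at h h'
  · rw [M.left_injective _ _ h h']
  · rw [key _ _ h]
  · rw [(M.rotAt t).symm.injective (key _ _ h')]

/-- The labels of the vertices before truncation. -/
def untrunc : {v // v ≠ t} ⊕ {d // M.tail d = t} → V
  | .inl v => v.1
  | .inr _ => t

theorem untrunc_tail (x : D) : untrunc (M.truncTail t (.inl x)) = M.tail x := by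
  by_cases h : M.tail x = t
  · rw [truncTail_inl h, h]; rfl
  · rw [truncTail_inl_of_ne h]; rfl

theorem trunc_chord_inc {x : D} {f : Option F}
    (h : ∃ y, M.truncTail t y = M.truncTail t (.inl x) ∧ M.truncLeft t y = f) :
    (f = none ∧ M.tail x = t) ∨ ∃ g, f = some g ∧ M.Inc (M.tail x) g := by
  by_cases hx : M.tail x = t
  · rw [truncTail_inl hx, trunc_inc_inr] at h
    rcases h with rfl | rfl | rfl
    · exact .inl ⟨rfl, hx⟩
    · exact .inr ⟨_, rfl, M.inc_left x⟩
    · exact .inr ⟨_, rfl, ⟨_, M.tail_rot _, rfl⟩⟩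
  · rw [truncTail_inl_of_ne hx, trunc_inc_inl] at h
    exact .inr h

theorem trunc_chord (x) (f : Option F)
    (h : ∃ y, M.truncTail t y = M.truncTail t x ∧ M.truncLeft t y = f)
    (h' : ∃ y, M.truncTail t y = M.truncTail t (M.truncRev t x) ∧ M.truncLeft t y = f) :
    M.truncLeft t x = f ∨ M.truncLeft t (M.truncRev t x) = f := by
  -- An old face at both the corner `e` and the corner `rot e` is the one between these darts: the
  -- other two candidates are the sectors starting at `e` and at `rot (rot e)`, which are different
  -- corners at `t` and so on different faces.
  have key : ∀ e : {d // M.tail d = t}, (f = some (M.left e.1) ∨ f = some (M.left (M.rot e.1))) →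
      (f = some (M.left (M.rot e.1)) ∨ f = some (M.left (M.rot (M.rot e.1)))) →
      f = some (M.left (M.rot e.1)) := by
    rintro e (rfl | rfl) (h | h)
    · exact h
    · exact absurd (M.corner _ _ (by simp only [M.tail_rot]) (Option.some.inj h)).symm
        (M.rot_rot_ne _)
    · rfl
    · rfl
  rcases x with (d | ⟨e, _ | _⟩)
  · rcases trunc_chord_inc h with ⟨rfl, hd⟩ | ⟨g, rfl, hg⟩
    · rcases trunc_chord_inc h' with ⟨_, hd'⟩ | ⟨g, hg, _⟩
      · exact absurd (hd'.trans hd.symm) (M.tail_rev_ne d)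
      · cases hg
    · rcases trunc_chord_inc h' with ⟨hg, _⟩ | ⟨g, hg', hg''⟩
      · cases hg
      · cases hg'
        exact (M.chord d g hg hg'').imp (congrArg some) (congrArg some)
  · simp only [truncRev, truncTail_inr, trunc_inc_inr, rotAt_coe] at h h'
    rcases h with rfl | h
    · exact .inr rfl
    · rcases h' with rfl | h'
      · exact .inr rfl
      · exact .inl (key e h h').symm
  · simp only [truncRev, truncTail_inr, trunc_inc_inr] at h h'
    rcases h with rfl | h
    · exact .inl rfl
    · rcases h' with rfl | h'
      · exact .inl rfl
      · right
        have h1 := key ((M.rotAt t).symm e) h' (by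
          rw [← rotAt_coe M t ((M.rotAt t).symm e), Equiv.apply_symm_apply]; exact h)
        exact h1.symm

/-- Adjacency of vertices after truncation. -/
def truncAdj (M : PolyMap D V F) (t : V) (a b : {v // v ≠ t} ⊕ {d // M.tail d = t}) : Prop :=
  ∃ x, M.truncTail t x = a ∧ M.truncTail t (M.truncRev t x) = b

/-- If no new vertex is removed, contract the triangle to `t`: the fibres of `untrunc` are connected
and every old edge lifts. -/
theorem trunc_joined_of_notMem {S : Set ({v // v ≠ t} ⊕ {d // M.tail d = t})}
    (hS : Joined (fun a b => ∃ d, M.tail d = a ∧ M.tail (M.rev d) = b)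
      {v | ∃ h : v ≠ t, .inl ⟨v, h⟩ ∈ S})
    (ht : ∀ e, .inr e ∉ S) : Joined (M.truncAdj t) S := by
  have fib : ∀ a b, untrunc a = untrunc b →
      Relation.EqvGen (fun a b => a ∉ S ∧ b ∉ S ∧ M.truncAdj t a b) a b := by
    rintro (a | e) (b | e') h
    · rw [show a = b from Subtype.ext h]; exact .refl _
    · exact absurd h a.2
    · exact absurd h.symm b.2
    · clear h
      have := rotAt_orbit e e'
      induction this with
      | rel a b hab =>
        refine .rel _ _ ⟨ht _, ht _, .inr (a, false), rfl, ?_⟩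
        rw [← hab]; rfl
      | refl => exact .refl _
      | symm _ _ _ ih => exact .symm _ _ ih
      | trans _ _ _ _ _ ih ih' => exact .trans _ _ _ ih ih'
  have notMem : ∀ a, a ∉ S ↔ untrunc a ∉ {v | ∃ h : v ≠ t, .inl ⟨v, h⟩ ∈ S} := by
    rintro (a | e)
    · simp [untrunc, a.2]
    · simp [untrunc, ht e]
  have sur : ∀ v, ∃ a : {v // v ≠ t} ⊕ {d // M.tail d = t}, untrunc a = v := by
    intro v
    obtain ⟨d, rfl⟩ := M.tail_surjective v
    exact ⟨_, untrunc_tail d⟩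
  have key : ∀ v w, Relation.EqvGen (fun a b => a ∉ {v | ∃ h : v ≠ t, .inl ⟨v, h⟩ ∈ S} ∧
      b ∉ {v | ∃ h : v ≠ t, .inl ⟨v, h⟩ ∈ S} ∧ ∃ d, M.tail d = a ∧ M.tail (M.rev d) = b) v w →
      ∀ a b, untrunc a = v → untrunc b = w →
      Relation.EqvGen (fun a b => a ∉ S ∧ b ∉ S ∧ M.truncAdj t a b) a b := by
    intro v w h
    induction h with
    | rel v w h =>
      obtain ⟨h1, h2, d, rfl, rfl⟩ := h
      intro a b ha hb
      refine .trans _ _ _ (fib a _ (ha.trans (untrunc_tail d).symm)) (.trans _ _ _ (.rel _ _ ?_)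
        (fib _ b ((untrunc_tail (M.rev d)).trans hb.symm)))
      exact ⟨by rwa [notMem, untrunc_tail], by rwa [notMem, untrunc_tail], .inl d, rfl, rfl⟩
    | refl => intro a b ha hb; exact fib _ _ (ha.trans hb.symm)
    | symm _ _ _ ih => intro a b ha hb; exact .symm _ _ (ih b a hb ha)
    | trans v w _ _ _ ih ih' =>
      intro a b ha hb
      obtain ⟨c, hc⟩ := sur w
      exact .trans _ _ _ (ih a c ha hc) (ih' c b hc hb)
  intro a b ha hb
  exact key _ _ (hS _ _ ((notMem a).1 ha) ((notMem b).1 hb)) a b rfl rfl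

/-- The counterpart with `t` removed from the old graph. Each surviving new vertex is reattached by
its outer edge, whose far end is kept by `ht`. -/
theorem trunc_joined_of_mem {S : Set ({v // v ≠ t} ⊕ {d // M.tail d = t})}
    (hS : Joined (fun a b => ∃ d, M.tail d = a ∧ M.tail (M.rev d) = b)
      {v | ∀ h : v ≠ t, .inl ⟨v, h⟩ ∈ S})
    (ht : ∀ e, .inr e ∉ S → M.truncTail t (.inl (M.rev e.1)) ∉ S) : Joined (M.truncAdj t) S := by
  have hh : ∀ e : {d // M.tail d = t}, M.tail (M.rev e.1) ≠ t := fun e h =>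
    M.tail_rev_ne e.1 (h.trans e.2.symm)
  have step : ∀ a, a ∉ S → ∃ v : {v // v ≠ t}, .inl v ∉ S ∧
      Relation.EqvGen (fun a b => a ∉ S ∧ b ∉ S ∧ M.truncAdj t a b) a (.inl v) := by
    rintro (v | e) ha
    · exact ⟨v, ha, .refl _⟩
    · have h1 := ht e ha
      refine ⟨⟨_, hh e⟩, by rwa [truncTail_inl_of_ne (hh e)] at h1, .rel _ _ ⟨ha, ?_, ?_⟩⟩
      · rwa [truncTail_inl_of_ne (hh e)] at h1
      · exact ⟨.inl e.1, truncTail_inl e.2, truncTail_inl_of_ne (hh e)⟩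
  have key : ∀ v w, Relation.EqvGen (fun a b => a ∉ {v | ∀ h : v ≠ t, .inl ⟨v, h⟩ ∈ S} ∧
      b ∉ {v | ∀ h : v ≠ t, .inl ⟨v, h⟩ ∈ S} ∧ ∃ d, M.tail d = a ∧ M.tail (M.rev d) = b) v w →
      (v = t ↔ w = t) ∧ ∀ (hv : v ≠ t) (hw : w ≠ t), Relation.EqvGen
        (fun a b => a ∉ S ∧ b ∉ S ∧ M.truncAdj t a b) (.inl ⟨v, hv⟩) (.inl ⟨w, hw⟩) := by
    intro v w h
    induction h with
    | rel v w h =>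
      simp only [Set.mem_ofPred_eq, not_forall] at h
      obtain ⟨⟨hv, hv'⟩, ⟨hw, hw'⟩, d, rfl, rfl⟩ := h
      refine ⟨by simp [hv, hw], fun _ _ => .rel _ _ ⟨hv', hw', .inl d, ?_, ?_⟩⟩
      · exact truncTail_inl_of_ne hv
      · exact truncTail_inl_of_ne hw
    | refl => exact ⟨Iff.rfl, fun _ _ => .refl _⟩
    | symm _ _ _ ih => exact ⟨ih.1.symm, fun hv hw => .symm _ _ (ih.2 hw hv)⟩
    | trans _ w _ _ _ ih ih' =>
      exact ⟨ih.1.trans ih'.1, fun hv hw => .trans _ _ _ (ih.2 hv (ih.1.not.1 hv))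
        (ih'.2 (ih.1.not.1 hv) hw)⟩
  intro a b ha hb
  obtain ⟨v, hv, hav⟩ := step a ha
  obtain ⟨w, hw, hbw⟩ := step b hb
  refine .trans _ _ _ hav (.trans _ _ _ ?_ (.symm _ _ hbw))
  exact (key v w (hS _ _ (fun h => hv (h v.2)) (fun h => hw (h w.2)))).2 v.2 w.2

theorem trunc_joined_vertex (v) : Joined (M.truncAdj t) {v} := by
  rcases v with v | e
  · refine trunc_joined_of_notMem ?_ (by simp)
    convert M.joined_vertex v.1 using 1
    ext w
    simp only [Set.mem_singleton_iff, Set.mem_ofPred_eq, Sum.inl.injEq]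
    exact ⟨fun ⟨_, h⟩ => congrArg Subtype.val h, fun h => ⟨h ▸ v.2, Subtype.ext h⟩⟩
  · refine trunc_joined_of_mem ?_ ?_
    · convert M.joined_vertex t using 1
      ext w
      simp
    · intro e' _
      rw [truncTail_inl_of_ne fun h => M.tail_rev_ne e'.1 (h.trans e'.2.symm)]
      simp

theorem trunc_joined_face (f : Option F) : Joined (M.truncAdj t)
    {v | ∃ x, M.truncTail t x = v ∧ M.truncLeft t x = f} := by
  have hh : ∀ e : {d // M.tail d = t}, M.tail (M.rev e.1) ≠ t := fun e h =>
    M.tail_rev_ne e.1 (h.trans e.2.symm)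
  rcases f with _ | f
  · refine trunc_joined_of_mem ?_ ?_
    -- All new vertices lie on the new face, so off this face there remains the old graph without
    -- `t`.
    · convert M.joined_vertex t using 1
      ext w
      simp only [Set.mem_ofPred_eq, trunc_inc_inl]
      simp
    · intro e he
      exact absurd (trunc_inc_inr.2 (.inl rfl)) he
  · by_cases ht : M.Inc t f
    · refine trunc_joined_of_mem ?_ ?_
      · convert M.joined_face f using 1
        ext w
        simp only [Set.mem_ofPred_eq, trunc_inc_inl, Option.some.injEq, exists_eq_left']
        refine ⟨fun h => ?_, fun h _ => h⟩
        by_cases hw : w = t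
        · rw [hw]; exact ht
        · exact h hw
      -- A new vertex off `f` lies on an edge at `t` with `f` on neither side; by `chord` the far
      -- end of that edge is off `f` too.
      · intro e
        simp only [Set.mem_ofPred_eq, trunc_inc_inr, truncTail_inl_of_ne (hh e), trunc_inc_inl,
          Option.some.injEq, exists_eq_left', reduceCtorEq, false_or, not_or]
        rintro ⟨h1, h2⟩ h3
        rcases M.chord e.1 f (by rwa [e.2]) h3 with h | h
        · exact h1 h.symm
        · rw [← M.left_rot] at h; exact h2 h.symm
    · refine trunc_joined_of_notMem ?_ ?_
      · convert M.joined_face f using 1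
        ext w
        simp only [Set.mem_ofPred_eq, trunc_inc_inl, Option.some.injEq, exists_eq_left']
        refine ⟨fun ⟨_, h⟩ => h, fun h => ⟨?_, h⟩⟩
        rintro rfl
        exact ht h
      · intro e
        simp only [Set.mem_ofPred_eq, trunc_inc_inr, Option.some.injEq, reduceCtorEq, false_or]
        rintro (rfl | rfl)
        · exact ht ⟨e.1, e.2, rfl⟩
        · exact ht ⟨M.rot e.1, (M.tail_rot _).trans e.2, rfl⟩

theorem Tri.card (h : M.Tri t) : Nat.card {d // M.tail d = t} = 3 := by
  obtain ⟨d, rfl⟩ := M.tail_surjective t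
  have : {e | M.tail e = M.tail d} = {d, M.rot d, M.rot (M.rot d)} := by
    ext e
    simp only [Set.mem_ofPred_eq, Set.mem_insert_iff, Set.mem_singleton_iff]
    refine ⟨h.cases, ?_⟩
    rintro (rfl | rfl | rfl) <;> simp only [M.tail_rot]
  change Nat.card ({e | M.tail e = M.tail d} : Set D) = 3
  rw [Nat.card_coe_set_eq, this, Set.ncard_eq_three]
  exact ⟨_, _, _, (M.rot_ne d).symm, (M.rot_rot_ne d).symm, (M.rot_ne _).symm, rfl⟩

theorem finite_left (M : PolyMap D V F) : Finite F :=
  have := M.finite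
  Finite.of_surjective _ M.left_surjective

theorem finite_tail (M : PolyMap D V F) : Finite V :=
  have := M.finite
  Finite.of_surjective _ M.tail_surjective

/-- The truncation of a vertex of degree three. -/
noncomputable def trunc (M : PolyMap D V F) (t : V) (ht : M.Tri t) :
    PolyMap (D ⊕ {d // M.tail d = t} × Bool) ({v // v ≠ t} ⊕ {d // M.tail d = t})
      (Option F) where
  finite := by
    have := M.finite
    infer_instance
  rev := M.truncRev t
  rot := M.truncRot t
  tail := M.truncTail t
  left := M.truncLeft t
  rev_rev := truncRev_rev
  tail_rot := truncTail_rot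
  left_rot := truncLeft_rot
  tail_orbit := trunc_tail_orbit
  left_orbit := trunc_left_orbit
  tail_surjective := by
    rintro (v | e)
    · obtain ⟨d, hd⟩ := M.tail_surjective v.1
      exact ⟨.inl d, by rw [truncTail_inl_of_ne (hd ▸ v.2)]; simp [hd]⟩
    · exact ⟨.inl e.1, truncTail_inl e.2⟩
  left_surjective := by
    rintro (_ | f)
    · obtain ⟨d, hd⟩ := M.tail_surjective t
      exact ⟨.inr (⟨d, hd⟩, true), rfl⟩
    · obtain ⟨d, hd⟩ := M.left_surjective f
      exact ⟨.inl d, by rw [← hd]; rfl⟩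
  rot_rot_ne := trunc_rot_rot_ne
  corner := trunc_corner
  chord := trunc_chord
  left_injective := trunc_left_injective
  joined_empty := trunc_joined_of_notMem (by convert M.joined_empty using 1; simp) (by simp)
  joined_vertex := trunc_joined_vertex
  joined_face := trunc_joined_face
  -- There are two more vertices, one more face and six more darts.
  euler := by
    have := M.finite
    have := M.finite_left
    have := M.finite_tail
    have h1 : Nat.card {v // v ≠ t} + 1 = Nat.card V := by
      rw [← Finite.card_option]
      classical
      exact Nat.card_congr (Equiv.optionSubtypeNe t)
    rw [Nat.card_sum, Nat.card_sum, Nat.card_prod, ht.card, Finite.card_option]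
    have := M.euler
    simp only [Nat.card_eq_fintype_card, Fintype.card_bool] at *
    omega

/-- In the dual, truncation changes no old adjacency and adds one vertex `none`, joined to the three
faces around `t`: a tetrahedron on the triangle dual to `t`. -/
theorem trunc_dual_some (ht : M.Tri t) {f g : F} :
    (M.trunc t ht).dual.Adj (some f) (some g) ↔ M.dual.Adj f g := by
  constructor
  · rintro ⟨d | ⟨e, _ | _⟩, h1, h2⟩
    · cases h1; cases h2
      exact M.dual_adj_rev d
    · cases h2
    · cases h1
  · rintro ⟨d, rfl, rfl⟩
    exact ⟨.inl d, rfl, rfl⟩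

theorem trunc_dual_none (ht : M.Tri t) {g : F} :
    (M.trunc t ht).dual.Adj none (some g) ↔ M.Inc t g := by
  constructor
  · rintro ⟨d | ⟨e, _ | _⟩, h1, h2⟩
    · cases h1
    · cases h1
    · cases h2
      exact ⟨_, (M.tail_rot _).trans ((M.rotAt t).symm e).2, rfl⟩
  · rintro ⟨d, hd, rfl⟩
    refine ⟨.inr (⟨d, hd⟩, true), rfl, ?_⟩
    change some (M.left (M.rot ((M.rotAt t).symm ⟨d, hd⟩).1)) = _
    rw [← rotAt_coe, Equiv.apply_symm_apply]

theorem trunc_inc_some (ht : M.Tri t) {v : {v // v ≠ t}} {f : Option F} :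
    (M.trunc t ht).Inc (.inl v) f ↔ ∃ g, f = some g ∧ M.Inc v.1 g := trunc_inc_inl

theorem trunc_inc_new (ht : M.Tri t) {e : {d // M.tail d = t}} {f : Option F} :
    (M.trunc t ht).Inc (.inr e) f ↔
      f = none ∨ f = some (M.left e.1) ∨ f = some (M.left (M.rot e.1)) := trunc_inc_inr

theorem trunc_tri_old (ht : M.Tri t) {v : {v // v ≠ t}} :
    (M.trunc t ht).Tri (.inl v) ↔ M.Tri v.1 := by
  have key : ∀ d, M.tail d = v.1 → M.truncRot t (M.truncRot t (M.truncRot t (.inl d))) =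
      .inl (M.rot (M.rot (M.rot d))) := by
    intro d hd
    have h : M.tail d ≠ t := hd ▸ v.2
    rw [truncRot_inl_of_ne h, truncRot_inl_of_ne (by rwa [M.tail_rot]),
      truncRot_inl_of_ne (by rwa [M.tail_rot, M.tail_rot])]
  constructor
  · intro h d hd
    have h0 : M.truncTail t (.inl d) = .inl v := by
      rw [truncTail_inl_of_ne (hd ▸ v.2)]; simp [hd]
    have h1 := h (.inl d) h0
    exact Sum.inl_injective ((key d hd).symm.trans h1)
  · rintro h (d | e) hd
    · have hd : M.truncTail t (.inl d) = .inl v := hd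
      by_cases hdt : M.tail d = t
      · rw [truncTail_inl hdt] at hd; cases hd
      · rw [truncTail_inl_of_ne hdt] at hd; cases hd
        exact (key d rfl).trans (by rw [h d rfl])
    · cases hd

theorem trunc_tri_new (ht : M.Tri t) (e : {d // M.tail d = t}) : (M.trunc t ht).Tri (.inr e) := by
  have key : ∀ x, M.truncTail t x = .inr e →
      M.truncRot t (M.truncRot t (M.truncRot t x)) = x := by
    rintro (d | ⟨e, _ | _⟩) hd
    · by_cases hdt : M.tail d = t
      · rw [truncRot_inl hdt, truncRot_false, truncRot_true]
      · rw [truncTail_inl_of_ne hdt] at hd; cases hd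
    · rw [truncRot_false, truncRot_true, truncRot_inl e.2]
    · rw [truncRot_true, truncRot_inl e.2, truncRot_false]
  exact key

theorem trunc_primal_old (ht : M.Tri t) {v w : {v // v ≠ t}} :
    (M.trunc t ht).primal.Adj (.inl v) (.inl w) ↔ M.primal.Adj v.1 w.1 := by
  constructor
  · rintro ⟨d | e, h1, h2⟩
    · have h1 := (untrunc_tail d).symm.trans (congrArg untrunc h1)
      have h2 := (untrunc_tail (M.rev d)).symm.trans (congrArg untrunc h2)
      exact ⟨d, h1, h2⟩
    · cases h1
  · rintro ⟨d, h1, h2⟩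
    refine ⟨.inl d, ?_, ?_⟩
    · exact (truncTail_inl_of_ne (h1 ▸ v.2)).trans (by simp [h1])
    · exact (truncTail_inl_of_ne (h2 ▸ w.2)).trans (by simp [h2])

theorem trunc_primal_mixed (ht : M.Tri t) {v : {v // v ≠ t}} {e : {d // M.tail d = t}} :
    (M.trunc t ht).primal.Adj (.inr e) (.inl v) ↔ v.1 = M.tail (M.rev e.1) := by
  constructor
  · rintro ⟨d | ⟨e, _ | _⟩, h1, h2⟩
    · have h1 : M.truncTail t (.inl d) = .inr e := h1
      have h2 := (untrunc_tail (M.rev d)).symm.trans (congrArg untrunc h2)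
      by_cases hdt : M.tail d = t
      · rw [truncTail_inl hdt] at h1; cases h1
        exact h2.symm
      · rw [truncTail_inl_of_ne hdt] at h1; cases h1
    · cases h2
    · cases h2
  · intro h
    refine ⟨.inl e.1, truncTail_inl e.2, ?_⟩
    exact (truncTail_inl_of_ne (h ▸ v.2)).trans (by simp [← h])

theorem trunc_primal_new (ht : M.Tri t) {e e' : {d // M.tail d = t}} :
    (M.trunc t ht).primal.Adj (.inr e) (.inr e') ↔ e ≠ e' := by
  constructor
  · rintro h rfl
    exact h.ne rfl
  · intro h
    have h0 : M.Tri (M.tail e.1) := by rwa [e.2]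
    rcases h0.cases (e'.2.trans e.2.symm) with h1 | h1 | h1
    · exact absurd (Subtype.ext h1.symm) h
    · have : e' = M.rotAt t e := Subtype.ext h1
      subst this
      exact ⟨.inr (e, false), rfl, rfl⟩
    · have : M.rotAt t e' = e := Subtype.ext ((congrArg M.rot h1).trans (h0 _ rfl))
      subst this
      refine ⟨.inr (_, true), rfl, ?_⟩
      change Sum.inr ((M.rotAt t).symm _) = _
      rw [Equiv.symm_apply_apply]

end Trunc

end PolyMap

namespace PolyMap

/-! ### Splitting a triangular face -/

section Split

variable {D V F : Type} (M : PolyMap D V F) (d : D)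

/-- The face to the left of `d` is a triangle, and both ends of `d` have degree three. -/
structure Splittable : Prop where
  triangle : M.next (M.next (M.next d)) = d
  tri_tail : M.Tri (M.tail d)
  tri_head : M.Tri (M.tail (M.rev d))

/-- The reversal of darts after subdividing `d` by a new vertex and joining that vertex to the
opposite vertex of the triangle to the left of `d`. The new darts lead from the new vertex to the
tail of `d`, the head of `d`, the opposite vertex, and back from there. -/
noncomputable def splitRev : D ⊕ Bool × Bool → D ⊕ Bool × Bool
  | .inl e => open Classical in if e = d then .inr (false, false) else
      if e = M.rev d then .inr (false, true) else .inl (M.rev e)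
  | .inr (false, false) => .inl d
  | .inr (false, true) => .inl (M.rev d)
  | .inr (true, b) => .inr (true, !b)

/-- The tails of the darts after the split. -/
def splitTail : D ⊕ Bool × Bool → Option V
  | .inl e => some (M.tail e)
  | .inr (true, true) => some (M.tail (M.next (M.next d)))
  | .inr (true, false) => none
  | .inr (false, _) => none

/-- The faces to the left of the darts after the split. -/
noncomputable def splitLeft : D ⊕ Bool × Bool → Option F
  -- The triangle is cut in two. The half at the tail of `d` keeps the old label; the half at the
  -- head, bounded by `next d`, becomes `none`.
  | .inl e => open Classical in if e = M.next d then none else some (M.left e)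
  | .inr (false, false) => some (M.left (M.rev d))
  | .inr (true, false) => some (M.left d)
  | .inr (_, true) => none

/-- The rotation of the darts after the split. -/
noncomputable def splitRot : Equiv.Perm (D ⊕ Bool × Bool) where
  toFun
    | .inl e => open Classical in if e = M.rev (M.next d) then .inr (true, true) else .inl (M.rot e)
    | .inr (false, false) => .inr (true, false)
    | .inr (true, false) => .inr (false, true)
    | .inr (false, true) => .inr (false, false)
    | .inr (true, true) => .inl (M.next (M.next d))
  invFun
    | .inl e => open Classical in if e = M.next (M.next d) then .inr (true, true) else
        .inl (M.rot.symm e)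
    | .inr (true, false) => .inr (false, false)
    | .inr (false, true) => .inr (true, false)
    | .inr (false, false) => .inr (false, true)
    | .inr (true, true) => .inl (M.rev (M.next d))
  left_inv := by
    rintro (e | ⟨_ | _, _ | _⟩)
    · by_cases h : e = M.rev (M.next d)
      · simp [h]
      · have : M.rot e ≠ M.next (M.next d) := fun h' => h (M.rot.injective h')
        simp [h, this]
    all_goals simp
  right_inv := by
    rintro (e | ⟨_ | _, _ | _⟩)
    · by_cases h : e = M.next (M.next d)
      · simp [h]
      · have : M.rot.symm e ≠ M.rev (M.next d) := fun h' => h (by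
          rw [next, ← h', Equiv.apply_symm_apply])
        simp [h, this]
    all_goals simp

variable {M d}

theorem next_ne (d : D) : M.next d ≠ d := fun h => by
  have := M.tail_next d
  rw [h] at this
  exact M.tail_rev_ne d this.symm

theorem left_next_next (d : D) : M.left (M.next (M.next d)) = M.left d := by
  rw [M.left_next, M.left_next]

theorem ne_rev_of_left {d e : D} (h : M.left d = M.left e) : d ≠ M.rev e := fun h' =>
  M.left_rev_ne e (by rw [← h', h])

theorem splitRev_self : M.splitRev d (.inl d) = .inr (false, false) := by simp [splitRev]

theorem splitRev_rev : M.splitRev d (.inl (M.rev d)) = .inr (false, true) := by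
  simp [splitRev, M.rev_ne]

theorem splitRev_of_ne {e : D} (h : e ≠ d) (h' : e ≠ M.rev d) :
    M.splitRev d (.inl e) = .inl (M.rev e) := by simp [splitRev, h, h']

theorem splitLeft_next : M.splitLeft d (.inl (M.next d)) = none := by simp [splitLeft]

theorem splitLeft_of_ne {e : D} (h : e ≠ M.next d) :
    M.splitLeft d (.inl e) = some (M.left e) := by simp [splitLeft, h]

theorem splitRot_rev_next : M.splitRot d (.inl (M.rev (M.next d))) = .inr (true, true) := by
  simp [splitRot]

theorem splitRot_of_ne {e : D} (h : e ≠ M.rev (M.next d)) :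
    M.splitRot d (.inl e) = .inl (M.rot e) := by simp [splitRot, h]

theorem splitRev_splitRev (x) : M.splitRev d (M.splitRev d x) = x := by
  rcases x with (e | ⟨_ | _, _ | _⟩)
  · by_cases h : e = d
    · subst h; rw [splitRev_self]; rfl
    · by_cases h' : e = M.rev d
      · subst h'; rw [splitRev_rev]; rfl
      · rw [splitRev_of_ne h h', splitRev_of_ne, M.rev_rev]
        · rintro rfl; exact h' (M.rev_rev e).symm
        · exact fun h1 => h (M.rev_injective h1)
  · exact splitRev_self
  · exact splitRev_rev
  · rfl
  · rfl

theorem splitTail_rot (x) : M.splitTail d (M.splitRot d x) = M.splitTail d x := by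
  rcases x with (e | ⟨_ | _, _ | _⟩)
  · by_cases h : e = M.rev (M.next d)
    · subst h; rw [splitRot_rev_next]
      simp only [splitTail]
      rw [M.tail_next]
    · rw [splitRot_of_ne h]; simp only [splitTail, M.tail_rot]
  all_goals rfl

theorem splitLeft_rot (x) : M.splitLeft d (M.splitRot d x) = M.splitLeft d (M.splitRev d x) := by
  have n1 : d ≠ M.next d := (next_ne d).symm
  have n2 : M.rev d ≠ M.next d := (ne_rev_of_left (M.left_next d)).symm
  rcases x with (e | ⟨_ | _, _ | _⟩)
  · by_cases h : e = M.rev (M.next d)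
    · subst h
      rw [splitRot_rev_next, splitRev_of_ne, M.rev_rev, splitLeft_next]
      · rfl
      · exact (ne_rev_of_left (M.left_next d).symm).symm
      · exact fun h => n1 (M.rev_injective h).symm
    · rw [splitRot_of_ne h]
      by_cases h1 : e = d
      · subst h1
        rw [splitRev_self, splitLeft_of_ne, M.left_rot]
        · rfl
        · intro h2
          exact M.left_rev_ne e (by rw [← M.left_rot, h2, M.left_next])
      · by_cases h2 : e = M.rev d
        · subst h2
          rw [splitRev_rev]
          exact splitLeft_next
        · rw [splitRev_of_ne h1 h2, splitLeft_of_ne, splitLeft_of_ne, M.left_rot]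
          · rintro h3; exact h (by rw [← h3, M.rev_rev])
          · intro h3; exact h2 (M.rot.injective h3)
  · exact (splitLeft_of_ne n1).symm
  · exact (splitLeft_of_ne n2.symm.symm).symm
  · rfl
  · change M.splitLeft d (.inl (M.next (M.next d))) = some (M.left d)
    rw [splitLeft_of_ne (next_ne _), left_next_next]

theorem split_tail_orbit (x y) (h : M.splitTail d x = M.splitTail d y) :
    SameOrbit (M.splitRot d) x y := by
  have lift : ∀ e e', SameOrbit M.rot e e' → SameOrbit (M.splitRot d) (.inl e) (.inl e') := by
    intro e e' he
    induction he with
    | rel a b hab =>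
      subst hab
      by_cases h : a = M.rev (M.next d)
      · have h1 := SameOrbit.apply (M.splitRot d) (.inl a)
        have h2 := SameOrbit.apply (M.splitRot d) (.inr (true, true))
        rw [h, splitRot_rev_next] at h1
        rw [h]
        exact h1.trans _ _ _ h2
      · rw [← splitRot_of_ne h]
        exact SameOrbit.apply _ _
    | refl => exact .refl _
    | symm _ _ _ ih => exact .symm _ _ ih
    | trans _ _ _ _ _ ih ih' => exact .trans _ _ _ ih ih'
  have key : ∀ x, (∃ e, M.splitTail d x = some (M.tail e) ∧
      SameOrbit (M.splitRot d) (.inl e) x) ∨ (M.splitTail d x = none ∧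
      SameOrbit (M.splitRot d) (.inr (false, false)) x) := by
    rintro (e | ⟨_ | _, _ | _⟩)
    · exact .inl ⟨e, rfl, .refl _⟩
    · exact .inr ⟨rfl, .refl _⟩
    · exact .inr ⟨rfl, .symm _ _ (.rel _ _ rfl)⟩
    · exact .inr ⟨rfl, .rel _ _ rfl⟩
    · exact .inl ⟨M.next (M.next d), rfl, .symm _ _ (.rel _ _ rfl)⟩
  rcases key x with ⟨e, he, hx⟩ | ⟨he, hx⟩ <;> rcases key y with ⟨e', he', hy⟩ | ⟨he', hy⟩
  · rw [he, he', Option.some.injEq] at h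
    exact .trans _ _ _ (.symm _ _ hx) (.trans _ _ _ (lift _ _ (M.tail_orbit _ _ h)) hy)
  · rw [he, he'] at h; cases h
  · rw [he, he'] at h; cases h
  · exact .trans _ _ _ (.symm _ _ hx) hy

theorem face_cases (h3 : M.next (M.next (M.next d)) = d) {e : D} (he : M.left e = M.left d) :
    e = d ∨ e = M.next d ∨ e = M.next (M.next d) := by
  have inj : Function.Injective M.next := M.rot.injective.comp M.rev_injective
  refine (SameOrbit.iff (P := fun e => e = d ∨ e = M.next d ∨ e = M.next (M.next d)) ?_
    (M.left_orbit _ _ he.symm)).1 (.inl rfl)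
  intro a
  change _ ↔ M.next a = _ ∨ M.next a = _ ∨ M.next a = _
  constructor
  · rintro (rfl | rfl | rfl) <;> simp [h3]
  · rintro (h | h | h)
    · right; right; apply inj; rw [h, h3]
    · left; exact inj h
    · right; left; exact inj h

namespace Splittable

variable (h : M.Splittable d)
include h

theorem left_orbit (x y) (hxy : M.splitLeft d x = M.splitLeft d y) :
    SameOrbit (fun a => M.splitRot d (M.splitRev d a)) x y := by
  have n1 : d ≠ M.next d := (next_ne d).symm
  have n2 : M.rev d ≠ M.next d := (ne_rev_of_left (M.left_next d)).symm
  -- Faces other than the triangle keep their boundary, except that a passage along `rev d` now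
  -- takes an extra step through the new vertex.
  have lift : ∀ e e', SameOrbit (fun a => M.rot (M.rev a)) e e' → M.left e ≠ M.left d →
      SameOrbit (fun a => M.splitRot d (M.splitRev d a)) (.inl e) (.inl e') := by
    intro e e' he
    induction he with
    | rel a b hab =>
      subst hab
      intro ha
      have h0 : a ≠ d := fun h => ha (by rw [h])
      by_cases h1 : a = M.rev d
      · subst h1
        have e1 := SameOrbit.apply (fun a => M.splitRot d (M.splitRev d a)) (.inl (M.rev d))
        have e2 : SameOrbit (fun a => M.splitRot d (M.splitRev d a)) (.inr (false, false))
            (.inl (M.rot d)) :=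
          .rel _ _ (splitRot_of_ne (ne_rev_of_left (M.left_next d).symm))
        simp only [splitRev_rev] at e1
        change SameOrbit _ _ (Sum.inl (M.rot (M.rev (M.rev d))))
        rw [M.rev_rev]
        exact e1.trans _ _ _ e2
      · have e1 := SameOrbit.apply (fun a => M.splitRot d (M.splitRev d a)) (.inl a)
        simp only [splitRev_of_ne h0 h1] at e1
        rw [splitRot_of_ne] at e1
        · exact e1
        · exact fun h2 => ha (by rw [M.rev_injective h2, M.left_next])
    | refl => intro _; exact .refl _
    | symm _ _ h1 ih =>
      intro h2
      have := SameOrbit.eq (P := M.left) M.left_next h1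
      exact .symm _ _ (ih (by rwa [this]))
    | trans _ _ _ h1 _ ih ih' =>
      intro h2
      have := SameOrbit.eq (P := M.left) M.left_next h1
      exact .trans _ _ _ (ih h2) (ih' (by rwa [← this]))
  -- The two halves of the triangle, dart by dart: `s1`, `s2` run along the half at the tail and
  -- `s3`, `s4` along the half at the head; `s5` is the extra step on the face across `d`.
  have s1 : SameOrbit (fun a => M.splitRot d (M.splitRev d a)) (.inl d) (.inr (true, false)) :=
    .rel _ _ (by simp only [splitRev_self]; rfl)
  have s2 : SameOrbit (fun a => M.splitRot d (M.splitRev d a)) (.inr (true, false))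
      (.inl (M.next (M.next d))) := .rel _ _ rfl
  have s3 : SameOrbit (fun a => M.splitRot d (M.splitRev d a)) (.inl (M.next d))
      (.inr (true, true)) := .rel _ _ (by
    simp only
    rw [splitRev_of_ne n1.symm n2.symm, splitRot_rev_next])
  have s4 : SameOrbit (fun a => M.splitRot d (M.splitRev d a)) (.inr (true, true))
      (.inr (false, true)) := .rel _ _ rfl
  have s5 : SameOrbit (fun a => M.splitRot d (M.splitRev d a)) (.inl (M.rev d))
      (.inr (false, false)) := .rel _ _ (by simp only [splitRev_rev]; rfl)
  have key : ∀ x, (∃ e, M.left e ≠ M.left d ∧ M.splitLeft d x = some (M.left e) ∧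
      SameOrbit (fun a => M.splitRot d (M.splitRev d a)) (.inl e) x) ∨
      (M.splitLeft d x = some (M.left d) ∧
        SameOrbit (fun a => M.splitRot d (M.splitRev d a)) (.inl d) x) ∨
      (M.splitLeft d x = none ∧
        SameOrbit (fun a => M.splitRot d (M.splitRev d a)) (.inl (M.next d)) x) := by
    rintro (e | ⟨_ | _, _ | _⟩)
    · by_cases h1 : M.left e = M.left d
      · rcases face_cases h.triangle h1 with rfl | rfl | rfl
        · exact .inr (.inl ⟨splitLeft_of_ne n1, .refl _⟩)
        · exact .inr (.inr ⟨splitLeft_next, .refl _⟩)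
        · exact .inr (.inl ⟨(splitLeft_of_ne (next_ne _)).trans (by rw [h1]),
            .trans _ _ _ s1 s2⟩)
      · refine .inl ⟨e, h1, splitLeft_of_ne ?_, .refl _⟩
        exact fun h2 => h1 (by rw [h2, M.left_next])
    · exact .inl ⟨_, M.left_rev_ne d, rfl, s5⟩
    · exact .inr (.inr ⟨rfl, .trans _ _ _ s3 s4⟩)
    · exact .inr (.inl ⟨rfl, s1⟩)
    · exact .inr (.inr ⟨rfl, s3⟩)
  rcases key x with ⟨e, n, he, hx⟩ | ⟨he, hx⟩ | ⟨he, hx⟩ <;>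
  rcases key y with ⟨e', n', he', hy⟩ | ⟨he', hy⟩ | ⟨he', hy⟩ <;> rw [he, he'] at hxy
  · rw [Option.some.injEq] at hxy
    exact .trans _ _ _ (.symm _ _ hx) (.trans _ _ _ (lift _ _ (M.left_orbit _ _ hxy) n) hy)
  · exact absurd (Option.some.inj hxy) n
  · cases hxy
  · exact absurd (Option.some.inj hxy).symm n'
  · exact .trans _ _ _ (.symm _ _ hx) hy
  · cases hxy
  · cases hxy
  · cases hxy
  · exact .trans _ _ _ (.symm _ _ hx) hy

theorem tail_next_next_rev : M.tail (M.rev (M.next (M.next d))) = M.tail d := by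
  rw [← M.tail_next, h.triangle]

theorem apex_ne_tail : M.tail (M.next (M.next d)) ≠ M.tail d := by
  rw [← h.tail_next_next_rev]
  exact (M.tail_rev_ne _).symm

omit h in
theorem apex_ne_head : M.tail (M.next (M.next d)) ≠ M.tail (M.next d) := by
  rw [M.tail_next (M.next d)]
  exact M.tail_rev_ne _

omit h in
theorem head_ne_tail : M.tail (M.next d) ≠ M.tail d := by
  rw [M.tail_next]; exact M.tail_rev_ne _

/-- The apex does not lie on the face to the right of `d`. -/
theorem not_inc_apex : ¬ M.Inc (M.tail (M.next (M.next d))) (M.left (M.rev d)) := by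
  intro hi
  -- By `chord` the edge from the apex to the tail of `d` would have the face across `d` on its
  -- other side, and the tail would have degree two.
  rcases M.chord (M.next (M.next d)) (M.left (M.rev d)) hi
    (by rw [h.tail_next_next_rev]; exact M.inc_rev d) with h1 | h1
  · exact M.left_rev_ne d (by rw [← h1, left_next_next])
  · have : M.rot d = M.rev (M.next (M.next d)) := M.corner _ _
      (by rw [M.tail_rot, h.tail_next_next_rev]) (by rw [M.left_rot, h1])
    apply M.rot_rot_ne d
    rw [this]
    exact h.triangle

-- Otherwise the head of `d` would have degree two.
omit h in
theorem right_ne : M.left (M.rev d) ≠ M.left (M.rev (M.next d)) := by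
  intro h1
  have : M.rot (M.next d) = M.rev d := M.corner _ _
    (by rw [M.tail_rot, M.tail_next]) (by rw [M.left_rot, h1])
  apply M.rot_rot_ne (M.rev d)
  exact this

theorem inc_face_iff {v : V} : M.Inc v (M.left d) ↔
    v = M.tail d ∨ v = M.tail (M.next d) ∨ v = M.tail (M.next (M.next d)) := by
  constructor
  · rintro ⟨e, rfl, he⟩
    rcases face_cases h.triangle he with rfl | rfl | rfl <;> simp
  · rintro (rfl | rfl | rfl)
    · exact ⟨_, rfl, rfl⟩
    · exact ⟨_, rfl, M.left_next d⟩
    · exact ⟨_, rfl, left_next_next d⟩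

omit h in
theorem inc_some {v : V} {f : F} :
    (∃ x, M.splitTail d x = some v ∧ M.splitLeft d x = some f) ↔
      M.Inc v f ∧ ¬ (f = M.left d ∧ v = M.tail (M.next d)) := by
  constructor
  · rintro ⟨e | ⟨_ | _, _ | _⟩, hx, hy⟩
    · cases hx
      by_cases h1 : e = M.next d
      · rw [h1, splitLeft_next] at hy; cases hy
      · rw [splitLeft_of_ne h1] at hy; cases hy
        refine ⟨M.inc_left e, fun ⟨h2, h3⟩ => h1 (M.corner _ _ h3 ?_)⟩
        rw [h2, M.left_next]
    · cases hx
    · cases hx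
    · cases hx
    · cases hy
  · rintro ⟨⟨e, rfl, rfl⟩, h2⟩
    refine ⟨.inl e, rfl, splitLeft_of_ne ?_⟩
    rintro rfl
    exact h2 ⟨M.left_next d, rfl⟩

omit h in
theorem inc_some_none {v : V} : (∃ x, M.splitTail d x = some v ∧ M.splitLeft d x = none) ↔
    v = M.tail (M.next d) ∨ v = M.tail (M.next (M.next d)) := by
  constructor
  · rintro ⟨e | ⟨_ | _, _ | _⟩, hx, hy⟩
    · cases hx
      by_cases h1 : e = M.next d
      · rw [h1]; exact .inl rfl
      · rw [splitLeft_of_ne h1] at hy; cases hy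
    · cases hx
    · cases hx
    · cases hx
    · cases hx; exact .inr rfl
  · rintro (rfl | rfl)
    · exact ⟨.inl _, rfl, splitLeft_next⟩
    · exact ⟨.inr (true, true), rfl, rfl⟩

omit h in
theorem inc_none {f : Option F} : (∃ x, M.splitTail d x = none ∧ M.splitLeft d x = f) ↔
    f = none ∨ f = some (M.left d) ∨ f = some (M.left (M.rev d)) := by
  constructor
  · rintro ⟨e | ⟨_ | _, _ | _⟩, hx, rfl⟩
    · cases hx
    · exact .inr (.inr rfl)
    · exact .inl rfl
    · exact .inr (.inl rfl)
    · cases hx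
  · rintro (rfl | rfl | rfl)
    · exact ⟨.inr (false, true), rfl, rfl⟩
    · exact ⟨.inr (true, false), rfl, rfl⟩
    · exact ⟨.inr (false, false), rfl, rfl⟩

omit h in
theorem rot_rot_ne (x) : M.splitRot d (M.splitRot d x) ≠ x := by
  rcases x with (e | ⟨_ | _, _ | _⟩)
  · by_cases h : e = M.rev (M.next d)
    · rw [h, splitRot_rev_next]
      change Sum.inl (M.next (M.next d)) ≠ _
      rw [Ne, Sum.inl.injEq]
      exact ne_rev_of_left (M.left_next _)
    · rw [splitRot_of_ne h]
      by_cases h' : M.rot e = M.rev (M.next d)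
      · rw [h', splitRot_rev_next]; simp
      · rw [splitRot_of_ne h', Ne, Sum.inl.injEq]
        exact M.rot_rot_ne e
  · simp [splitRot]
  · simp [splitRot]
  · simp [splitRot]
  · change M.splitRot d (.inl (M.next (M.next d))) ≠ _
    rw [splitRot_of_ne (ne_rev_of_left (M.left_next _))]
    simp

omit h in
theorem corner (x y) (h1 : M.splitTail d x = M.splitTail d y)
    (h2 : M.splitLeft d x = M.splitLeft d y) : x = y := by
  have ha := M.left_rev_ne d
  have key : ∀ e, M.splitTail d (.inl e) = some (M.tail (M.next (M.next d))) →
      M.splitLeft d (.inl e) ≠ none := by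
    intro e h1 h2
    by_cases h3 : e = M.next d
    · rw [h3] at h1; exact apex_ne_head (Option.some.inj h1).symm
    · rw [splitLeft_of_ne h3] at h2; cases h2
  rcases x with (e | ⟨_ | _, _ | _⟩) <;> rcases y with (e' | ⟨_ | _, _ | _⟩) <;>
    try first
      | rfl
      | (simp only [splitTail, reduceCtorEq] at h1; done)
      | (simp only [splitLeft, reduceCtorEq] at h2; done)
  · have h1 := Option.some.inj h1
    by_cases he : e = M.next d <;> by_cases he' : e' = M.next d
    · rw [he, he']
    · rw [he, splitLeft_next, splitLeft_of_ne he'] at h2; cases h2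
    · rw [he', splitLeft_next, splitLeft_of_ne he] at h2; cases h2
    · rw [splitLeft_of_ne he, splitLeft_of_ne he'] at h2
      rw [M.corner e e' h1 (Option.some.inj h2)]
  · exact absurd h2 (key e h1)
  · exact absurd (Option.some.inj h2) ha
  · exact absurd (Option.some.inj h2) ha.symm
  · exact absurd h2.symm (key e' h1.symm)

/-- These darts meet every edge, so that `chord` gets the remaining ones by reversal. -/
theorem chord_aux (x) (hx : (∃ e, x = .inl e) ∨ x = .inr (true, false)) (f : Option F)
    (h1 : ∃ y, M.splitTail d y = M.splitTail d x ∧ M.splitLeft d y = f)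
    (h2 : ∃ y, M.splitTail d y = M.splitTail d (M.splitRev d x) ∧ M.splitLeft d y = f) :
    M.splitLeft d x = f ∨ M.splitLeft d (M.splitRev d x) = f := by
  have n1 : d ≠ M.next d := (next_ne d).symm
  have n2 : M.rev d ≠ M.next d := (ne_rev_of_left (M.left_next d)).symm
  rcases hx with ⟨e, rfl⟩ | rfl
  · by_cases e1 : e = d
    · subst e1
      rw [splitRev_self] at h2 ⊢
      rw [splitLeft_of_ne n1]
      rcases inc_none.1 h2 with rfl | rfl | rfl
      · rcases inc_some_none.1 h1 with h1 | h1
        · exact absurd h1.symm head_ne_tail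
        · exact absurd h1.symm h.apex_ne_tail
      · exact .inl rfl
      · exact .inr rfl
    · by_cases e2 : e = M.rev d
      · subst e2
        rw [splitRev_rev] at h2 ⊢
        rw [splitLeft_of_ne n2]
        rcases inc_none.1 h2 with rfl | rfl | rfl
        · exact .inr rfl
        · exact absurd ⟨rfl, (M.tail_next d).symm⟩ (inc_some.1 h1).2
        · exact .inl rfl
      · rw [splitRev_of_ne e1 e2] at h2 ⊢
        rcases f with _ | f
        · have h1 := inc_some_none.1 h1
          have h2 := inc_some_none.1 h2
          rcases h1 with h1 | h1 <;> rcases h2 with h2 | h2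
          · exact absurd (h2.trans h1.symm) (M.tail_rev_ne e)
          · rw [M.tail_next (M.next d)] at h2
            rw [M.tail_injective h1 h2]
            exact .inl splitLeft_next
          · rw [M.tail_next (M.next d)] at h1
            rw [M.tail_injective h2 ((congrArg M.tail (M.rev_rev e)).trans h1)]
            exact .inr splitLeft_next
          · exact absurd (h2.trans h1.symm) (M.tail_rev_ne e)
        · obtain ⟨h1, m1⟩ := inc_some.1 h1
          obtain ⟨h2, m2⟩ := inc_some.1 h2
          rcases M.chord e f h1 h2 with h3 | h3
          · left; rw [← h3]; apply splitLeft_of_ne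
            rintro rfl
            exact m1 ⟨by rw [← h3, M.left_next], rfl⟩
          · right; rw [← h3]; apply splitLeft_of_ne
            intro h4
            exact m2 ⟨by rw [← h3, h4, M.left_next], by rw [h4]⟩
  · rcases inc_none.1 h1 with rfl | rfl | rfl
    · exact .inr rfl
    · exact .inl rfl
    · exact absurd (inc_some.1 h2).1 h.not_inc_apex

theorem chord (x) (f : Option F)
    (h1 : ∃ y, M.splitTail d y = M.splitTail d x ∧ M.splitLeft d y = f)
    (h2 : ∃ y, M.splitTail d y = M.splitTail d (M.splitRev d x) ∧ M.splitLeft d y = f) :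
    M.splitLeft d x = f ∨ M.splitLeft d (M.splitRev d x) = f := by
  by_cases hx : (∃ e, x = .inl e) ∨ x = .inr (true, false)
  · exact h.chord_aux x hx f h1 h2
  · have := h.chord_aux (M.splitRev d x) ?_ f h2 (by rwa [splitRev_splitRev])
    · rw [splitRev_splitRev] at this; exact this.symm
    · rcases x with (e | ⟨_ | _, _ | _⟩)
      · simp at hx
      · exact .inl ⟨_, rfl⟩
      · exact .inl ⟨_, rfl⟩
      · simp at hx
      · exact .inr rfl

omit h in
/-- The faces on the two sides of the darts, listed. -/
theorem sides (x) :
    (∃ e, e ≠ M.rev d ∧ x = .inl e ∧ M.splitLeft d x = some (M.left e) ∧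
      M.splitLeft d (M.splitRev d x) = some (M.left (M.rev e))) ∨
    (x = .inr (false, false) ∧ M.splitLeft d x = some (M.left (M.rev d)) ∧
      M.splitLeft d (M.splitRev d x) = some (M.left d)) ∨
    (x = .inl (M.rev d) ∧ M.splitLeft d x = some (M.left (M.rev d)) ∧
      M.splitLeft d (M.splitRev d x) = none) ∨
    (x = .inr (false, true) ∧ M.splitLeft d x = none ∧
      M.splitLeft d (M.splitRev d x) = some (M.left (M.rev d))) ∨
    (x = .inr (true, false) ∧ M.splitLeft d x = some (M.left d) ∧
      M.splitLeft d (M.splitRev d x) = none) ∨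
    (x = .inr (true, true) ∧ M.splitLeft d x = none ∧
      M.splitLeft d (M.splitRev d x) = some (M.left d)) ∨
    (x = .inl (M.next d) ∧ M.splitLeft d x = none ∧
      M.splitLeft d (M.splitRev d x) = some (M.left (M.rev (M.next d)))) ∨
    (x = .inl (M.rev (M.next d)) ∧ M.splitLeft d x = some (M.left (M.rev (M.next d))) ∧
      M.splitLeft d (M.splitRev d x) = none) := by
  have n1 : d ≠ M.next d := (next_ne d).symm
  have n2 : M.rev d ≠ M.next d := (ne_rev_of_left (M.left_next d)).symm
  have n3 : M.rev (M.next d) ≠ d := (ne_rev_of_left (M.left_next d).symm).symm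
  rcases x with (e | ⟨_ | _, _ | _⟩)
  · by_cases e1 : e = d
    · subst e1
      refine .inl ⟨e, (M.rev_ne e).symm, rfl, splitLeft_of_ne n1, ?_⟩
      rw [splitRev_self]; rfl
    by_cases e2 : e = M.rev d
    · subst e2
      refine .inr (.inr (.inl ⟨rfl, splitLeft_of_ne n2, ?_⟩))
      rw [splitRev_rev]; rfl
    by_cases e3 : e = M.next d
    · subst e3
      refine .inr (.inr (.inr (.inr (.inr (.inr (.inl ⟨rfl, splitLeft_next, ?_⟩))))))
      rw [splitRev_of_ne e1 e2, splitLeft_of_ne (M.rev_ne _)]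
    by_cases e4 : e = M.rev (M.next d)
    · subst e4
      refine .inr (.inr (.inr (.inr (.inr (.inr (.inr ⟨rfl, splitLeft_of_ne e3, ?_⟩))))))
      rw [splitRev_of_ne e1 e2, M.rev_rev, splitLeft_next]
    · refine .inl ⟨e, e2, rfl, splitLeft_of_ne e3, ?_⟩
      rw [splitRev_of_ne e1 e2, splitLeft_of_ne]
      intro h; exact e4 (by rw [← h, M.rev_rev])
  · exact .inr (.inl ⟨rfl, rfl, splitLeft_of_ne n1⟩)
  · exact .inr (.inr (.inr (.inl ⟨rfl, rfl, splitLeft_of_ne n2⟩)))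
  · exact .inr (.inr (.inr (.inr (.inl ⟨rfl, rfl, rfl⟩))))
  · exact .inr (.inr (.inr (.inr (.inr (.inl ⟨rfl, rfl, rfl⟩)))))

omit h in
theorem left_injective (x y) (h1 : M.splitLeft d x = M.splitLeft d y)
    (h2 : M.splitLeft d (M.splitRev d x) = M.splitLeft d (M.splitRev d y)) : x = y := by
  have a1 := M.left_rev_ne d
  have a2 := M.left_rev_ne (M.next d)
  rw [M.left_next] at a2
  have a3 := right_ne (M := M) (d := d)
  have key : ∀ e, M.left e = M.left (M.rev d) → M.left (M.rev e) = M.left d → e = M.rev d :=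
    fun e h3 h4 => M.left_injective _ _ h3 (by rw [h4, M.rev_rev])
  rcases sides (M := M) (d := d) x with ⟨e, n, rfl, l, r⟩ | ⟨rfl, l, r⟩ | ⟨rfl, l, r⟩ |
    ⟨rfl, l, r⟩ | ⟨rfl, l, r⟩ | ⟨rfl, l, r⟩ | ⟨rfl, l, r⟩ | ⟨rfl, l, r⟩ <;>
  rcases sides (M := M) (d := d) y with ⟨e', n', rfl, l', r'⟩ | ⟨rfl, l', r'⟩ |
    ⟨rfl, l', r'⟩ | ⟨rfl, l', r'⟩ | ⟨rfl, l', r'⟩ | ⟨rfl, l', r'⟩ | ⟨rfl, l', r'⟩ |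
    ⟨rfl, l', r'⟩ <;>
  replace h1 := l.symm.trans (h1.trans l') <;> replace h2 := r.symm.trans (h2.trans r') <;>
  first
    | rfl
    | (cases h1; done)
    | (cases h2; done)
    | exact absurd (Option.some.inj h1) a1
    | exact absurd (Option.some.inj h1) a1.symm
    | exact absurd (Option.some.inj h1) a2
    | exact absurd (Option.some.inj h1) a2.symm
    | exact absurd (Option.some.inj h1) a3
    | exact absurd (Option.some.inj h1) a3.symm
    | exact absurd (Option.some.inj h2) a1
    | exact absurd (Option.some.inj h2) a1.symm
    | exact absurd (Option.some.inj h2) a2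
    | exact absurd (Option.some.inj h2) a2.symm
    | exact absurd (Option.some.inj h2) a3
    | exact absurd (Option.some.inj h2) a3.symm
    | exact absurd (key e (Option.some.inj h1) (Option.some.inj h2)) n
    | exact absurd (key e' (Option.some.inj h1).symm (Option.some.inj h2).symm) n'
    | rw [M.left_injective _ _ (Option.some.inj h1) (Option.some.inj h2)]

-- Chains in the old graph survive: the lost edge is replaced by its two halves through the new
-- vertex or, if that vertex is removed, by the detour through the apex, which `h1` then keeps. By
-- `h2` a surviving new vertex has a surviving neighbour.
omit h in
theorem joined_aux {S : Set (Option V)}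
    (hS : Joined (fun a b => ∃ e, M.tail e = a ∧ M.tail (M.rev e) = b) {v | some v ∈ S})
    (h1 : none ∈ S → some (M.tail d) ∉ S → some (M.tail (M.next d)) ∉ S →
      some (M.tail (M.next (M.next d))) ∉ S)
    (h2 : none ∉ S → some (M.tail d) ∉ S ∨ some (M.tail (M.next d)) ∉ S ∨
      some (M.tail (M.next (M.next d))) ∉ S)
    (h : M.Splittable d) :
    Joined (fun a b => ∃ x, M.splitTail d x = a ∧ M.splitTail d (M.splitRev d x) = b) S := by
  have edge : ∀ x, M.splitTail d x ∉ S → M.splitTail d (M.splitRev d x) ∉ S →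
      Relation.EqvGen (fun a b => a ∉ S ∧ b ∉ S ∧
        ∃ x, M.splitTail d x = a ∧ M.splitTail d (M.splitRev d x) = b)
      (M.splitTail d x) (M.splitTail d (M.splitRev d x)) :=
    fun x h1 h2 => .rel _ _ ⟨h1, h2, x, rfl, rfl⟩
  have q1 : none ∉ S → some (M.tail d) ∉ S → Relation.EqvGen (fun a b => a ∉ S ∧ b ∉ S ∧
      ∃ x, M.splitTail d x = a ∧ M.splitTail d (M.splitRev d x) = b) none (some (M.tail d)) :=
    fun h1 h2 => edge (.inr (false, false)) h1 h2
  have q2 : none ∉ S → some (M.tail (M.next d)) ∉ S → Relation.EqvGen (fun a b => a ∉ S ∧ b ∉ S ∧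
      ∃ x, M.splitTail d x = a ∧ M.splitTail d (M.splitRev d x) = b) none
      (some (M.tail (M.next d))) := by
    intro h1 h2
    rw [M.tail_next] at h2 ⊢
    exact edge (.inr (false, true)) h1 h2
  have q3 : none ∉ S → some (M.tail (M.next (M.next d))) ∉ S → Relation.EqvGen (fun a b => a ∉ S ∧
      b ∉ S ∧ ∃ x, M.splitTail d x = a ∧ M.splitTail d (M.splitRev d x) = b) none
      (some (M.tail (M.next (M.next d)))) :=
    fun h1 h2 => edge (.inr (true, false)) h1 h2
  have old : ∀ e, e ≠ d → e ≠ M.rev d → some (M.tail e) ∉ S → some (M.tail (M.rev e)) ∉ S →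
      Relation.EqvGen (fun a b => a ∉ S ∧ b ∉ S ∧
        ∃ x, M.splitTail d x = a ∧ M.splitTail d (M.splitRev d x) = b)
      (some (M.tail e)) (some (M.tail (M.rev e))) := by
    intro e e1 e2 h1 h2
    have := edge (.inl e)
    rw [splitRev_of_ne e1 e2] at this
    exact this h1 h2
  have main : some (M.tail d) ∉ S → some (M.tail (M.next d)) ∉ S →
      Relation.EqvGen (fun a b => a ∉ S ∧ b ∉ S ∧
        ∃ x, M.splitTail d x = a ∧ M.splitTail d (M.splitRev d x) = b)
      (some (M.tail d)) (some (M.tail (M.next d))) := by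
    intro hp hr
    by_cases hq : none ∈ S
    · have hs := h1 hq hp hr
      have e1 := old (M.rev (M.next (M.next d)))
        (ne_rev_of_left (left_next_next d).symm).symm
        (fun h3 => next_ne d (by
          have := congrArg M.next (M.rev_injective h3)
          rw [h.triangle] at this; exact this.symm))
      have e2 := old (M.rev (M.next d)) (ne_rev_of_left (M.left_next d).symm).symm
        (fun h3 => next_ne d (M.rev_injective h3))
      rw [M.rev_rev, h.tail_next_next_rev] at e1
      rw [M.rev_rev, ← M.tail_next (M.next d)] at e2
      exact .trans _ _ _ (e1 hp hs) (e2 hs hr)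
    · exact .trans _ _ _ (.symm _ _ (q1 hq hp)) (q2 hq hr)
  have lift : ∀ v w, Relation.EqvGen (fun a b => a ∉ {v | some v ∈ S} ∧ b ∉ {v | some v ∈ S} ∧
      ∃ e, M.tail e = a ∧ M.tail (M.rev e) = b) v w →
      Relation.EqvGen (fun a b => a ∉ S ∧ b ∉ S ∧
        ∃ x, M.splitTail d x = a ∧ M.splitTail d (M.splitRev d x) = b) (some v) (some w) := by
    intro v w hvw
    induction hvw with
    | rel v w h =>
      obtain ⟨hv, hw, e, rfl, rfl⟩ := h
      by_cases e1 : e = d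
      · subst e1
        have := main hv
        rw [M.tail_next] at this
        exact this hw
      by_cases e2 : e = M.rev d
      · subst e2
        have hv : some (M.tail (M.rev d)) ∉ S := hv
        have hw : some (M.tail (M.rev (M.rev d))) ∉ S := hw
        rw [M.rev_rev] at hw ⊢
        have := main hw
        rw [M.tail_next] at this
        exact .symm _ _ (this hv)
      · exact old e e1 e2 hv hw
    | refl => exact .refl _
    | symm _ _ _ ih => exact .symm _ _ ih
    | trans _ _ _ _ _ ih ih' => exact .trans _ _ _ ih ih'
  have some_case : ∀ a, a ∉ S → ∃ v, some v ∉ S ∧ Relation.EqvGen (fun a b => a ∉ S ∧ b ∉ S ∧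
        ∃ x, M.splitTail d x = a ∧ M.splitTail d (M.splitRev d x) = b) a (some v) := by
    rintro (_ | v) ha
    · rcases h2 ha with h3 | h3 | h3
      · exact ⟨_, h3, q1 ha h3⟩
      · exact ⟨_, h3, q2 ha h3⟩
      · exact ⟨_, h3, q3 ha h3⟩
    · exact ⟨v, ha, .refl _⟩
  intro a b ha hb
  obtain ⟨v, hv, hav⟩ := some_case a ha
  obtain ⟨w, hw, hbw⟩ := some_case b hb
  exact .trans _ _ _ hav (.trans _ _ _ (lift v w (hS v w hv hw)) (.symm _ _ hbw))

theorem joined_vertex (v : Option V) :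
    Joined (fun a b => ∃ x, M.splitTail d x = a ∧ M.splitTail d (M.splitRev d x) = b) {v} := by
  rcases v with _ | v
  · refine joined_aux ?_ (by simp) (by simp) h
    convert M.joined_empty using 1
    ext; simp
  · refine joined_aux ?_ (by simp) ?_ h
    · convert M.joined_vertex v using 1
      ext; simp
    · intro _
      simp only [Set.mem_singleton_iff, Option.some.injEq]
      by_cases hv : M.tail d = v
      · right; left
        rw [← hv]; exact head_ne_tail
      · exact .inl hv

-- The vertex `v` that is put back is attached to the rest by its neighbour `w`. This serves for the
-- two halves of a split triangle, each of which misses one end of the split edge.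
omit h in
theorem _root_.D3.Joined.erase {V : Type*} {adj : V → V → Prop} {S T : Set V} {v w : V}
    (h : Joined adj S) (hT : ∀ u, u ∈ S ↔ u ∈ T ∨ u = v) (hv : v ∉ T)
    (hw : w ∉ S) (hvw : adj v w) : Joined adj T := by
  have hw' : w ∉ T := fun h1 => hw ((hT w).2 (.inl h1))
  have sub : ∀ u, u ∉ S → u ∉ T := fun u h1 h2 => h1 ((hT u).2 (.inl h2))
  have key : ∀ a, a ∉ T → ∃ b, b ∉ S ∧
      Relation.EqvGen (fun a b => a ∉ T ∧ b ∉ T ∧ adj a b) a b := by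
    intro a ha
    by_cases hav : a = v
    · subst hav
      exact ⟨w, hw, .rel _ _ ⟨hv, hw', hvw⟩⟩
    · exact ⟨a, fun h1 => ((hT a).1 h1).elim ha hav, .refl _⟩
  intro a b ha hb
  obtain ⟨a', ha', h1⟩ := key a ha
  obtain ⟨b', hb', h2⟩ := key b hb
  refine .trans _ _ _ h1 (.trans _ _ _ ?_ (.symm _ _ h2))
  exact Relation.EqvGen.mono (fun x y ⟨h1, h2, h3⟩ => ⟨sub x h1, sub y h2, h3⟩) _ _ (h a' b' ha' hb')

theorem joined_face (f : Option F) :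
    Joined (fun a b => ∃ x, M.splitTail d x = a ∧ M.splitTail d (M.splitRev d x) = b)
      {v | ∃ x, M.splitTail d x = v ∧ M.splitLeft d x = f} := by
  -- The end of `d` missed by a half of the triangle stays connected to the rest by its edge `rot
  -- e`, whose far end is off the triangle.
  have third : ∀ e, M.left e = M.left d → M.Tri (M.tail e) →
      ¬ M.Inc (M.tail (M.rev (M.rot e))) (M.left d) := by
    intro e he ht hi
    rcases M.chord (M.rot e) (M.left d) (by
      rw [M.tail_rot, ← he]; exact M.inc_left e) hi with h1 | h1
    · exact M.rot_ne e (M.corner _ _ (M.tail_rot e) (by rw [h1, he]))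
    · rw [← M.left_rot, ← he] at h1
      exact M.rot_rot_ne e (M.corner _ _ (by simp only [M.tail_rot]) h1)
  rcases f with _ | f
  · refine joined_aux ?_ ?_ ?_ h
    · refine Joined.erase (M.joined_face (M.left d)) (v := M.tail d)
        (w := M.tail (M.rev (M.rot d))) ?_ ?_ (third d rfl h.tri_tail)
        ⟨M.rot d, M.tail_rot d, rfl⟩
      · intro u
        refine h.inc_face_iff.trans ?_
        simp only [Set.mem_ofPred_eq, inc_some_none]
        tauto
      · simp only [Set.mem_ofPred_eq, inc_some_none, not_or]
        exact ⟨head_ne_tail.symm, h.apex_ne_tail.symm⟩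
    · intro _ _ h2
      exact absurd (inc_some_none.2 (.inl rfl)) h2
    · intro h2
      exact absurd (inc_none.2 (.inl rfl)) h2
  · by_cases hf : f = M.left d
    · subst hf
      have mem : ∀ u, (∃ x, M.splitTail d x = some u ∧ M.splitLeft d x = some (M.left d)) ↔
          u = M.tail d ∨ u = M.tail (M.next (M.next d)) := by
        intro u
        rw [inc_some, h.inc_face_iff]
        have := head_ne_tail (M := M) (d := d)
        have := apex_ne_head (M := M) (d := d)
        constructor
        · tauto
        · rintro (rfl | rfl) <;> tauto
      refine joined_aux ?_ ?_ ?_ h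
      · refine Joined.erase (M.joined_face (M.left d)) (v := M.tail (M.next d))
          (w := M.tail (M.rev (M.rot (M.next d)))) ?_ ?_
          (third _ (M.left_next d) (by rw [M.tail_next]; exact h.tri_head))
          ⟨M.rot (M.next d), M.tail_rot _, rfl⟩
        · intro u
          refine h.inc_face_iff.trans ?_
          simp only [Set.mem_ofPred_eq, mem]
          tauto
        · simp only [Set.mem_ofPred_eq, mem, not_or]
          exact ⟨head_ne_tail, apex_ne_head.symm⟩
      · intro _ h2
        exact absurd ((mem _).2 (.inl rfl)) h2
      · intro h2
        exact absurd (inc_none.2 (.inr (.inl rfl))) h2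
    · have mem : ∀ u, (∃ x, M.splitTail d x = some u ∧ M.splitLeft d x = some f) ↔
          M.Inc u f := by
        intro u
        rw [inc_some]
        tauto
      refine joined_aux ?_ ?_ ?_ h
      · convert M.joined_face f using 1
        ext u
        simp only [Set.mem_ofPred_eq, mem]
        rfl
      · intro h1 h2
        rcases inc_none.1 h1 with h3 | h3 | h3
        · cases h3
        · exact absurd (Option.some.inj h3) hf
        · rw [Option.some.inj h3] at h2
          exact absurd (inc_some.2 ⟨M.inc_rev d, fun h4 => head_ne_tail h4.2.symm⟩) h2
      -- If the new vertex is isolated off `f`, both ends of `d` lie on `f`, so `f` is the face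
      -- across `d`; but the apex is not on that face.
      · intro h1
        by_contra hcon
        simp only [Set.mem_ofPred_eq, mem, not_or, not_not] at hcon
        obtain ⟨i1, i2, i3⟩ := hcon
        rcases M.chord d f i1 (by rw [← M.tail_next]; exact i2) with h4 | h4
        · exact hf h4.symm
        · rw [← h4] at i3
          exact h.not_inc_apex i3

end Splittable

/-- Subdividing the edge of `d` by a new vertex joined to the opposite vertex of the triangle. -/
noncomputable def split (M : PolyMap D V F) (d : D) (h : M.Splittable d) :
    PolyMap (D ⊕ Bool × Bool) (Option V) (Option F) where
  finite := by
    have := M.finite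
    infer_instance
  rev := M.splitRev d
  rot := M.splitRot d
  tail := M.splitTail d
  left := M.splitLeft d
  rev_rev := splitRev_splitRev
  tail_rot := splitTail_rot
  left_rot := splitLeft_rot
  tail_orbit := split_tail_orbit
  left_orbit := h.left_orbit
  tail_surjective := by
    rintro (_ | v)
    · exact ⟨.inr (true, false), rfl⟩
    · obtain ⟨e, rfl⟩ := M.tail_surjective v
      exact ⟨.inl e, rfl⟩
  left_surjective := by
    rintro (_ | f)
    · exact ⟨.inr (true, true), rfl⟩
    · obtain ⟨e, rfl⟩ := M.left_surjective f
      by_cases he : e = M.next d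
      · exact ⟨.inr (true, false), by rw [he, M.left_next]; rfl⟩
      · exact ⟨.inl e, splitLeft_of_ne he⟩
  rot_rot_ne := Splittable.rot_rot_ne
  corner := Splittable.corner
  chord := h.chord
  left_injective := Splittable.left_injective
  joined_empty := Splittable.joined_aux (by
    convert M.joined_empty using 1
    ext; simp) (by simp) (by simp) h
  joined_vertex := h.joined_vertex
  joined_face := h.joined_face
  -- There are one more vertex, one more face and four more darts.
  euler := by
    have := M.finite
    have := M.finite_left
    have := M.finite_tail
    have := M.euler
    rw [Nat.card_sum, Nat.card_prod, Finite.card_option, Finite.card_option]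
    simp only [Nat.card_eq_fintype_card, Fintype.card_bool] at *
    omega

section Facts

variable (h : M.Splittable d)

/-- In the dual, `left d` is a vertex of degree three. Its edge to the face across `next d` is
subdivided by `none`, which is joined to the face across `d`: with that face as hub, a rim edge of a
wheel is subdivided. -/
theorem split_dual_some {f g : F} (hf : f ≠ M.left d) (hg : g ≠ M.left d) :
    (M.split d h).dual.Adj (some f) (some g) ↔ M.dual.Adj f g := by
  constructor
  · rintro ⟨x, h1, h2⟩
    rcases Splittable.sides (M := M) (d := d) x with ⟨e, n, rfl, l, r⟩ | ⟨rfl, l, r⟩ | ⟨rfl, l, r⟩ |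
      ⟨rfl, l, r⟩ | ⟨rfl, l, r⟩ | ⟨rfl, l, r⟩ | ⟨rfl, l, r⟩ | ⟨rfl, l, r⟩ <;>
    have l := l.symm.trans h1 <;> have r := r.symm.trans h2
    all_goals first | (cases l; done) | (cases r; done) | (cases l; cases r)
    · exact M.dual_adj_rev e
    · exact absurd rfl hg
  · rintro ⟨e, rfl, rfl⟩
    refine ⟨.inl e, ?_, ?_⟩
    · exact splitLeft_of_ne (fun h1 => hf (by rw [h1, M.left_next]))
    · change M.splitLeft d (M.splitRev d (.inl e)) = some (M.left (M.rev e))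
      rw [splitRev_of_ne (fun h1 => hf (by rw [h1])) (fun h1 => hg (by rw [h1, M.rev_rev])),
        splitLeft_of_ne (fun h1 => hg (by rw [h1, M.left_next]))]

theorem split_dual_left {g : F} (hg : g ≠ M.left d) :
    (M.split d h).dual.Adj (some (M.left d)) (some g) ↔
      g = M.left (M.rev d) ∨ g = M.left (M.rev (M.next (M.next d))) := by
  constructor
  · rintro ⟨x, h1, h2⟩
    have h1 : M.splitLeft d x = some (M.left d) := h1
    have h2 : M.splitLeft d (M.splitRev d x) = some g := h2
    rcases x with (e | ⟨_ | _, _ | _⟩)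
    · by_cases he : e = M.next d
      · rw [he, splitLeft_next] at h1; cases h1
      · rw [splitLeft_of_ne he] at h1
        rcases face_cases h.triangle (Option.some.inj h1) with rfl | rfl | rfl
        · rw [splitRev_self] at h2; cases h2; exact .inl rfl
        · exact absurd rfl he
        · rw [splitRev_of_ne, splitLeft_of_ne (ne_rev_of_left (M.left_next _).symm).symm] at h2
          · cases h2; exact .inr rfl
          · intro h3
            have := h.triangle
            rw [h3] at this
            exact next_ne d this
          · exact ne_rev_of_left (left_next_next d)
    · exact absurd (Option.some.inj h1) (M.left_rev_ne d)
    · cases h1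
    · cases h2
    · cases h1
  · rintro (rfl | rfl)
    · exact ⟨.inl d, splitLeft_of_ne (next_ne d).symm,
        (congrArg (M.splitLeft d) splitRev_self).trans rfl⟩
    · refine ⟨.inl (M.next (M.next d)), ?_, ?_⟩
      · exact (splitLeft_of_ne (next_ne _)).trans (by rw [left_next_next])
      · change M.splitLeft d (M.splitRev d (.inl (M.next (M.next d)))) = some (M.left (M.rev (M.next (M.next d))))
        rw [splitRev_of_ne, splitLeft_of_ne (ne_rev_of_left (M.left_next _).symm).symm]
        · intro h3
          have := h.triangle
          rw [h3] at this
          exact next_ne d this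
        · exact ne_rev_of_left (left_next_next d)

theorem split_dual_none {g : F} (hg : g ≠ M.left d) :
    (M.split d h).dual.Adj none (some g) ↔
      g = M.left (M.rev d) ∨ g = M.left (M.rev (M.next d)) := by
  constructor
  · rintro ⟨x, h1, h2⟩
    rcases Splittable.sides (M := M) (d := d) x with ⟨e, n, rfl, l, r⟩ | ⟨rfl, l, r⟩ | ⟨rfl, l, r⟩ |
      ⟨rfl, l, r⟩ | ⟨rfl, l, r⟩ | ⟨rfl, l, r⟩ | ⟨rfl, l, r⟩ | ⟨rfl, l, r⟩ <;>
    have l := l.symm.trans h1 <;> have r := r.symm.trans h2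
    all_goals first | (cases l; done) | (cases r; done) | (cases l; cases r)
    · exact .inl rfl
    · exact absurd rfl hg
    · exact .inr rfl
  · have n2 : M.rev d ≠ M.next d := (ne_rev_of_left (M.left_next d)).symm
    rintro (rfl | rfl)
    · exact ⟨.inr (false, true), rfl, splitLeft_of_ne n2⟩
    · refine ⟨.inl (M.next d), splitLeft_next, ?_⟩
      change M.splitLeft d (M.splitRev d (.inl (M.next d))) = some (M.left (M.rev (M.next d)))
      rw [splitRev_of_ne (next_ne d) n2.symm, splitLeft_of_ne (M.rev_ne _)]

theorem split_dual_new : (M.split d h).dual.Adj none (some (M.left d)) :=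
  ⟨.inr (true, true), rfl, rfl⟩

theorem split_inc_some {v : V} {f : F} : (M.split d h).Inc (some v) (some f) ↔
    M.Inc v f ∧ ¬ (f = M.left d ∧ v = M.tail (M.next d)) := Splittable.inc_some

theorem split_inc_some_none {v : V} : (M.split d h).Inc (some v) none ↔
    v = M.tail (M.next d) ∨ v = M.tail (M.next (M.next d)) := Splittable.inc_some_none

theorem split_inc_none {f : Option F} : (M.split d h).Inc none f ↔
    f = none ∨ f = some (M.left d) ∨ f = some (M.left (M.rev d)) := Splittable.inc_none

theorem split_tri_none : (M.split d h).Tri none := by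
  have key : ∀ x, M.splitTail d x = none →
      M.splitRot d (M.splitRot d (M.splitRot d x)) = x := by
    rintro (e | ⟨_ | _, _ | _⟩) hx
    · cases hx
    · rfl
    · rfl
    · rfl
    · cases hx
  exact key

theorem split_tri_some {v : V} : (M.split d h).Tri (some v) ↔
    M.Tri v ∧ v ≠ M.tail (M.next (M.next d)) := by
  have key : ∀ e, M.tail e ≠ M.tail (M.next (M.next d)) →
      M.splitRot d (M.splitRot d (M.splitRot d (.inl e))) = .inl (M.rot (M.rot (M.rot e))) := by
    intro e he
    have h1 : ∀ e', M.tail e' = M.tail e → e' ≠ M.rev (M.next d) := by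
      rintro e' h1 rfl
      exact he (by rw [← h1, M.tail_next])
    rw [splitRot_of_ne (h1 _ rfl), splitRot_of_ne (h1 _ (M.tail_rot e)),
      splitRot_of_ne (h1 _ (by simp only [M.tail_rot]))]
  constructor
  · intro ht
    have hv : v ≠ M.tail (M.next (M.next d)) := by
      rintro rfl
      have h1 : M.splitRot d (M.splitRot d (M.splitRot d (.inr (true, true)))) =
        .inr (true, true) := ht (.inr (true, true)) rfl
      change M.splitRot d (M.splitRot d (.inl (M.next (M.next d)))) = _ at h1
      rw [splitRot_of_ne (ne_rev_of_left (M.left_next _))] at h1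
      by_cases h2 : M.rot (M.next (M.next d)) = M.rev (M.next d)
      · exact M.rot_rot_ne (M.rev (M.next d)) h2
      · rw [splitRot_of_ne h2] at h1; cases h1
    refine ⟨fun e he => ?_, hv⟩
    have h1 : M.splitRot d (M.splitRot d (M.splitRot d (.inl e))) = .inl e :=
      ht (.inl e) (congrArg some he)
    rw [key e (he ▸ hv)] at h1
    exact Sum.inl_injective h1
  · rintro ⟨ht, hv⟩
    have : ∀ x, M.splitTail d x = some v →
        M.splitRot d (M.splitRot d (M.splitRot d x)) = x := by
      rintro (e | ⟨_ | _, _ | _⟩) hx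
      · have he := Option.some.inj hx
        rw [key e (by rwa [he]), ht e he]
      · cases hx
      · cases hx
      · cases hx
      · exact absurd (Option.some.inj hx).symm hv
    exact this

theorem split_primal_some {v w : V} : (M.split d h).primal.Adj (some v) (some w) ↔
    M.primal.Adj v w ∧ ¬ (v = M.tail d ∧ w = M.tail (M.next d)) ∧
      ¬ (v = M.tail (M.next d) ∧ w = M.tail d) := by
  constructor
  · rintro ⟨e | ⟨_ | _, _ | _⟩, h1, h2⟩
    · have h1 := Option.some.inj h1
      have h2 : M.splitTail d (M.splitRev d (.inl e)) = some w := h2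
      by_cases e1 : e = d
      · rw [e1, splitRev_self] at h2; cases h2
      by_cases e2 : e = M.rev d
      · rw [e2, splitRev_rev] at h2; cases h2
      rw [splitRev_of_ne e1 e2] at h2
      have h2 := Option.some.inj h2
      refine ⟨⟨e, h1, h2⟩, fun ⟨h3, h4⟩ => e1 ?_, fun ⟨h3, h4⟩ => e2 ?_⟩
      · rw [M.tail_next] at h4
        exact M.tail_injective (h1.trans h3) (h2.trans h4)
      · rw [M.tail_next] at h3
        exact M.tail_injective (h1.trans h3) (by rw [h2, h4, M.rev_rev])
    · cases h1
    · cases h1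
    · cases h1
    · cases h2
  · rintro ⟨⟨e, rfl, rfl⟩, h1, h2⟩
    refine ⟨.inl e, rfl, ?_⟩
    change M.splitTail d (M.splitRev d (.inl e)) = some (M.tail (M.rev e))
    rw [splitRev_of_ne]
    · rfl
    · rintro rfl; exact h1 ⟨rfl, (M.tail_next _).symm⟩
    · rintro rfl; exact h2 ⟨(M.tail_next _).symm, by rw [M.rev_rev]⟩

theorem split_primal_none {v : V} : (M.split d h).primal.Adj none (some v) ↔
    v = M.tail d ∨ v = M.tail (M.next d) ∨ v = M.tail (M.next (M.next d)) := by
  constructor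
  · rintro ⟨e | ⟨_ | _, _ | _⟩, h1, h2⟩
    · cases h1
    · cases h2; exact .inl rfl
    · cases h2; exact .inr (.inl (M.tail_next d).symm)
    · cases h2; exact .inr (.inr rfl)
    · cases h1
  · rintro (rfl | rfl | rfl)
    · exact ⟨.inr (false, false), rfl, rfl⟩
    · exact ⟨.inr (false, true), rfl, congrArg some (M.tail_next d).symm⟩
    · exact ⟨.inr (true, false), rfl, rfl⟩

end Facts

end Split
end PolyMap
/-! ### Circulations on planar rotation systems -/

namespace RotationSystem

variable {V : Type u} {G : SimpleGraph V} (R : RotationSystem G)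

theorem faceNext_apply (d : G.Dart) : R.faceNext d = R.rot d.symm := rfl

theorem face_faceNext (d : G.Dart) : R.face (R.faceNext d) = R.face d :=
  Quotient.sound (Equiv.Perm.sameCycle_apply_left.2 (.refl _ _))

theorem face_eq_iff {d e : G.Dart} : R.face d = R.face e ↔ R.faceNext.SameCycle d e :=
  Quotient.eq (r := Equiv.Perm.SameCycle.setoid R.faceNext)

theorem face_rot (d : G.Dart) : R.face (R.rot d) = R.face d.symm := by
  rw [← R.face_faceNext d.symm, faceNext_apply, SimpleGraph.Dart.symm_symm]

theorem faceNext_fst (d : G.Dart) : (R.faceNext d).fst = d.snd := R.rot_fst _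

theorem face_surjective : Function.Surjective R.face := Quotient.mk_surjective

theorem sum_symm [Fintype G.Dart] (f : G.Dart → ℝ) : ∑ d : G.Dart, f d.symm = ∑ d, f d :=
  Equiv.sum_comp (SimpleGraph.Dart.symm_involutive (G := G)).toPerm f

/-- Boundaries of combinations of faces are orthogonal to coboundaries of functions on the vertices,
because the increments of `g` around a face cancel. -/
theorem sum_boundary_mul_coboundary [Fintype G.Dart] (c : R.Face → ℝ) (g : V → ℝ) :
    ∑ d : G.Dart, (c (R.face d) - c (R.face d.symm)) * (g d.snd - g d.fst) = 0 := by
  have h1 : ∑ d : G.Dart, c (R.face d.symm) * (g d.snd - g d.fst) =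
      ∑ d : G.Dart, c (R.face d) * (g d.fst - g d.snd) := by
    rw [← sum_symm (fun d => c (R.face d) * (g d.fst - g d.snd))]
    rfl
  have h2 : ∑ d : G.Dart, c (R.face d) * g d.snd = ∑ d : G.Dart, c (R.face d) * g d.fst := by
    rw [← Equiv.sum_comp R.faceNext (fun d => c (R.face d) * g d.fst)]
    simp only [face_faceNext, faceNext_fst]
  simp only [sub_mul, Finset.sum_sub_distrib, h1]
  simp only [mul_sub, Finset.sum_sub_distrib, h2]
  ring

variable {R}

theorem const_of_adj (hG : G.Connected) {g : V → ℝ} (h : ∀ d : G.Dart, g d.snd = g d.fst)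
    (v w : V) : g v = g w := by
  obtain ⟨p⟩ := hG.preconnected v w
  induction p with
  | nil => rfl
  | cons hadj _ ih => exact (h ⟨⟨_, _⟩, hadj⟩).symm.trans ih

/-- Rotating past a dart crosses its edge, so `c` is constant around each vertex, and hence along
walks. -/
theorem const_of_face (hG : G.Connected) {c : R.Face → ℝ}
    (h : ∀ d : G.Dart, c (R.face d.symm) = c (R.face d)) (f f' : R.Face) : c f = c f' := by
  obtain ⟨d, rfl⟩ := R.face_surjective f
  obtain ⟨e, rfl⟩ := R.face_surjective f'
  have same : ∀ d e : G.Dart, d.fst = e.fst → c (R.face d) = c (R.face e) := by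
    intro d e hde
    have hcyc := R.rot_cyclic d e hde
    obtain ⟨i, rfl⟩ := hcyc
    have key : ∀ (d : G.Dart) (n : ℕ), c (R.face ((R.rot ^ n) d)) = c (R.face d) := by
      intro d n
      induction n with
      | zero => rfl
      | succ n ih => rw [pow_succ', Equiv.Perm.mul_apply, face_rot, h, ih]
    obtain ⟨n, rfl | rfl⟩ := i.eq_nat_or_neg
    · rw [zpow_natCast, key]
    · rw [← key ((R.rot ^ (-(n : ℤ))) d) n, ← Equiv.Perm.mul_apply, ← zpow_natCast, ← zpow_add]
      simp
  have walk : ∀ v w, G.Walk v w → ∀ d e : G.Dart, d.fst = v → e.fst = w →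
      c (R.face d) = c (R.face e) := by
    intro v w p
    induction p with
    | nil => intro d e hd he; exact same d e (hd.trans he.symm)
    | cons hadj _ ih =>
      intro d e hd he
      rw [same d ⟨⟨_, _⟩, hadj⟩ hd, ← h]
      exact ih _ _ rfl he
  obtain ⟨p⟩ := hG.preconnected d.fst e.fst
  exact walk _ _ p d e rfl rfl

/-- The antisymmetric functions on the darts. -/
def antisymmetric (G : SimpleGraph V) : Submodule ℝ (G.Dart → ℝ) where
  carrier := {f | ∀ d : G.Dart, f d.symm = -f d}
  add_mem' := by
    intro a b ha hb d
    simp only [Pi.add_apply, ha d, hb d]; ring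
  zero_mem' := by intro d; simp
  smul_mem' := by
    intro c a ha d
    simp only [Pi.smul_apply, ha d, smul_neg]

/-- Evaluation at one dart of each edge is injective on antisymmetric functions. -/
theorem finrank_antisymmetric_le [Finite V] :
    Module.finrank ℝ (antisymmetric G) ≤ Nat.card G.edgeSet := by
  classical
  have := Fintype.ofFinite V
  have := Fintype.ofFinite G.edgeSet
  have hex : ∀ e : G.edgeSet, ∃ d : G.Dart, d.edge = e.1 := by
    rintro ⟨⟨a, b⟩, he⟩
    exact ⟨⟨(a, b), he⟩, rfl⟩
  choose t ht using hex
  let ev : antisymmetric G →ₗ[ℝ] (G.edgeSet → ℝ) :=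
    (LinearMap.funLeft ℝ ℝ t).comp (antisymmetric G).subtype
  have hinj : Function.Injective ev := by
    rw [injective_iff_map_eq_zero]
    rintro ⟨f, hf⟩ h
    ext d
    have h1 : f (t ⟨d.edge, d.edge_mem⟩) = 0 := congrFun h ⟨d.edge, d.edge_mem⟩
    rcases SimpleGraph.dart_edge_eq_iff _ _ |>.1 (ht ⟨d.edge, d.edge_mem⟩) with h2 | h2
    · rw [h2] at h1; exact h1
    · rw [h2, hf d] at h1
      exact neg_eq_zero.1 h1
  have := LinearMap.finrank_le_finrank_of_injective hinj
  rwa [Module.finrank_fintype_fun_eq_card, ← Nat.card_eq_fintype_card] at this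

/-- On a planar rotation system every circulation is the difference of a function on the faces on
the two sides of the darts. -/
theorem IsPlanar.exists_potential [Fintype G.Dart] (hR : R.IsPlanar) (h : G.Dart → ℝ)
    (anti : ∀ d : G.Dart, h d.symm = -h d) (hdiv : ∀ g : V → ℝ, ∑ d : G.Dart, g d.fst * h d = 0) :
    ∃ c : R.Face → ℝ, ∀ d : G.Dart, h d = c (R.face d) - c (R.face d.symm) := by
  classical
  rcases isEmpty_or_nonempty G.Dart with hE | ⟨⟨d₀⟩⟩
  · exact ⟨0, fun d => hE.elim d⟩
  have := hR.finite
  have := Fintype.ofFinite V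
  have : Finite R.Face := Finite.of_surjective _ R.face_surjective
  have := Fintype.ofFinite R.Face
  -- Boundary plus coboundary. An element of the kernel is a pair of constants, so by Euler's
  -- formula the range has dimension at least `|V| + |F| - 2 = |E|`; the target has at most that
  -- dimension, so `Φ` is onto.
  let Φ : ((R.Face → ℝ) × (V → ℝ)) →ₗ[ℝ] antisymmetric G :=
    { toFun := fun p => ⟨fun d => (p.1 (R.face d) - p.1 (R.face d.symm)) + (p.2 d.snd - p.2 d.fst),
        by
          intro d
          change (p.1 (R.face d.symm) - p.1 (R.face d.symm.symm)) +
            (p.2 d.fst - p.2 d.snd) = _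
          rw [SimpleGraph.Dart.symm_symm]; ring⟩
      map_add' := by
        intro p q; ext d
        simp only [Prod.fst_add, Prod.snd_add, Pi.add_apply, Submodule.coe_add]; ring
      map_smul' := by
        intro r p; ext d
        simp only [Prod.smul_fst, Prod.smul_snd, Pi.smul_apply, Submodule.coe_smul, smul_eq_mul,
          RingHom.id_apply]
        ring }
  have Φ_apply : ∀ p d, (Φ p).1 d =
    (p.1 (R.face d) - p.1 (R.face d.symm)) + (p.2 d.snd - p.2 d.fst) := fun _ _ => rfl
  have hker : Module.finrank ℝ (LinearMap.ker Φ) ≤ 2 := by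
    let ev : LinearMap.ker Φ →ₗ[ℝ] ℝ × ℝ :=
      (LinearMap.prodMap (LinearMap.proj (R.face d₀)) (LinearMap.proj d₀.fst)).comp
        (LinearMap.ker Φ).subtype
    have hinj : Function.Injective ev := by
      rw [injective_iff_map_eq_zero]
      rintro ⟨⟨c, g⟩, hp⟩ h0
      have h1 : c (R.face d₀) = 0 := congrArg Prod.fst h0
      have h2 : g d₀.fst = 0 := congrArg Prod.snd h0
      have hz : ∀ d : G.Dart, (c (R.face d) - c (R.face d.symm)) + (g d.snd - g d.fst) = 0 := by
        intro d
        have := congrFun (congrArg Subtype.val hp) d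
        exact this
      -- In the kernel the coboundary part is minus the boundary part, which is orthogonal to it; so
      -- both vanish.
      have hsq : ∑ d : G.Dart, (g d.snd - g d.fst) * (g d.snd - g d.fst) = 0 := by
        have h3 := R.sum_boundary_mul_coboundary c g
        have h4 : ∑ d : G.Dart, ((c (R.face d) - c (R.face d.symm)) + (g d.snd - g d.fst)) *
            (g d.snd - g d.fst) = 0 := Finset.sum_eq_zero fun d _ => by rw [hz d, zero_mul]
        simp only [add_mul, Finset.sum_add_distrib, h3, zero_add] at h4
        exact h4
      rw [Finset.sum_eq_zero_iff_of_nonneg fun d _ => mul_self_nonneg _] at hsq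
      have hg : ∀ d : G.Dart, g d.snd = g d.fst := fun d =>
        sub_eq_zero.1 (mul_self_eq_zero.1 (hsq d (Finset.mem_univ d)))
      have hc : ∀ d : G.Dart, c (R.face d.symm) = c (R.face d) := by
        intro d
        have := hz d
        rw [hg d] at this
        linarith
      have hg0 : g = 0 := funext fun v => (const_of_adj hR.connected hg v d₀.fst).trans h2
      have hc0 : c = 0 := funext fun f => (const_of_face hR.connected hc f (R.face d₀)).trans h1
      exact Subtype.ext (Prod.ext hc0 hg0)
    have := LinearMap.finrank_le_finrank_of_injective hinj
    simpa using this
  have hrange : LinearMap.range Φ = ⊤ := by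
    apply Submodule.eq_top_of_finrank_eq
    have h1 := LinearMap.finrank_range_add_finrank_ker Φ
    have h2 := finrank_antisymmetric_le (G := G)
    have h3 := hR.euler
    have h4 := Submodule.finrank_le (LinearMap.range Φ)
    rw [Module.finrank_prod, Module.finrank_fintype_fun_eq_card,
      Module.finrank_fintype_fun_eq_card, ← Nat.card_eq_fintype_card,
      ← Nat.card_eq_fintype_card] at h1
    omega
  have hmem : (⟨h, anti⟩ : antisymmetric G) ∈ LinearMap.range Φ := by rw [hrange]; trivial
  obtain ⟨⟨c, g⟩, hcg⟩ := hmem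
  have hcg : ∀ d : G.Dart, (c (R.face d) - c (R.face d.symm)) + (g d.snd - g d.fst) = h d :=
    fun d => congrFun (congrArg Subtype.val hcg) d
  refine ⟨c, ?_⟩
  -- A circulation is orthogonal to every coboundary. Since the boundary part is as well, the
  -- coboundary part of `h` has norm zero.
  have h1 : ∑ d : G.Dart, h d * (g d.snd - g d.fst) = 0 := by
    have h2 : ∑ d : G.Dart, g d.snd * h d = -∑ d : G.Dart, g d.fst * h d := by
      rw [← sum_symm fun d => g d.snd * h d, ← Finset.sum_neg_distrib]
      refine Finset.sum_congr rfl fun d _ => ?_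
      rw [anti]
      change g d.fst * _ = _
      ring
    have h3 : ∀ d : G.Dart, h d * (g d.snd - g d.fst) = g d.snd * h d - g d.fst * h d := by
      intro d; ring
    simp only [h3, Finset.sum_sub_distrib, h2, hdiv, neg_zero, sub_zero]
  have hsq : ∑ d : G.Dart, (g d.snd - g d.fst) * (g d.snd - g d.fst) = 0 := by
    have h3 := R.sum_boundary_mul_coboundary c g
    simp only [← hcg, add_mul, Finset.sum_add_distrib, h3, zero_add] at h1
    exact h1
  rw [Finset.sum_eq_zero_iff_of_nonneg fun d _ => mul_self_nonneg _] at hsq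
  intro d
  have := mul_self_eq_zero.1 (hsq d (Finset.mem_univ d))
  rw [← hcg d, this, add_zero]

end RotationSystem
/-! ### Uniqueness of the embedding -/

namespace PolyMap

variable {D V F : Type} (M : PolyMap D V F)

/-- A property of darts invariant under rotation and reversal holds for all darts or none. -/
theorem dart_iff {P : D → Prop} (hrot : ∀ d, P d ↔ P (M.rot d)) (hrev : ∀ d, P d → P (M.rev d))
    (d e : D) : P d ↔ P e := by
  have hrev' : ∀ d, P d ↔ P (M.rev d) := fun d =>
    ⟨hrev d, fun h => by have := hrev _ h; rwa [M.rev_rev] at this⟩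
  have same : ∀ d e, M.tail d = M.tail e → (P d ↔ P e) := fun d e h =>
    SameOrbit.iff hrot (M.tail_orbit d e h)
  have key : ∀ v w, Relation.EqvGen (fun a b => a ∉ (∅ : Set V) ∧ b ∉ (∅ : Set V) ∧
      ∃ d, M.tail d = a ∧ M.tail (M.rev d) = b) v w →
      ∀ d e, M.tail d = v → M.tail e = w → (P d ↔ P e) := by
    intro v w h
    induction h with
    | rel v w h =>
      obtain ⟨_, _, x, rfl, rfl⟩ := h
      intro d e hd he
      rw [same d x hd, hrev' x, same (M.rev x) e he.symm]
    | refl => intro d e hd he; exact same d e (hd.trans he.symm)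
    | symm _ _ _ ih => intro d e hd he; exact (ih e d he hd).symm
    | trans _ w _ _ _ ih ih' =>
      intro d e hd he
      obtain ⟨x, hx⟩ := M.tail_surjective w
      exact (ih d x hd hx).trans (ih' x e hx he)
  exact key _ _ (M.joined_empty _ _ (by simp) (by simp)) d e rfl rfl

theorem sameCycle_induction {D : Type*} [Finite D] {ρ : Equiv.Perm D} {x y : D}
    (h : ρ.SameCycle x y) {P : D → Prop} (hx : P x) (hs : ∀ y, P y → P (ρ y)) : P y := by
  obtain ⟨n, -, rfl⟩ := h.exists_pow_eq'
  clear h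
  induction n with
  | zero => exact hx
  | succ n ih => rw [pow_succ', Equiv.Perm.mul_apply]; exact hs _ ih

section Rigid

variable {M} {ρ : Equiv.Perm D} (htail : ∀ d, M.tail (ρ d) = M.tail d)
  (horb : ∀ d e, M.tail d = M.tail e → ρ.SameCycle d e)

include htail horb

/-- A potential of the boundary of a face is constant away from the face. -/
theorem potential_const {f : F} {c : D → ℝ} (hc : ∀ d, c (ρ d) = c (M.rev d))
    (h0 : ∀ d, M.left d ≠ f → M.left (M.rev d) ≠ f → c d = c (M.rev d)) :
    ∃ k, ∀ d, M.left d ≠ f → M.left (M.rev d) ≠ f → c d = k := by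
  have := M.finite
  have out : ∀ x, ¬ M.Inc (M.tail x) f → c x = c (M.rev x) := by
    intro x hx
    refine h0 x ?_ ?_
    · rintro rfl; exact hx (M.inc_left x)
    · rintro rfl; exact hx (M.inc_rev x)
  have same : ∀ x y, ¬ M.Inc (M.tail x) f → M.tail x = M.tail y → c x = c y := by
    intro x y hx hxy
    refine (sameCycle_induction (horb x y hxy) (P := fun z => c x = c z ∧ M.tail z = M.tail x)
      ⟨rfl, rfl⟩ ?_).1
    rintro z ⟨h1, h2⟩
    refine ⟨?_, (htail z).trans h2⟩
    rw [hc, ← out z (by rwa [h2]), h1]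
  have key : ∀ v w, Relation.EqvGen (fun a b => a ∉ {v | ∃ d, M.tail d = v ∧ M.left d = f} ∧
      b ∉ {v | ∃ d, M.tail d = v ∧ M.left d = f} ∧
      ∃ d, M.tail d = a ∧ M.tail (M.rev d) = b) v w →
      (¬ M.Inc v f ↔ ¬ M.Inc w f) ∧
      (¬ M.Inc v f → ∀ d e, M.tail d = v → M.tail e = w → c d = c e) := by
    intro v w h
    induction h with
    | rel v w h =>
      obtain ⟨h1, h2, x, rfl, rfl⟩ := h
      refine ⟨iff_of_true h1 h2, fun _ d e hd he => ?_⟩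
      rw [same d x (by rw [hd]; exact h1) hd, out x h1, same (M.rev x) e h2 he.symm]
    | refl => exact ⟨Iff.rfl, fun hv d e hd he => same d e (by rwa [hd]) (hd.trans he.symm)⟩
    | symm _ _ _ ih =>
      exact ⟨ih.1.symm, fun hv d e hd he => (ih.2 (ih.1.2 hv) e d he hd).symm⟩
    | trans _ w _ _ _ ih ih' =>
      refine ⟨ih.1.trans ih'.1, fun hv d e hd he => ?_⟩
      obtain ⟨x, hx⟩ := M.tail_surjective w
      exact (ih.2 hv d x hd hx).trans (ih'.2 (ih.1.1 hv) x e hx he)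
  -- By `chord`, an edge that is not on `f` has an end off `f`, where connectedness of the
  -- complement of `f` applies.
  have ends : ∀ d, M.left d ≠ f → M.left (M.rev d) ≠ f →
      ∃ y, ¬ M.Inc (M.tail y) f ∧ c d = c y := by
    intro d h1 h2
    by_cases hd : M.Inc (M.tail d) f
    · refine ⟨M.rev d, fun h3 => ?_, h0 d h1 h2⟩
      exact (M.chord d f hd h3).elim h1 h2
    · exact ⟨d, hd, rfl⟩
  by_cases hex : ∃ y, ¬ M.Inc (M.tail y) f
  · obtain ⟨y, hy⟩ := hex
    refine ⟨c y, fun d h1 h2 => ?_⟩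
    obtain ⟨z, hz, hdz⟩ := ends d h1 h2
    rw [hdz]
    exact (key _ _ (M.joined_face f _ _ hz hy)).2 hz z y rfl rfl
  · refine ⟨0, fun d h1 h2 => ?_⟩
    obtain ⟨z, hz, -⟩ := ends d h1 h2
    exact absurd ⟨z, hz⟩ hex

-- The conclusion of `RotationSystem.IsPlanar.exists_potential` for `ρ`, with a function on the
-- faces of `ρ` read as a function `c` on darts; it depends on the face alone when `c (ρ d) = c
-- (M.rev d)`.
variable (hpot : ∀ h : D → ℝ, (∀ d, h (M.rev d) = -h d) →
    (∀ g : V → ℝ, ∑ᶠ d, g (M.tail d) * h d = 0) →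
    ∃ c : D → ℝ, (∀ d, c (ρ d) = c (M.rev d)) ∧ ∀ d, h d = c d - c (M.rev d))

include hpot

/-- A combinatorial Jordan curve theorem for the boundary of a face `f` of `M` drawn in the
embedding `ρ`. The boundary is a circulation; its potential jumps by one across each edge of `f`,
and off the boundary only one value `k` occurs. -/
theorem exists_face_potential (f : F) : ∃ (c : D → ℝ) (k : ℝ), (∀ d, c (ρ d) = c (M.rev d)) ∧
    (∀ d, M.left d = f → c d = c (M.rev d) + 1) ∧
    ∀ d, M.left d ≠ f → M.left (M.rev d) ≠ f → c d = k := by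
  classical
  have := M.finite
  have := Fintype.ofFinite D
  obtain ⟨c, hc, hd⟩ := hpot (fun d => (if M.left d = f then 1 else 0) -
    (if M.left (M.rev d) = f then 1 else 0)) (by intro d; rw [M.rev_rev]; ring) (by
      intro g
      rw [finsum_eq_sum_of_fintype]
      simp only [mul_sub, Finset.sum_sub_distrib]
      rw [sub_eq_zero, ← Equiv.sum_comp M.rot]
      simp only [M.tail_rot, M.left_rot])
  obtain ⟨k, hk⟩ := potential_const htail horb (f := f) hc (by
    intro d h1 h2
    have := hd d
    rw [if_neg h1, if_neg h2] at this
    linarith)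
  refine ⟨c, k, hc, fun d h1 => ?_, hk⟩
  have := hd d
  rw [if_pos h1, if_neg (by rw [← h1]; exact M.left_rev_ne d)] at this
  linarith

/-- The rotation `ρ` and the given one agree at every corner, up to orientation. -/
theorem corner_sign (b : D) : (ρ b = M.rot b ∨ ρ (M.rot b) = b) ∧
    ∃ (c : D → ℝ) (k : ℝ), ∀ b', M.left (M.rot b') = M.left (M.rot b) →
      (ρ b' ≠ M.rot b' → c b' = k - 1) ∧ (ρ (M.rot b') ≠ b' → c (M.rot b') = k + 1) ∧
      c (M.rot b') = c (M.rev (M.rot b')) + 1 := by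
  have := M.finite
  obtain ⟨c, k, hc, hf, hk⟩ := exists_face_potential htail horb hpot (M.left (M.rot b))
  have hρ : ∀ x, ρ x ≠ x := by
    intro x hx
    have := sameCycle_induction (horb x (M.rot x) (M.tail_rot x).symm) (P := fun y => y = x) rfl
      (by rintro y rfl; exact hx)
    exact M.rot_ne x this
  have other : ∀ b', M.left (M.rot b') = M.left (M.rot b) → ∀ x, M.tail x = M.tail b' → x ≠ b' →
      x ≠ M.rot b' → M.left x ≠ M.left (M.rot b) ∧ M.left (M.rev x) ≠ M.left (M.rot b) := by
    intro b' hb x hx h1 h2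
    rw [← hb]
    refine ⟨fun h => h2 (M.corner _ _ (hx.trans (M.tail_rot _).symm) h), fun h => ?_⟩
    rw [← M.left_rot x] at h
    exact h1 (M.rot.injective (M.corner _ _ (by rw [M.tail_rot, M.tail_rot, hx]) h))
  -- At this vertex only `b'` and `rot b'` lie on the face. If the dart that follows one of them
  -- under `ρ` is not the other one, it carries the value `k`, and the jump across the boundary
  -- determines the value at the dart before it.
  have step : ∀ b', M.left (M.rot b') = M.left (M.rot b) →
      (ρ b' ≠ M.rot b' → c b' = k - 1) ∧ (ρ (M.rot b') ≠ b' → c (M.rot b') = k + 1) := by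
    intro b' hb
    constructor
    · intro h
      obtain ⟨h1, h2⟩ := other b' hb _ (htail b') (hρ b') h
      have h3 := hk _ h1 h2
      rw [hc, hf (M.rev b') (by rw [← M.left_rot, hb]), M.rev_rev] at h3
      linarith
    · intro h
      obtain ⟨h1, h2⟩ := other b' hb _ ((htail _).trans (M.tail_rot b')) h (hρ _)
      have h3 := hk _ h1 h2
      rw [hc] at h3
      have := hf _ hb
      linarith
  refine ⟨?_, c, k, fun b' hb => ⟨(step b' hb).1, (step b' hb).2, hf _ hb⟩⟩
  by_contra hcon
  rw [not_or] at hcon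
  obtain ⟨n1, n2⟩ := hcon
  have s1 := (step b rfl).1 n1
  have s2 := (step b rfl).2 n2
  -- Starting from `ρ b` all values stay equal to `k`, while `b` and `rot b` carry `k - 1` and `k +
  -- 1`. So the orbit of `ρ` would never come back to `b`.
  have := sameCycle_induction (horb (ρ b) b (htail b))
    (P := fun x => M.tail x = M.tail b ∧ x ≠ b ∧ x ≠ M.rot b) ⟨htail b, hρ b, n1⟩ (by
      rintro x ⟨h1, h2, h3⟩
      obtain ⟨h4, h5⟩ := other b rfl x h1 h2 h3
      have h6 : c (ρ x) = k := by
        rw [hc]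
        exact hk _ h5 (by rwa [M.rev_rev])
      refine ⟨(htail x).trans h1, ?_, ?_⟩
      · intro h7; rw [h7, s1] at h6; linarith
      · intro h7; rw [h7, s2] at h6; linarith)
  exact this.2.1 rfl

/-- A planar rotation system on the graph of a polyhedral map is the given one or its mirror
image. -/
theorem rigid : ρ = M.rot ∨ ρ = M.rot⁻¹ := by
  have := M.finite
  have sign := fun b => (corner_sign htail horb hpot b).1
  -- Otherwise `b` and `rot b` would be all the darts at the vertex.
  have both : ∀ b, ρ b = M.rot b → ρ (M.rot b) ≠ b := by
    intro b h1 h2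
    have := sameCycle_induction (horb b (M.rot (M.rot b)) (by simp only [M.tail_rot]))
      (P := fun x => x = b ∨ x = M.rot b) (.inl rfl) (by
        rintro x (rfl | rfl)
        · exact .inr h1
        · exact .inl h2)
    exact this.elim (M.rot_rot_ne b) (M.rot_ne _)
  have hrot : ∀ d, ρ d = M.rot d ↔ ρ (M.rot d) = M.rot (M.rot d) := by
    intro d
    constructor
    · intro h
      refine (sign (M.rot d)).resolve_right fun h1 => ?_
      rw [← h] at h1
      exact M.rot_rot_ne d ((congrArg M.rot h.symm).trans (ρ.injective h1))
    · intro h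
      refine (sign d).resolve_right fun h1 => ?_
      exact M.rot_rot_ne d (h.symm.trans h1)
  have hrev : ∀ d, ρ d = M.rot d → ρ (M.rev d) = M.rot (M.rev d) := by
    intro d h
    -- The corners at the two ends of `d` on the face to its left share one potential. If `ρ` had
    -- opposite orientations there, the values on the two sides of `d` would be `k + 1` and `k - 1`,
    -- but they differ by one.
    obtain ⟨-, c, k, hck⟩ := corner_sign htail horb hpot (M.rev d)
    by_contra h1
    have h2 := (hck _ rfl).1 h1
    obtain ⟨b, rfl⟩ := M.rot.surjective d
    have h3 := hck b (by rw [M.left_rot (M.rev _), M.rev_rev])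
    have h4 := h3.2.1 (both b ((hrot b).2 h))
    rw [h3.2.2, h2] at h4
    linarith
  by_cases hall : ∀ d, ρ d = M.rot d
  · exact .inl (Equiv.ext hall)
  · right
    push Not at hall
    obtain ⟨d, hd⟩ := hall
    ext e
    have he : ∀ e, ρ (M.rot e) = e := fun e => (sign e).resolve_left fun h =>
      hd ((M.dart_iff (P := fun d => ρ d = M.rot d) hrot hrev e d).1 h)
    rw [Equiv.Perm.eq_inv_iff_eq.2 (show M.rot (ρ e) = e from ?_)]
    have := he (M.rot.symm e)
    rw [Equiv.apply_symm_apply] at this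
    rw [this, Equiv.apply_symm_apply]

end Rigid

end PolyMap

/-! ### Rotation systems and polyhedral maps -/

/-- Labelled darts of a graph. -/
theorem exists_dartEquiv {X : Type*} {P : SimpleGraph X} {D : Type*} {rev : D → D} {t : D → X}
    (hrev : ∀ d, rev (rev d) = d)
    (hadj : ∀ a b, P.Adj a b ↔ ∃ d, t d = a ∧ t (rev d) = b)
    (hinj : ∀ d e, t d = t e → t (rev d) = t (rev e) → d = e) :
    ∃ κ : D ≃ P.Dart, (∀ d, (κ d).fst = t d) ∧ ∀ d, κ (rev d) = (κ d).symm := by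
  let f : D → P.Dart := fun d => ⟨(t d, t (rev d)), (hadj _ _).2 ⟨d, rfl, rfl⟩⟩
  have hf : Function.Bijective f := by
    constructor
    · intro d e h
      have h := congrArg SimpleGraph.Dart.toProd h
      exact hinj d e (congrArg Prod.fst h) (congrArg Prod.snd h)
    · rintro ⟨⟨a, b⟩, h⟩
      obtain ⟨d, rfl, rfl⟩ := (hadj a b).1 h
      exact ⟨d, rfl⟩
  refine ⟨Equiv.ofBijective f hf, fun d => rfl, fun d => ?_⟩
  ext
  · rfl
  · exact congrArg t (hrev d)

/-- Labelled darts with rotation and face data give a planar rotation system. -/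
theorem exists_rotationSystem {X Y D : Type*} {P : SimpleGraph X} [Finite D] {rev : D → D}
    {ρ : Equiv.Perm D} {t : D → X} {l : D → Y}
    (hrev : ∀ d, rev (rev d) = d)
    (hadj : ∀ a b, P.Adj a b ↔ ∃ d, t d = a ∧ t (rev d) = b)
    (hinj : ∀ d e, t d = t e → t (rev d) = t (rev e) → d = e)
    (ht : ∀ d, t (ρ d) = t d) (htorb : ∀ d e, t d = t e → SameOrbit ρ d e)
    (hl : ∀ d, l (ρ (rev d)) = l d)
    (hlorb : ∀ d e, l d = l e → SameOrbit (fun a => ρ (rev a)) d e)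
    (htsurj : Function.Surjective t) (hlsurj : Function.Surjective l) (hconn : P.Connected)
    (heuler : 2 * (Nat.card X + Nat.card Y) = Nat.card D + 4) :
    ∃ (R : RotationSystem P) (κ : D ≃ P.Dart), R.IsPlanar ∧ (∀ d, (κ d).fst = t d) ∧
      (∀ d, κ (rev d) = (κ d).symm) ∧ (∀ d, R.rot (κ d) = κ (ρ d)) ∧
      ∃ Fe : R.Face ≃ Y, ∀ d, Fe (R.face (κ d)) = l d := by
  classical
  obtain ⟨κ, hκ, hκr⟩ := exists_dartEquiv hrev hadj hinj
  let R : RotationSystem P :=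
    { rot := (κ.symm.trans ρ).trans κ
      rot_fst := by
        intro d
        obtain ⟨x, rfl⟩ := κ.surjective d
        simp only [Equiv.trans_apply, Equiv.symm_apply_apply, hκ, ht]
      rot_cyclic := by
        intro d e h
        obtain ⟨x, rfl⟩ := κ.surjective d
        obtain ⟨y, rfl⟩ := κ.surjective e
        rw [hκ, hκ] at h
        have := htorb x y h
        refine SameOrbit.sameCycle ?_
        induction this with
        | rel a b hab => exact .rel _ _ (by simp [hab])
        | refl => exact .refl _
        | symm a b hab ih =>
          exact .symm _ _ (ih (SameOrbit.eq ht hab))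
        | trans a b c hab _ ih ih' =>
          have := SameOrbit.eq ht hab
          exact .trans _ _ _ (ih this) (ih' (this.symm.trans h)) }
  have hrot : ∀ d, R.rot (κ d) = κ (ρ d) := by
    intro d
    change κ (ρ (κ.symm (κ d))) = _
    rw [Equiv.symm_apply_apply]
  have hnext : ∀ d, R.faceNext (κ d) = κ (ρ (rev d)) := by
    intro d
    rw [RotationSystem.faceNext_apply, ← hκr, hrot]
  have hface : ∀ d e, R.face (κ d) = R.face (κ e) ↔ l d = l e := by
    intro d e
    constructor
    · intro h
      rw [RotationSystem.face_eq_iff] at h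
      have : Finite P.Dart := Finite.of_equiv D κ
      have := PolyMap.sameCycle_induction h (P := fun x => l (κ.symm x) = l d) (by simp) (by
        intro y hy
        obtain ⟨z, rfl⟩ := κ.surjective y
        rw [hnext, Equiv.symm_apply_apply, hl]
        simpa using hy)
      simpa using this.symm
    · intro h
      have h' := hlorb d e h
      clear h
      induction h' with
      | rel a b hab =>
        subst hab
        rw [← hnext, RotationSystem.face_faceNext]
      | refl => rfl
      | symm _ _ _ ih => exact ih.symm
      | trans _ _ _ _ _ ih ih' => exact ih.trans ih'
  let Fe : R.Face → Y := Quotient.lift (fun x => l (κ.symm x)) (by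
    intro a b hab
    obtain ⟨x, rfl⟩ := κ.surjective a
    obtain ⟨y, rfl⟩ := κ.surjective b
    simp only [Equiv.symm_apply_apply]
    exact (hface x y).1 (Quotient.sound hab))
  have hFe : ∀ d, Fe (R.face (κ d)) = l d := by
    intro d
    change l (κ.symm (κ d)) = l d
    rw [Equiv.symm_apply_apply]
  have hFebij : Function.Bijective Fe := by
    constructor
    · intro a b h
      obtain ⟨a, rfl⟩ := R.face_surjective a
      obtain ⟨b, rfl⟩ := R.face_surjective b
      obtain ⟨x, rfl⟩ := κ.surjective a
      obtain ⟨y, rfl⟩ := κ.surjective b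
      rw [hFe, hFe] at h
      exact (hface x y).2 h
    · intro y
      obtain ⟨d, rfl⟩ := hlsurj y
      exact ⟨_, hFe d⟩
  have hX : Finite X := Finite.of_surjective t htsurj
  have := Fintype.ofFinite X
  refine ⟨R, κ, ⟨hX, hconn, ?_⟩, hκ, hκr, hrot, Equiv.ofBijective Fe hFebij, hFe⟩
  rw [Nat.card_congr (Equiv.ofBijective Fe hFebij)]
  have h1 := P.dart_card_eq_twice_card_edges
  rw [← Nat.card_eq_fintype_card, ← Nat.card_congr κ] at h1
  have h2 : Nat.card P.edgeSet = P.edgeFinset.card := by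
    rw [Nat.card_eq_fintype_card, SimpleGraph.edgeFinset_card]
  omega

namespace PolyMap

variable {D V F : Type} (M : PolyMap D V F)

theorem primal_connected : M.primal.Connected := by
  have hV : Nonempty V := by
    by_contra h
    rw [not_nonempty_iff] at h
    have hD : IsEmpty D := ⟨fun d => h.elim (M.tail d)⟩
    have hF : IsEmpty F := ⟨fun f => hD.elim (M.left_surjective f).choose⟩
    have := M.euler
    simp at this
  refine @SimpleGraph.Connected.mk _ _ ?_ hV
  intro v w
  have := M.joined_empty v w (by simp) (by simp)
  induction this with
  | rel a b h => exact SimpleGraph.Adj.reachable h.2.2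
  | refl => exact .refl _
  | symm _ _ _ ih => exact ih.symm
  | trans _ _ _ _ _ ih ih' => exact ih.trans ih'

theorem dual_connected : M.dual.Connected := by
  obtain ⟨v⟩ := M.primal_connected.nonempty
  obtain ⟨d, -⟩ := M.tail_surjective v
  refine @SimpleGraph.Connected.mk _ _ ?_ ⟨M.left d⟩
  intro f g
  obtain ⟨x, rfl⟩ := M.left_surjective f
  obtain ⟨y, rfl⟩ := M.left_surjective g
  have hrev : ∀ d, M.dual.Reachable (M.left x) (M.left d) →
      M.dual.Reachable (M.left x) (M.left (M.rev d)) := fun d h =>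
    h.trans (M.dual_adj_rev d).reachable
  refine (M.dart_iff (P := fun d => M.dual.Reachable (M.left x) (M.left d)) ?_ hrev x y).1 (.refl _)
  intro d
  rw [M.left_rot]
  refine ⟨hrev d, fun h => ?_⟩
  have := hrev _ h
  rwa [M.rev_rev] at this

/-- A graph isomorphic to the dual of the map is a planar dual of the primal graph. -/
theorem isPlanarDual {X : Type*} {G : SimpleGraph X} (e : G ≃g M.dual) :
    IsPlanarDual G M.primal := by
  have := M.finite
  obtain ⟨R, κ, hR, h1, h2, -, Fe, hFe⟩ := exists_rotationSystem (P := M.primal) (rev := M.rev)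
    (ρ := M.rot) (t := M.tail) (l := M.left) M.rev_rev (fun _ _ => Iff.rfl)
    (fun _ _ => M.tail_injective) M.tail_rot M.tail_orbit M.left_next M.left_orbit
    M.tail_surjective M.left_surjective M.primal_connected M.euler
  obtain ⟨κ', h1', h2'⟩ := exists_dartEquiv (P := G) (rev := M.rev)
    (t := fun d => e.symm (M.left d)) M.rev_rev (by
      intro a b
      rw [← e.map_adj_iff, dual_adj]
      simp only [RelIso.symm_apply_eq]) (by
      intro d d' h h'
      exact M.left_injective d d' (e.symm.injective h) (e.symm.injective h'))
  refine ⟨R, hR, Fe.trans e.symm.toEquiv, κ.symm.trans κ', ?_, ?_⟩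
  · intro d
    obtain ⟨x, rfl⟩ := κ.surjective d
    rw [← h2]
    simp only [Equiv.trans_apply, Equiv.symm_apply_apply, h2']
  · intro d
    obtain ⟨x, rfl⟩ := κ.surjective d
    simp only [Equiv.trans_apply, Equiv.symm_apply_apply, h1', hFe]
    rfl

/-- The faces around a vertex of degree three form a triangular face of the dual. -/
theorem isTriangularFace {X : Type*} {G : SimpleGraph X} (e : G ≃g M.dual) {v : V} (hv : M.Tri v) :
    IsTriangularFace G {x | M.Inc v (e x)} := by
  have := M.finite
  have := M.finite_left
  have := M.finite_tail
  have hnn : ∀ d, M.next (M.rev d) = M.rot d := fun d => by rw [next, M.rev_rev]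
  -- The dual embedding: its rotation is `next`, and its faces are the vertices of `M`.
  let ν : Equiv.Perm D := (Function.Involutive.toPerm M.rev M.rev_rev).trans M.rot
  have hν : ∀ d, ν d = M.next d := fun _ => rfl
  have hX : Nat.card X = Nat.card F := Nat.card_congr e.toEquiv
  obtain ⟨R, κ, hR, h1, h2, h3, -⟩ := exists_rotationSystem (P := G) (rev := M.rev)
    (ρ := ν) (t := fun d => e.symm (M.left d)) (l := M.tail) M.rev_rev (by
      intro a b
      rw [← e.map_adj_iff, dual_adj]
      simp only [RelIso.symm_apply_eq]) (by
      intro d d' h h'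
      exact M.left_injective d d' (e.symm.injective h) (e.symm.injective h'))
    (by intro d; rw [hν, M.left_next])
    (by intro d d' h; exact M.left_orbit d d' (e.symm.injective h))
    (by intro d; rw [hν, hnn, M.tail_rot])
    (by
      intro d d' h
      have := M.tail_orbit d d' h
      refine Relation.EqvGen.mono ?_ _ _ this
      intro a b hab
      change ν (M.rev a) = b
      rw [hν, hnn, hab])
    (e.symm.surjective.comp M.left_surjective) M.tail_surjective
    (e.connected_iff.2 M.dual_connected)
    (by rw [hX, add_comm (Nat.card F)]; exact M.euler)
  obtain ⟨d, rfl⟩ := M.tail_surjective v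
  have hn : ∀ d, R.faceNext (κ d) = κ (M.rot d) := by
    intro d
    rw [RotationSystem.faceNext_apply, ← h2, h3, hν, hnn]
  refine ⟨R, hR, κ d, ?_, ?_⟩
  · rw [hn, hn, hn, hv d rfl]
  · ext x
    simp only [hn, h1, Set.mem_ofPred_eq, hv.inc_iff, Set.mem_insert_iff, Set.mem_singleton_iff,
      RelIso.eq_symm_apply]

/-- If the primal graph is isomorphic to `G'`, then every planar dual of `G'` is isomorphic to the
dual graph. -/
theorem dual_iso_of_isPlanarDual {X X' : Type*} {G : SimpleGraph X} {G' : SimpleGraph X'}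
    (h : IsPlanarDual G G') (ψ : G' ≃g M.primal) : Nonempty (G ≃g M.dual) := by
  classical
  obtain ⟨R, hR, Fe, δ, hδ, hδF⟩ := h
  have := M.finite
  have := hR.finite
  have := Fintype.ofFinite X'
  have := Fintype.ofFinite D
  obtain ⟨κ, h1, h2⟩ := exists_dartEquiv (P := G') (rev := M.rev)
    (t := fun d => ψ.symm (M.tail d)) M.rev_rev (by
      intro a b
      rw [← ψ.map_adj_iff, primal_adj]
      simp only [RelIso.symm_apply_eq]) (by
      intro d d' h h'
      exact M.tail_injective (ψ.symm.injective h) (ψ.symm.injective h'))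
  let ρ : Equiv.Perm D := (κ.trans R.rot).trans κ.symm
  have hρ : ∀ d, κ (ρ d) = R.rot (κ d) := by
    intro d
    change κ (κ.symm _) = _
    rw [Equiv.apply_symm_apply]; rfl
  have tail_κ : ∀ d e, (κ d).fst = (κ e).fst ↔ M.tail d = M.tail e := by
    intro d e
    rw [h1, h1, ψ.symm.injective.eq_iff]
  have hrig := rigid (M := M) (ρ := ρ) (by
      intro d
      rw [← tail_κ, hρ, R.rot_fst]) (by
      intro d e h
      have : Finite G'.Dart := Finite.of_equiv D κ
      have := sameCycle_induction (R.rot_cyclic _ _ ((tail_κ d e).2 h))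
        (P := fun x => ρ.SameCycle d (κ.symm x))
        (by rw [Equiv.symm_apply_apply]) (by
          intro y hy
          obtain ⟨z, rfl⟩ := κ.surjective y
          rw [← hρ]
          simp only [Equiv.symm_apply_apply] at hy ⊢
          exact Equiv.Perm.sameCycle_apply_right.2 hy)
      simpa using this) (by
      intro h anti hdiv
      obtain ⟨c, hc⟩ := hR.exists_potential (fun x => h (κ.symm x)) (by
          intro x
          obtain ⟨d, rfl⟩ := κ.surjective x
          rw [← h2, Equiv.symm_apply_apply, Equiv.symm_apply_apply, anti]) (by
          intro g
          have := hdiv (fun v => g (ψ.symm v))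
          rw [finsum_eq_sum_of_fintype] at this
          rw [← this, ← Equiv.sum_comp κ]
          simp only [h1, Equiv.symm_apply_apply])
      refine ⟨fun d => c (R.face (κ d)), fun d => ?_, fun d => ?_⟩
      · simp only [hρ, R.face_rot, h2]
      · have := hc (κ d)
        rwa [Equiv.symm_apply_apply, ← h2] at this)
  have hnext : ∀ d, R.faceNext (κ d) = κ (ρ (M.rev d)) := by
    intro d
    rw [RotationSystem.faceNext_apply, ← h2, hρ]
  -- By rigidity the faces of `R` are those of `M`, found to the left of each dart or, in the mirror
  -- image, to its right. Either way `L` computes the adjacency of faces.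
  obtain ⟨L, hL, hLadj, hLinj⟩ : ∃ L : D → F, (∀ d e, R.face (κ d) = R.face (κ e) ↔ L d = L e) ∧
      (∀ a b, M.dual.Adj a b ↔ ∃ d, L d = a ∧ L (M.rev d) = b) ∧ Function.Surjective L := by
    have gen : ∀ L : D → F, (∀ d, L (ρ (M.rev d)) = L d) →
        (∀ d e, L d = L e → SameOrbit (fun a => ρ (M.rev a)) d e) →
        ∀ d e, R.face (κ d) = R.face (κ e) ↔ L d = L e := by
      intro L hL hL' d e
      constructor
      · intro h
        rw [RotationSystem.face_eq_iff] at h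
        have : Finite G'.Dart := Finite.of_equiv D κ
        have := sameCycle_induction h (P := fun x => L (κ.symm x) = L d) (by simp) (by
          intro y hy
          obtain ⟨z, rfl⟩ := κ.surjective y
          rw [hnext, Equiv.symm_apply_apply, hL]
          simpa using hy)
        simpa using this.symm
      · intro h
        have h' := hL' d e h
        clear h
        induction h' with
        | rel a b hab =>
          subst hab
          rw [← hnext, RotationSystem.face_faceNext]
        | refl => rfl
        | symm _ _ _ ih => exact ih.symm
        | trans _ _ _ _ _ ih ih' => exact ih.trans ih'
    rcases hrig with hr | hr
    · refine ⟨M.left, gen _ ?_ ?_, fun a b => Iff.rfl, M.left_surjective⟩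
      · intro d; rw [hr]; exact M.left_next d
      · intro d e h; rw [hr]; exact M.left_orbit d e h
    · refine ⟨fun d => M.left (M.rev d), gen _ ?_ ?_, ?_, ?_⟩
      · intro d
        simp only [hr]
        rw [← M.left_rot]
        exact congrArg M.left (M.rot.apply_symm_apply _)
      · intro d e h
        have key : ∀ a b, SameOrbit (fun x => M.rot (M.rev x)) a b →
            SameOrbit (fun x => ρ (M.rev x)) (M.rev a) (M.rev b) := by
          intro a b hab
          induction hab with
          | rel a b hab =>
            refine .symm _ _ (.rel _ _ ?_)
            simp only [← hab, M.rev_rev, hr]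
            exact M.rot.symm_apply_apply _
          | refl => exact .refl _
          | symm _ _ _ ih => exact .symm _ _ ih
          | trans _ _ _ _ _ ih ih' => exact .trans _ _ _ ih ih'
        have := key _ _ (M.left_orbit _ _ h)
        rwa [M.rev_rev, M.rev_rev] at this
      · intro a b
        rw [M.dual.adj_comm, dual_adj]
        constructor
        · rintro ⟨d, rfl, rfl⟩; exact ⟨d, rfl, by simp only [M.rev_rev]⟩
        · rintro ⟨d, rfl, rfl⟩; exact ⟨d, by simp only [M.rev_rev], rfl⟩
      · intro f
        obtain ⟨d, rfl⟩ := M.left_surjective f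
        exact ⟨M.rev d, by simp only [M.rev_rev]⟩
  let E : R.Face → F := Quotient.lift (fun x => L (κ.symm x)) (by
    intro a b hab
    obtain ⟨x, rfl⟩ := κ.surjective a
    obtain ⟨y, rfl⟩ := κ.surjective b
    simp only [Equiv.symm_apply_apply]
    exact (hL x y).1 (Quotient.sound hab))
  have hE : ∀ d, E (R.face (κ d)) = L d := by
    intro d
    change L (κ.symm (κ d)) = L d
    rw [Equiv.symm_apply_apply]
  have hEbij : Function.Bijective E := by
    constructor
    · intro a b h
      obtain ⟨a, rfl⟩ := R.face_surjective a
      obtain ⟨b, rfl⟩ := R.face_surjective b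
      obtain ⟨x, rfl⟩ := κ.surjective a
      obtain ⟨y, rfl⟩ := κ.surjective b
      rw [hE, hE] at h
      exact (hL x y).2 h
    · intro y
      obtain ⟨d, rfl⟩ := hLinj y
      exact ⟨_, hE d⟩
  refine ⟨⟨Fe.symm.trans (Equiv.ofBijective E hEbij), ?_⟩⟩
  have lab : ∀ d, E (Fe.symm (δ (κ d)).fst) = L d := by
    intro d
    rw [hδF, Equiv.symm_apply_apply, hE]
  intro a b
  simp only [Equiv.trans_apply, Equiv.ofBijective_apply]
  rw [hLadj]
  constructor
  · rintro ⟨d, h3, h4⟩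
    rw [← lab] at h3 h4
    have h3 := Fe.symm.injective (hEbij.1 h3)
    have h4 := Fe.symm.injective (hEbij.1 h4)
    rw [h2, hδ] at h4
    rw [← h3, ← h4]
    exact (δ (κ d)).adj
  · intro h
    obtain ⟨x, hx⟩ := δ.surjective ⟨(a, b), h⟩
    obtain ⟨d, rfl⟩ := κ.surjective x
    refine ⟨d, ?_, ?_⟩
    · rw [← lab, hx]
    · rw [← lab, h2, hδ, hx]; rfl

end PolyMap
/-! ### The tetrahedron -/

/-- The tetrahedron: faces are labelled like the opposite vertices. -/
def tetrahedron : PolyMap (Fin 12) (Fin 4) (Fin 4) where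
  finite := inferInstance
  -- The darts `3 v`, `3 v + 1`, `3 v + 2` leave the vertex `v`, in increasing order of the face to
  -- their left.
  rev := ![8, 10, 4, 11, 2, 6, 5, 9, 0, 7, 1, 3]
  rot :=
    { toFun := ![2, 0, 1, 4, 5, 3, 8, 6, 7, 10, 11, 9]
      invFun := ![1, 2, 0, 5, 3, 4, 7, 8, 6, 11, 9, 10]
      left_inv := by unfold Function.LeftInverse; decide
      right_inv := by unfold Function.RightInverse Function.LeftInverse; decide }
  tail := ![0, 0, 0, 1, 1, 1, 2, 2, 2, 3, 3, 3]
  left := ![1, 2, 3, 0, 2, 3, 0, 1, 3, 0, 1, 2]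
  rev_rev := by decide
  tail_rot := by decide
  left_rot := by decide
  tail_orbit := by
    intro d e h
    have key : e = d ∨ e = ![2, 0, 1, 4, 5, 3, 8, 6, 7, 10, 11, 9] d ∨ e = ![2, 0, 1, 4, 5, 3, 8, 6, 7, 10, 11, 9] (![2, 0, 1, 4, 5, 3, 8, 6, 7, 10, 11, 9] d) := by
      revert d e; decide
    rcases key with rfl | rfl | rfl
    · exact .refl _
    · exact .rel _ _ rfl
    · exact .trans _ _ _ (.rel _ _ rfl) (.rel _ _ rfl)
  left_orbit := by
    intro d e h
    have key : e = d ∨ e = ![2, 0, 1, 4, 5, 3, 8, 6, 7, 10, 11, 9] (![8, 10, 4, 11, 2, 6, 5, 9, 0, 7, 1, 3] d) ∨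
        e = ![2, 0, 1, 4, 5, 3, 8, 6, 7, 10, 11, 9] (![8, 10, 4, 11, 2, 6, 5, 9, 0, 7, 1, 3] (![2, 0, 1, 4, 5, 3, 8, 6, 7, 10, 11, 9] (![8, 10, 4, 11, 2, 6, 5, 9, 0, 7, 1, 3] d))) := by
      revert d e; decide
    rcases key with rfl | rfl | rfl
    · exact .refl _
    · exact .rel _ _ rfl
    · exact .trans _ _ _ (.rel _ _ rfl) (.rel _ _ rfl)
  tail_surjective := by unfold Function.Surjective; decide
  left_surjective := by unfold Function.Surjective; decide
  rot_rot_ne := by decide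
  corner := by decide
  chord := by decide
  left_injective := by decide
  joined_empty := by
    intro a b ha hb
    rcases eq_or_ne a b with rfl | h
    · exact .refl _
    · refine .rel _ _ ⟨ha, hb, ?_⟩
      revert h; clear ha hb; revert a b; decide
  joined_vertex := by
    intro v a b ha hb
    rcases eq_or_ne a b with rfl | h
    · exact .refl _
    · refine .rel _ _ ⟨ha, hb, ?_⟩
      revert h; clear ha hb; revert a b; decide
  joined_face := by
    intro v a b ha hb
    rcases eq_or_ne a b with rfl | h
    · exact .refl _
    · refine .rel _ _ ⟨ha, hb, ?_⟩
      revert h; clear ha hb; revert a b; decide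
  euler := by simp

theorem tetrahedron_primal : tetrahedron.primal = ⊤ := by
  ext a b
  rw [PolyMap.primal_adj, SimpleGraph.top_adj]
  revert a b
  decide

theorem tetrahedron_dual : tetrahedron.dual = ⊤ := by
  ext a b
  rw [PolyMap.dual_adj, SimpleGraph.top_adj]
  revert a b
  decide

theorem tetrahedron_tri (v : Fin 4) : tetrahedron.Tri v := by
  have key : ∀ d, tetrahedron.rot (tetrahedron.rot (tetrahedron.rot d)) = d := by decide
  exact fun d _ => key d

theorem tetrahedron_inc {v f : Fin 4} : tetrahedron.Inc v f ↔ v ≠ f := by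
  unfold PolyMap.Inc
  revert v f
  decide

/-! ### Reductions and isomorphisms -/

theorem DegreeThree.map {V : Type u} {W : Type v} {G : SimpleGraph V} {H : SimpleGraph W}
    (e : G ≃g H) {x : V} (h : DegreeThree G x) : DegreeThree H (e x) := by
  have : H.neighborSet (e x) = e '' G.neighborSet x := by
    ext y
    obtain ⟨z, rfl⟩ := e.surjective y
    rw [e.injective.mem_set_image]
    exact e.map_adj_iff
  rw [DegreeThree, this, Set.ncard_image_of_injective _ e.injective]
  exact h

theorem TriangleReducible.map {V : Type u} {W : Type v} {G : SimpleGraph V} {H : SimpleGraph W}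
    (e : G ≃g H) {p q r : V} (h : TriangleReducible G p q r) :
    TriangleReducible H (e p) (e q) (e r) where
  degree_p := h.degree_p.map e
  degree_q := h.degree_q.map e
  degree_r := h.degree_r.map e
  adj_pq := e.map_adj_iff.2 h.adj_pq
  adj_qr := e.map_adj_iff.2 h.adj_qr
  adj_pr := e.map_adj_iff.2 h.adj_pr
  outside_distinct := by
    intro y h1 h2 h3
    obtain ⟨x, rfl⟩ := e.surjective y
    simp only [e.map_adj_iff]
    exact h.outside_distinct x (fun h => h1 (by rw [h])) (fun h => h2 (by rw [h]))
      (fun h => h3 (by rw [h]))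

theorem PathReducible.map {V : Type u} {W : Type v} {G : SimpleGraph V} {H : SimpleGraph W}
    (e : G ≃g H) {p q r s : V} (h : PathReducible G p q r s) :
    PathReducible H (e p) (e q) (e r) (e s) where
  degree_p := h.degree_p.map e
  degree_q := h.degree_q.map e
  degree_r := h.degree_r.map e
  adj_pq := e.map_adj_iff.2 h.adj_pq
  adj_qr := e.map_adj_iff.2 h.adj_qr
  ne_pr := fun h' => h.ne_pr (e.injective h')
  not_adj_pr := fun h' => h.not_adj_pr (e.map_adj_iff.1 h')
  adj_ps := e.map_adj_iff.2 h.adj_ps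
  adj_qs := e.map_adj_iff.2 h.adj_qs
  adj_rs := e.map_adj_iff.2 h.adj_rs

theorem triangleReduce_iso {V : Type u} {W : Type v} {G : SimpleGraph V} {H : SimpleGraph W}
    (e : G ≃g H) (p q r : V) :
    Nonempty (triangleReduce G p q r ≃g triangleReduce H (e p) (e q) (e r)) := by
  refine ⟨⟨Equiv.optionCongr (e.toEquiv.subtypeEquiv fun x => ?_), ?_⟩⟩
  · simp only [RelIso.coe_fn_toEquiv, ne_eq, e.injective.eq_iff]
  · rintro (_ | x) (_ | y)
    · exact Iff.rfl
    · exact or_congr e.map_adj_iff (or_congr e.map_adj_iff e.map_adj_iff)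
    · exact or_congr e.map_adj_iff (or_congr e.map_adj_iff e.map_adj_iff)
    · exact e.map_adj_iff

theorem pathReduce_adj {V : Type u} {G : SimpleGraph V} {p q r : V} {x y : {x : V // x ≠ q}} :
    (pathReduce G p q r).Adj x y ↔
      G.Adj x.1 y.1 ∨ ((x.1 = p ∧ y.1 = r ∨ x.1 = r ∧ y.1 = p) ∧ x.1 ≠ y.1) := by
  change (G ⊔ SimpleGraph.edge p r).Adj x.1 y.1 ↔ _
  rw [SimpleGraph.sup_adj, SimpleGraph.edge_adj]

theorem pathReduce_iso {V : Type u} {W : Type v} {G : SimpleGraph V} {H : SimpleGraph W}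
    (e : G ≃g H) (p q r : V) :
    Nonempty (pathReduce G p q r ≃g pathReduce H (e p) (e q) (e r)) := by
  refine ⟨⟨e.toEquiv.subtypeEquiv fun x => ?_, ?_⟩⟩
  · simp only [RelIso.coe_fn_toEquiv, ne_eq, e.injective.eq_iff]
  · intro x y
    rw [pathReduce_adj, pathReduce_adj]
    simp only [Equiv.subtypeEquiv_apply, RelIso.coe_fn_toEquiv, e.injective.eq_iff, ne_eq,
      e.map_adj_iff]

theorem Reducible.map {V : Type u} {G : SimpleGraph V} (h : Reducible G) :
    ∀ {W : Type u} {H : SimpleGraph W}, Nonempty (G ≃g H) → Reducible H := by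
  induction h with
  | complete G h =>
    rintro W H ⟨e⟩
    obtain ⟨e'⟩ := h
    exact .complete H ⟨e.symm.trans e'⟩
  | triangle G p q r h _ ih =>
    rintro W H ⟨e⟩
    exact .triangle H _ _ _ (h.map e) (ih (triangleReduce_iso e p q r))
  | path G p q r s h _ ih =>
    rintro W H ⟨e⟩
    exact .path H _ _ _ _ (h.map e) (ih (pathReduce_iso e p q r))

/-! ### The reductions as inverses of truncating and splitting -/

namespace PolyMap

variable {D V F : Type} (M : PolyMap D V F)

theorem tetrahedron_reducible : Reducible tetrahedron.primal :=
  .complete _ (by rw [tetrahedron_primal]; exact ⟨.refl⟩)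

variable {M}

/-- The triangle reduction at the three new vertices gives `M` back; the vertex that replaces them
plays the role of `t`. -/
theorem trunc_reducible {t : V} (ht : M.Tri t) (h : Reducible M.primal) :
    Reducible (M.trunc t ht).primal := by
  obtain ⟨d, hd⟩ := M.tail_surjective t
  let e₁ : {d // M.tail d = t} := ⟨d, hd⟩
  let e₂ := M.rotAt t e₁
  let e₃ := M.rotAt t e₂
  have n12 : e₁ ≠ e₂ := fun h => M.rot_ne d (congrArg Subtype.val h).symm
  have n23 : e₂ ≠ e₃ := fun h => M.rot_ne _ (congrArg Subtype.val h).symm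
  have n13 : e₁ ≠ e₃ := fun h => M.rot_rot_ne d (congrArg Subtype.val h).symm
  have all : ∀ e, e = e₁ ∨ e = e₂ ∨ e = e₃ := by
    intro e
    have h0 : M.Tri (M.tail d) := by rwa [hd]
    rcases h0.cases (e.2.trans hd.symm) with h | h | h
    · exact .inl (Subtype.ext h)
    · exact .inr (.inl (Subtype.ext h))
    · exact .inr (.inr (Subtype.ext h))
  have out : ∀ e e' : {d // M.tail d = t}, e ≠ e' → ∀ x, x ≠ .inr e₁ → x ≠ .inr e₂ → x ≠ .inr e₃ →
      ¬ ((M.trunc t ht).primal.Adj (.inr e) x ∧ (M.trunc t ht).primal.Adj (.inr e') x) := by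
    rintro e e' hne (v | f) h1 h2 h3
    · rw [trunc_primal_mixed, trunc_primal_mixed]
      rintro ⟨h4, h5⟩
      exact hne (Subtype.ext (M.tail_injective (e.2.trans e'.2.symm) (h4.symm.trans h5)))
    · rcases all f with rfl | rfl | rfl
      · exact absurd rfl h1
      · exact absurd rfl h2
      · exact absurd rfl h3
  refine .triangle _ (.inr e₁) (.inr e₂) (.inr e₃)
    { degree_p := (trunc_tri_new ht e₁).degreeThree
      degree_q := (trunc_tri_new ht e₂).degreeThree
      degree_r := (trunc_tri_new ht e₃).degreeThree
      adj_pq := (trunc_primal_new ht).2 n12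
      adj_qr := (trunc_primal_new ht).2 n23
      adj_pr := (trunc_primal_new ht).2 n13
      outside_distinct := fun x h1 h2 h3 => ⟨out _ _ n12 x h1 h2 h3, out _ _ n23 x h1 h2 h3,
        out _ _ n13 x h1 h2 h3⟩ } (h.map ?_)
  let f : V → Option {x : {v // v ≠ t} ⊕ {d // M.tail d = t} //
      x ≠ .inr e₁ ∧ x ≠ .inr e₂ ∧ x ≠ .inr e₃} := fun v =>
    open Classical in if hv : v = t then none else some ⟨.inl ⟨v, hv⟩, by simp, by simp, by simp⟩
  have ft : f t = none := by simp [f]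
  have fo : ∀ v (hv : v ≠ t), f v = some ⟨.inl ⟨v, hv⟩, by simp, by simp, by simp⟩ := by
    intro v hv; simp [f, hv]
  have hf : Function.Bijective f := by
    constructor
    · intro v w h
      by_cases hv : v = t <;> by_cases hw : w = t
      · rw [hv, hw]
      · subst hv; rw [ft, fo w hw] at h; cases h
      · subst hw; rw [ft, fo v hv] at h; cases h
      · rw [fo v hv, fo w hw] at h
        simpa using h
    · rintro (_ | ⟨v | e, h1, h2, h3⟩)
      · exact ⟨t, ft⟩
      · exact ⟨v.1, fo v.1 v.2⟩
      · rcases all e with rfl | rfl | rfl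
        · exact absurd rfl h1
        · exact absurd rfl h2
        · exact absurd rfl h3
  have mixed : ∀ w (hw : w ≠ t), M.primal.Adj t w ↔
      (M.trunc t ht).primal.Adj (.inr e₁) (.inl ⟨w, hw⟩) ∨
      (M.trunc t ht).primal.Adj (.inr e₂) (.inl ⟨w, hw⟩) ∨
      (M.trunc t ht).primal.Adj (.inr e₃) (.inl ⟨w, hw⟩) := by
    intro w hw
    simp only [trunc_primal_mixed]
    constructor
    · rintro ⟨x, hx, rfl⟩
      rcases all ⟨x, hx⟩ with h | h | h
      · exact .inl (by rw [← h])
      · exact .inr (.inl (by rw [← h]))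
      · exact .inr (.inr (by rw [← h]))
    · rintro (h | h | h)
      · exact ⟨_, e₁.2, h.symm⟩
      · exact ⟨_, e₂.2, h.symm⟩
      · exact ⟨_, e₃.2, h.symm⟩
  refine ⟨⟨Equiv.ofBijective f hf, ?_⟩⟩
  intro v w
  simp only [Equiv.ofBijective_apply]
  by_cases hv : v = t <;> by_cases hw : w = t
  · rw [hv, hw, ft]; exact iff_of_false (fun h => h) (M.primal.irrefl)
  · rw [hv, ft, fo w hw, mixed w hw]; exact Iff.rfl
  · rw [hw, ft, fo v hv, M.primal.adj_comm, mixed v hv]; exact Iff.rfl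
  · rw [fo v hv, fo w hw]
    exact trunc_primal_old ht (v := ⟨v, hv⟩) (w := ⟨w, hw⟩)

theorem _root_.Set.exists_third {α : Type*} {S : Set α} (h : S.ncard = 3) {a b : α} (ha : a ∈ S)
    (hb : b ∈ S) (hab : a ≠ b) : ∃ c, c ≠ a ∧ c ≠ b ∧ ∀ x, x ∈ S ↔ x = a ∨ x = b ∨ x = c := by
  have hfin : S.Finite := Set.finite_of_ncard_ne_zero (by omega)
  have h1 : ((S \ {a}) \ {b}).ncard = 1 := by
    rw [Set.ncard_sdiff_singleton_of_mem (show b ∈ S \ {a} from ⟨hb, hab.symm⟩),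
      Set.ncard_sdiff_singleton_of_mem ha, h]
  obtain ⟨c, hc⟩ := Set.ncard_eq_one.1 h1
  have hc' : c ∈ (S \ {a}) \ {b} := by rw [hc]; rfl
  refine ⟨c, hc'.1.2, hc'.2, fun x => ⟨fun hx => ?_, ?_⟩⟩
  · by_cases hxa : x = a
    · exact .inl hxa
    by_cases hxb : x = b
    · exact .inr (.inl hxb)
    have : x ∈ (S \ {a}) \ {b} := ⟨⟨hx, hxa⟩, hxb⟩
    rw [hc] at this
    exact .inr (.inr this)
  · rintro (rfl | rfl | rfl)
    · exact ha
    · exact hb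
    · exact hc'.1.1

/-- The three corners of a reducible triangle have unique, distinct outside neighbours. -/
theorem _root_.D3.TriangleReducible.exists_out {X : Type*} {G : SimpleGraph X} {p q r : X}
    (h : TriangleReducible G p q r) :
    ∃ out : X → X, (∀ z, ¬ (z ≠ p ∧ z ≠ q ∧ z ≠ r) → (out z ≠ p ∧ out z ≠ q ∧ out z ≠ r) ∧
      ∀ x, (x ≠ p ∧ x ≠ q ∧ x ≠ r) → (G.Adj z x ↔ x = out z)) := by
  obtain ⟨p', p1, p2, p3⟩ := Set.exists_third h.degree_p (a := q) (b := r) h.adj_pq h.adj_pr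
    h.adj_qr.ne
  obtain ⟨q', q1, q2, q3⟩ := Set.exists_third h.degree_q (a := p) (b := r) h.adj_pq.symm h.adj_qr
    h.adj_pr.ne
  obtain ⟨r', r1, r2, r3⟩ := Set.exists_third h.degree_r (a := p) (b := q) h.adj_pr.symm
    h.adj_qr.symm h.adj_pq.ne
  have p4 : p' ≠ p := fun h' => G.irrefl (v := p) ((p3 p).2 (by simp [h']))
  have q4 : q' ≠ q := fun h' => G.irrefl (v := q) ((q3 q).2 (by simp [h']))
  have r4 : r' ≠ r := fun h' => G.irrefl (v := r) ((r3 r).2 (by simp [h']))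
  simp only [SimpleGraph.mem_neighborSet] at p3 q3 r3
  classical
  refine ⟨fun z => if z = p then p' else if z = q then q' else r', fun z hz => ?_⟩
  have npq := h.adj_pq.ne
  have npr := h.adj_pr.ne
  have nqr := h.adj_qr.ne
  by_cases h1 : z = p
  · subst h1
    simp only [if_true]
    exact ⟨⟨p4, p1, p2⟩, fun x hx => by rw [p3]; simp [hx.2.1, hx.2.2]⟩
  by_cases h2 : z = q
  · subst h2
    simp only [if_true, if_neg h1]
    exact ⟨⟨q1, q4, q2⟩, fun x hx => by rw [q3]; simp [hx.1, hx.2.2]⟩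
  have h3 : z = r := by tauto
  subst h3
  simp only [if_neg h1, if_neg h2]
  exact ⟨⟨r1, r2, r4⟩, fun x hx => by rw [r3]; simp [hx.1, hx.2.1]⟩

theorem _root_.D3.mem_of_not_outside {X : Type*} {p q r z : X}
    (h : ¬ (z ≠ p ∧ z ≠ q ∧ z ≠ r)) : z = p ∨ z = q ∨ z = r := by
  tauto

/-- The vertex `none` created by the reduction has degree three, and truncating its image undoes the
reduction. Each of `p`, `q`, `r` becomes the corner on the edge towards its own outside neighbour.
-/
theorem exists_trunc_iso {X : Type*} {G : SimpleGraph X} {p q r : X}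
    (h : TriangleReducible G p q r) (ψ : triangleReduce G p q r ≃g M.primal) :
    ∃ (t : V) (ht : M.Tri t), Nonempty (G ≃g (M.trunc t ht).primal) := by
  obtain ⟨out, hout⟩ := h.exists_out
  have npq := h.adj_pq.ne
  have npr := h.adj_pr.ne
  have nqr := h.adj_qr.ne
  have ip : ¬ (p ≠ p ∧ p ≠ q ∧ p ≠ r) := by simp
  have iq : ¬ (q ≠ p ∧ q ≠ q ∧ q ≠ r) := by simp
  have ir : ¬ (r ≠ p ∧ r ≠ q ∧ r ≠ r) := by simp
  have inj : ∀ z w, ¬ (z ≠ p ∧ z ≠ q ∧ z ≠ r) → ¬ (w ≠ p ∧ w ≠ q ∧ w ≠ r) → out z = out w →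
      z = w := by
    intro z w hz hw hzw
    by_contra hne
    have a1 := ((hout z hz).2 _ (hout z hz).1).2 rfl
    have a2 := ((hout w hw).2 _ (hout w hw).1).2 rfl
    rw [← hzw] at a2
    obtain ⟨o1, o2, o3⟩ := (hout z hz).1
    obtain ⟨b1, b2, b3⟩ := h.outside_distinct (out z) o1 o2 o3
    rcases mem_of_not_outside hz with rfl | rfl | rfl <;>
      rcases mem_of_not_outside hw with rfl | rfl | rfl
    · exact hne rfl
    · exact b1 ⟨a1, a2⟩
    · exact b3 ⟨a1, a2⟩
    · exact b1 ⟨a2, a1⟩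
    · exact hne rfl
    · exact b2 ⟨a1, a2⟩
    · exact b3 ⟨a2, a1⟩
    · exact b2 ⟨a2, a1⟩
    · exact hne rfl
  have inner : ∀ z w, ¬ (z ≠ p ∧ z ≠ q ∧ z ≠ r) → ¬ (w ≠ p ∧ w ≠ q ∧ w ≠ r) →
      (G.Adj z w ↔ z ≠ w) := by
    intro z w hz hw
    refine ⟨fun h => h.ne, fun hne => ?_⟩
    rcases mem_of_not_outside hz with rfl | rfl | rfl <;>
      rcases mem_of_not_outside hw with rfl | rfl | rfl
    · exact absurd rfl hne
    · exact h.adj_pq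
    · exact h.adj_pr
    · exact h.adj_pq.symm
    · exact absurd rfl hne
    · exact h.adj_qr
    · exact h.adj_pr.symm
    · exact h.adj_qr.symm
    · exact absurd rfl hne
  have nbr : ∀ x, (triangleReduce G p q r).Adj none (some x) ↔
      ∃ z, ¬ (z ≠ p ∧ z ≠ q ∧ z ≠ r) ∧ x.1 = out z := by
    intro x
    change (G.Adj p x.1 ∨ G.Adj q x.1 ∨ G.Adj r x.1) ↔ _
    rw [(hout p ip).2 _ x.2, (hout q iq).2 _ x.2, (hout r ir).2 _ x.2]
    constructor
    · rintro (h | h | h)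
      · exact ⟨p, ip, h⟩
      · exact ⟨q, iq, h⟩
      · exact ⟨r, ir, h⟩
    · rintro ⟨z, hz, hx⟩
      rcases mem_of_not_outside hz with rfl | rfl | rfl
      · exact .inl hx
      · exact .inr (.inl hx)
      · exact .inr (.inr hx)
  have hdeg : DegreeThree (triangleReduce G p q r) none := by
    have : (triangleReduce G p q r).neighborSet none =
        {some ⟨out p, (hout p ip).1⟩, some ⟨out q, (hout q iq).1⟩,
          some ⟨out r, (hout r ir).1⟩} := by
      ext y
      rcases y with _ | x
      · simp
      · rw [SimpleGraph.mem_neighborSet]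
        simp only [Set.mem_insert_iff, Set.mem_singleton_iff, Option.some.injEq, Subtype.ext_iff]
        change (G.Adj p x.1 ∨ G.Adj q x.1 ∨ G.Adj r x.1) ↔ _
        rw [(hout p ip).2 _ x.2, (hout q iq).2 _ x.2, (hout r ir).2 _ x.2]
    rw [DegreeThree, this, Set.ncard_eq_three]
    refine ⟨_, _, _, ?_, ?_, ?_, rfl⟩ <;>
      simp only [ne_eq, Option.some.injEq, Subtype.mk.injEq] <;> intro hh
    · exact npq (inj _ _ ip iq hh)
    · exact npr (inj _ _ ip ir hh)
    · exact nqr (inj _ _ iq ir hh)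
  have ht : M.Tri (ψ none) := tri_of_ncard (hdeg.map ψ)
  refine ⟨ψ none, ht, ?_⟩
  have dart : ∀ z, ∃ e : {d // M.tail d = ψ none}, (hz : ¬ (z ≠ p ∧ z ≠ q ∧ z ≠ r)) →
      M.tail (M.rev e.1) = ψ (some ⟨out z, (hout z hz).1⟩) := by
    intro z
    by_cases hz : ¬ (z ≠ p ∧ z ≠ q ∧ z ≠ r)
    · obtain ⟨d, h1, h2⟩ := ψ.map_adj_iff.2 ((nbr ⟨out z, (hout z hz).1⟩).2 ⟨z, hz, rfl⟩)
      exact ⟨⟨d, h1⟩, fun _ => h2⟩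
    · obtain ⟨d, hd⟩ := M.tail_surjective (ψ none)
      exact ⟨⟨d, hd⟩, fun h => absurd h hz⟩
  choose ed hed using dart
  classical
  let f : X → {v // v ≠ ψ none} ⊕ {d // M.tail d = ψ none} := fun x =>
    if hx : x ≠ p ∧ x ≠ q ∧ x ≠ r then .inl ⟨ψ (some ⟨x, hx⟩), fun h => by
      simpa using ψ.injective h⟩ else .inr (ed x)
  have fo : ∀ x (hx : x ≠ p ∧ x ≠ q ∧ x ≠ r), f x = .inl ⟨ψ (some ⟨x, hx⟩), fun h => by
      simpa using ψ.injective h⟩ := fun x hx => dif_pos hx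
  have fi : ∀ x, ¬ (x ≠ p ∧ x ≠ q ∧ x ≠ r) → f x = .inr (ed x) := fun x hx => dif_neg hx
  have edinj : ∀ z w, ¬ (z ≠ p ∧ z ≠ q ∧ z ≠ r) → ¬ (w ≠ p ∧ w ≠ q ∧ w ≠ r) → ed z = ed w →
      z = w := by
    intro z w hz hw hzw
    have h1 := hed z hz
    rw [hzw, hed w hw] at h1
    have h2 := ψ.injective h1
    rw [Option.some.injEq, Subtype.mk.injEq] at h2
    exact inj z w hz hw h2.symm
  have hf : Function.Bijective f := by
    constructor
    · intro x y hxy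
      by_cases hx : x ≠ p ∧ x ≠ q ∧ x ≠ r <;> by_cases hy : y ≠ p ∧ y ≠ q ∧ y ≠ r
      · rw [fo x hx, fo y hy, Sum.inl.injEq, Subtype.mk.injEq] at hxy
        simpa using ψ.injective hxy
      · rw [fo x hx, fi y hy] at hxy; cases hxy
      · rw [fi x hx, fo y hy] at hxy; cases hxy
      · rw [fi x hx, fi y hy, Sum.inr.injEq] at hxy
        exact edinj x y hx hy hxy
    · rintro (⟨v, hv⟩ | e)
      · obtain ⟨y, rfl⟩ := ψ.surjective v
        rcases y with _ | y
        · exact absurd rfl hv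
        · exact ⟨y.1, fo y.1 y.2⟩
      · have h1 : M.primal.Adj (ψ none) (M.tail (M.rev e.1)) := ⟨e.1, e.2, rfl⟩
        obtain ⟨y, hy⟩ := ψ.surjective (M.tail (M.rev e.1))
        rw [← hy, ψ.map_adj_iff] at h1
        rcases y with _ | y
        · exact absurd h1 (SimpleGraph.irrefl _)
        · obtain ⟨z, hz, hyz⟩ := (nbr y).1 h1
          refine ⟨z, (fi z hz).trans (congrArg Sum.inr (Subtype.ext ?_))⟩
          refine M.tail_injective ((ed z).2.trans e.2.symm) ?_
          rw [hed z hz, ← hy]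
          congr 2
          exact Subtype.ext hyz.symm
  refine ⟨⟨Equiv.ofBijective f hf, ?_⟩⟩
  have mixed : ∀ x y, ¬ (x ≠ p ∧ x ≠ q ∧ x ≠ r) → (y ≠ p ∧ y ≠ q ∧ y ≠ r) →
      ((M.trunc (ψ none) ht).primal.Adj (f x) (f y) ↔ G.Adj x y) := by
    intro x y hx hy
    rw [fi x hx, fo y hy, trunc_primal_mixed, hed x hx, (hout x hx).2 y hy, ψ.injective.eq_iff,
      Option.some.injEq, Subtype.mk.injEq]
  intro x y
  simp only [Equiv.ofBijective_apply]
  by_cases hx : x ≠ p ∧ x ≠ q ∧ x ≠ r <;> by_cases hy : y ≠ p ∧ y ≠ q ∧ y ≠ r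
  · rw [fo x hx, fo y hy, trunc_primal_old, ψ.map_adj_iff]
    exact Iff.rfl
  · rw [SimpleGraph.adj_comm, G.adj_comm]
    exact mixed y x hy hx
  · exact mixed x y hx hy
  · rw [fi x hx, fi y hy, trunc_primal_new, inner x y hx hy, not_iff_not]
    exact ⟨edinj x y hx hy, fun h => by rw [h]⟩

/-- The path reduction with the new vertex in the middle, between the ends of `d`, and with the apex
as `s` restores the edge of `d`. -/
theorem split_reducible {d : D} (hd : M.Splittable d) (h : Reducible M.primal) :
    Reducible (M.split d hd).primal := by
  refine .path _ (some (M.tail d)) none (some (M.tail (M.next d)))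
    (some (M.tail (M.next (M.next d))))
    { degree_p := ((split_tri_some hd).2 ⟨hd.tri_tail, hd.apex_ne_tail.symm⟩).degreeThree
      degree_q := (split_tri_none hd).degreeThree
      degree_r := ((split_tri_some hd).2 ⟨by rw [M.tail_next]; exact hd.tri_head,
        Splittable.apex_ne_head.symm⟩).degreeThree
      adj_pq := ((split_primal_none hd).2 (.inl rfl)).symm
      adj_qr := (split_primal_none hd).2 (.inr (.inl rfl))
      ne_pr := fun h => Splittable.head_ne_tail (Option.some.inj h).symm
      not_adj_pr := fun h => ((split_primal_some hd).1 h).2.1 ⟨rfl, rfl⟩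
      adj_ps := (split_primal_some hd).2 ⟨?_, fun h => Splittable.apex_ne_head h.2,
        fun h => Splittable.head_ne_tail h.1.symm⟩
      adj_qs := (split_primal_none hd).2 (.inr (.inr rfl))
      adj_rs := (split_primal_some hd).2 ⟨?_, fun h => Splittable.head_ne_tail h.1,
        fun h => hd.apex_ne_tail h.2⟩ } (h.map ?_)
  · have := M.primal_adj_rev (M.next (M.next d))
    rw [hd.tail_next_next_rev] at this
    exact this.symm
  · have := M.primal_adj_rev (M.next d)
    rwa [← M.tail_next] at this
  · have hpr : M.primal.Adj (M.tail d) (M.tail (M.next d)) := by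
      rw [M.tail_next]; exact M.primal_adj_rev d
    let f : V ≃ {x : Option V // x ≠ none} :=
      { toFun := fun v => ⟨some v, by simp⟩
        invFun := fun x => x.1.get (Option.isSome_iff_ne_none.2 x.2)
        left_inv := fun v => rfl
        right_inv := fun x => Subtype.ext (by simp) }
    refine ⟨⟨f, ?_⟩⟩
    intro v w
    rw [pathReduce_adj]
    change (M.split d hd).primal.Adj (some v) (some w) ∨
      (some v = some _ ∧ some w = some _ ∨ some v = some _ ∧ some w = some _) ∧
        some v ≠ some w ↔ _
    rw [split_primal_some]
    simp only [Option.some.injEq, ne_eq]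
    constructor
    · rintro (h | ⟨⟨rfl, rfl⟩ | ⟨rfl, rfl⟩, -⟩)
      · exact h.1
      · exact hpr
      · exact hpr.symm
    · intro h
      have := h.ne
      tauto

/-- The edge that closes the triangle has both ends on the face to the left of `x`, so it lies on
that face by `chord`. -/
theorem next_next_next_of_adj {x : D} (h : M.primal.Adj (M.tail x) (M.tail (M.rev (M.next x)))) :
    M.next (M.next (M.next x)) = x := by
  obtain ⟨z, h1, h2⟩ := h.symm
  rcases M.chord z (M.left x) ⟨M.next (M.next x), by rw [M.tail_next, h1],
    by rw [M.left_next, M.left_next]⟩ ⟨x, h2.symm, rfl⟩ with h3 | h3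
  · have e1 : M.next (M.next x) = z := M.corner _ _ (by rw [M.tail_next, h1])
      (by rw [M.left_next, M.left_next, h3])
    rw [e1]
    exact M.corner _ _ (by rw [M.tail_next, h2]) (by rw [M.left_next, h3])
  · have e1 : M.rev z = x := M.corner _ _ h2 h3
    have e2 : M.tail (M.rev (M.next x)) = M.tail (M.next x) := by
      rw [M.tail_next, ← e1, M.rev_rev, h1, e1]
    exact absurd e2 (M.tail_rev_ne _)

/-- At a vertex of degree three any two edges are consecutive in the rotation. So the triangle
occupies a corner of a face at `a`, and then it bounds this face. -/
theorem exists_splittable {a b c : V} (ha : M.Tri a) (hb : M.Tri b) (hab : M.primal.Adj a b)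
    (hac : M.primal.Adj a c) (hbc : M.primal.Adj b c) :
    ∃ d, M.Splittable d ∧ ((M.tail d = a ∧ M.tail (M.next d) = b) ∨
      (M.tail d = b ∧ M.tail (M.next d) = a)) ∧ M.tail (M.next (M.next d)) = c := by
  obtain ⟨x, rfl, rfl⟩ := hab
  obtain ⟨y, hy, rfl⟩ := hac
  rcases ha.cases hy with rfl | rfl | rfl
  · exact absurd hbc (SimpleGraph.irrefl _)
  · have h1 : M.next (M.rev x) = M.rot x := by rw [next, M.rev_rev]
    have h2 := next_next_next_of_adj (M := M) (x := M.rev x) (by rw [h1]; exact hbc)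
    refine ⟨M.rev x, ⟨h2, hb, by rwa [M.rev_rev]⟩, .inr ⟨rfl, by rw [h1, M.tail_rot]⟩, ?_⟩
    rw [M.tail_next, h1]
  · have h1 : M.next (M.rev (M.rot (M.rot x))) = x := by rw [next, M.rev_rev, ha x rfl]
    have h2 := next_next_next_of_adj (M := M) (x := M.rev (M.rot (M.rot x)))
      (by rw [h1]; exact hbc.symm)
    rw [h1] at h2
    refine ⟨x, ⟨?_, ha, hb⟩, .inl ⟨rfl, M.tail_next x⟩, ?_⟩
    · rw [h2, h1]
    · rw [h2]

/-- In the reduced graph `p`, `r`, `s` form a triangle in which `p` and `r` have degree three. It is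
therefore a face, and splitting it at the edge `pr` undoes the reduction. -/
theorem exists_split_iso {X : Type*} {G : SimpleGraph X} {p q r s : X}
    (h : PathReducible G p q r s) (ψ : pathReduce G p q r ≃g M.primal) :
    ∃ (d : D) (hd : M.Splittable d), Nonempty (G ≃g (M.split d hd).primal) := by
  have npq := h.adj_pq.ne
  have nqr := h.adj_qr.ne
  have nqs := h.adj_qs.ne
  have nps := h.adj_ps.ne
  have nrs := h.adj_rs.ne
  obtain ⟨s', hs1, hs2, hq⟩ := Set.exists_third h.degree_q (a := p) (b := r) h.adj_pq.symm h.adj_qr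
    h.ne_pr
  have hs' : s' = s := by
    rcases (hq s).1 h.adj_qs with h1 | h1 | h1
    · exact absurd h1.symm nps
    · exact absurd h1.symm nrs
    · exact h1.symm
  subst hs'
  simp only [SimpleGraph.mem_neighborSet] at hq
  -- The reduction takes the neighbour `q` away from `p` and `r` and gives each of them the other
  -- one instead.
  have deg : ∀ a b (ha : a ≠ q), a ≠ b → b ≠ q → ¬ G.Adj a b → G.Adj a q → DegreeThree G a →
      (∀ y : {x // x ≠ q}, (pathReduce G p q r).Adj ⟨a, ha⟩ y ↔ G.Adj a y.1 ∨ y.1 = b) →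
      DegreeThree (pathReduce G p q r) ⟨a, ha⟩ := by
    intro a b ha hab hb hnb haq hdeg hadj
    have him : Subtype.val '' (pathReduce G p q r).neighborSet ⟨a, ha⟩ =
        insert b (G.neighborSet a \ {q}) := by
      ext y
      simp only [Set.mem_image, SimpleGraph.mem_neighborSet, hadj, Set.mem_insert_iff,
        Set.mem_sdiff, Set.mem_singleton_iff]
      constructor
      · rintro ⟨⟨y, hy⟩, h1 | h1, rfl⟩
        · exact .inr ⟨h1, hy⟩
        · exact .inl h1
      · rintro (rfl | ⟨h1, h2⟩)
        · exact ⟨⟨y, hb⟩, .inr rfl, rfl⟩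
        · exact ⟨⟨y, h2⟩, .inl h1, rfl⟩
    have hfin : (G.neighborSet a).Finite := Set.finite_of_ncard_ne_zero (by rw [hdeg]; simp)
    rw [DegreeThree, ← Set.ncard_image_of_injective _ Subtype.val_injective, him,
      Set.ncard_insert_of_notMem (fun h => hnb h.1) (hfin.subset Set.sdiff_subset),
      Set.ncard_sdiff_singleton_of_mem (show q ∈ G.neighborSet a from haq), hdeg]
  have tp : M.Tri (ψ ⟨p, npq⟩) := by
    refine tri_of_ncard (DegreeThree.map ψ (deg p r npq h.ne_pr nqr.symm h.not_adj_pr h.adj_pq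
      h.degree_p ?_))
    intro y
    rw [pathReduce_adj]
    have := h.ne_pr
    constructor
    · rintro (h1 | ⟨⟨-, h1⟩ | ⟨h1, -⟩, -⟩)
      · exact .inl h1
      · exact .inr h1
      · exact absurd h1 this
    · rintro (h1 | h1)
      · exact .inl h1
      · exact .inr ⟨.inl ⟨rfl, h1⟩, by rw [h1]; exact this⟩
  have tr : M.Tri (ψ ⟨r, nqr.symm⟩) := by
    refine tri_of_ncard (DegreeThree.map ψ (deg r p nqr.symm h.ne_pr.symm npq
      (fun h' => h.not_adj_pr h'.symm) h.adj_qr.symm h.degree_r ?_))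
    intro y
    rw [pathReduce_adj]
    have := h.ne_pr
    constructor
    · rintro (h1 | ⟨⟨h1, -⟩ | ⟨-, h1⟩, -⟩)
      · exact .inl h1
      · exact absurd h1.symm this
      · exact .inr h1
    · rintro (h1 | h1)
      · exact .inl h1
      · exact .inr ⟨.inr ⟨rfl, h1⟩, by rw [h1]; exact this.symm⟩
  obtain ⟨d, hd, hpr, hs⟩ := exists_splittable (c := ψ ⟨s', nqs.symm⟩) tp tr
    (ψ.map_adj_iff.2 (pathReduce_adj.2 (.inr ⟨.inl ⟨rfl, rfl⟩, h.ne_pr⟩)))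
    (ψ.map_adj_iff.2 (pathReduce_adj.2 (.inl h.adj_ps)))
    (ψ.map_adj_iff.2 (pathReduce_adj.2 (.inl h.adj_rs)))
  refine ⟨d, hd, ?_⟩
  classical
  let f : X → Option V := fun x => if hx : x ≠ q then some (ψ ⟨x, hx⟩) else none
  have fq : f q = none := by simp [f]
  have fo : ∀ x (hx : x ≠ q), f x = some (ψ ⟨x, hx⟩) := fun x hx => dif_pos hx
  have hf : Function.Bijective f := by
    constructor
    · intro x y hxy
      by_cases hx : x = q <;> by_cases hy : y = q
      · rw [hx, hy]
      · rw [hx, fq, fo y hy] at hxy; cases hxy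
      · rw [hy, fq, fo x hx] at hxy; cases hxy
      · rw [fo x hx, fo y hy, Option.some.injEq] at hxy
        simpa using ψ.injective hxy
    · rintro (_ | v)
      · exact ⟨q, fq⟩
      · obtain ⟨y, rfl⟩ := ψ.surjective v
        exact ⟨y.1, fo y.1 y.2⟩
  have new : ∀ y (hy : y ≠ q), (M.split d hd).primal.Adj (f q) (f y) ↔ G.Adj q y := by
    intro y hy
    rw [fq, fo y hy, split_primal_none, hq, hs]
    rcases hpr with ⟨h1, h2⟩ | ⟨h1, h2⟩ <;> rw [h1, h2] <;>
      simp only [ψ.injective.eq_iff, Subtype.mk.injEq]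
    tauto
  refine ⟨⟨Equiv.ofBijective f hf, ?_⟩⟩
  intro x y
  simp only [Equiv.ofBijective_apply]
  by_cases hx : x = q <;> by_cases hy : y = q
  · rw [hx, hy]; exact iff_of_false (SimpleGraph.irrefl _) (SimpleGraph.irrefl _)
  · rw [hx]; exact new y hy
  · rw [hy, SimpleGraph.adj_comm, G.adj_comm]; exact new x hx
  · rw [fo x hx, fo y hy, split_primal_some, ψ.map_adj_iff, pathReduce_adj]
    have h1 := h.not_adj_pr
    have h2 : ¬ G.Adj r p := fun h' => h1 h'.symm
    rcases hpr with ⟨e1, e2⟩ | ⟨e1, e2⟩ <;> rw [e1, e2] <;>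
      simp only [ψ.injective.eq_iff, Subtype.mk.injEq]
    · constructor
      · tauto
      · intro h3
        refine ⟨.inl h3, ?_, ?_⟩
        · rintro ⟨rfl, rfl⟩; exact h1 h3
        · rintro ⟨rfl, rfl⟩; exact h2 h3
    · constructor
      · tauto
      · intro h3
        refine ⟨.inl h3, ?_, ?_⟩
        · rintro ⟨rfl, rfl⟩; exact h2 h3
        · rintro ⟨rfl, rfl⟩; exact h1 h3

end PolyMap
/-! ### Wheels -/

theorem wheel_adj_rim {m : ℕ} {i j : Fin (m + 3)} : (wheel (m + 3)).Adj (some i) (some j) ↔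
    i.val + 1 = j.val ∨ j.val + 1 = i.val ∨ (i.val = 0 ∧ j.val = m + 2) ∨
      (j.val = 0 ∧ i.val = m + 2) := by
  change (SimpleGraph.cycleGraph (m + 3)).Adj i j ↔ _
  rw [SimpleGraph.cycleGraph_adj']
  have hi := i.isLt
  have hj := j.isLt
  rcases lt_trichotomy i j with h | rfl | h
  · rw [Fin.sub_val_of_le h.le, Fin.coe_sub_iff_lt.2 h]
    rw [Fin.lt_def] at h
    omega
  · rw [Fin.sub_val_of_le le_rfl]
    omega
  · rw [Fin.sub_val_of_le h.le, Fin.coe_sub_iff_lt.2 h]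
    rw [Fin.lt_def] at h
    omega

theorem wheel_adj_rim_iff_sub {m : ℕ} {i j : Fin (m + 3)} :
    (wheel (m + 3)).Adj (some i) (some j) ↔ i - j = 1 ∨ j - i = 1 :=
  SimpleGraph.cycleGraph_adj

theorem wheel_adj_hub {n : ℕ} (i : Fin n) : (wheel n).Adj none (some i) := trivial

/-- The automorphism of a wheel induced by an automorphism of the rim. -/
def wheelIso {m : ℕ} (σ : Equiv.Perm (Fin (m + 3)))
    (h : ∀ i j, σ i - σ j = 1 ∨ σ j - σ i = 1 ↔ i - j = 1 ∨ j - i = 1) :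
    wheel (m + 3) ≃g wheel (m + 3) where
  toEquiv := Equiv.optionCongr σ
  map_rel_iff' := by
    rintro (_ | i) (_ | j)
    · exact Iff.rfl
    · exact Iff.rfl
    · exact Iff.rfl
    · exact wheel_adj_rim_iff_sub.trans ((h i j).trans wheel_adj_rim_iff_sub.symm)

theorem wheel_three_adj {a b : Option (Fin (0 + 3))} : (wheel (0 + 3)).Adj a b ↔ a ≠ b := by
  refine ⟨fun h => h.ne, fun h => ?_⟩
  rcases a with _ | i <;> rcases b with _ | j
  · exact absurd rfl h
  · trivial
  · trivial
  · rw [wheel_adj_rim]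
    have : i.val ≠ j.val := fun h' => h (congrArg some (Fin.ext h'))
    have hi := i.isLt
    have hj := j.isLt
    omega

theorem wheel_rim_clique {m : ℕ} {i j k : Fin (m + 3)}
    (h1 : (wheel (m + 3)).Adj (some i) (some j)) (h2 : (wheel (m + 3)).Adj (some i) (some k))
    (h3 : (wheel (m + 3)).Adj (some j) (some k)) : m = 0 := by
  rw [wheel_adj_rim] at h1 h2 h3
  have hi := i.isLt
  have hj := j.isLt
  have hk := k.isLt
  omega

/-! ### Wheels in normal position -/

section Normalize

variable {W : Type v} {G : SimpleGraph W}

theorem IsWheel.exists_iso (h : IsWheel G) : ∃ m, Nonempty (wheel (m + 3) ≃g G) := by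
  obtain ⟨n, hn, ⟨e⟩⟩ := h
  obtain ⟨m, rfl⟩ := Nat.exists_eq_add_of_le' hn
  exact ⟨m, ⟨e.symm⟩⟩

/-- Rotations and reflections of the rim carry any directed rim edge to any other. -/
theorem exists_iso_of_rim_adj {m : ℕ} (φ : wheel (m + 3) ≃g G) {i j : Fin (m + 3)}
    (h : (wheel (m + 3)).Adj (some i) (some j)) :
    ∃ φ' : wheel (m + 3) ≃g G,
      φ' none = φ none ∧ φ' (some 0) = φ (some i) ∧ φ' (some 1) = φ (some j) := by
  rcases wheel_adj_rim_iff_sub.1 h with h | h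
  · refine ⟨(wheelIso (Equiv.subLeft i) fun a b => ?_).trans φ, rfl, ?_, ?_⟩
    · simp only [Equiv.subLeft_apply, sub_sub_sub_cancel_left]
      exact or_comm
    · change φ (some (i - 0)) = _
      rw [sub_zero]
    · change φ (some (i - 1)) = _
      rw [← h, sub_sub_cancel]
  · refine ⟨(wheelIso (Equiv.addRight i) fun a b => ?_).trans φ, rfl, ?_, ?_⟩
    · simp only [Equiv.coe_addRight, add_sub_add_right_eq_sub]
    · change φ (some (0 + i)) = _
      rw [zero_add]
    · change φ (some (1 + i)) = _
      rw [← h, sub_add_cancel]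

theorem exists_iso_of_rim_adj' {m : ℕ} (φ : wheel (m + 3) ≃g G) {i j : Fin (m + 3)}
    (h : (wheel (m + 3)).Adj (some i) (some j)) :
    ∃ φ' : wheel (m + 3) ≃g G, φ' none = φ none ∧ φ' (some 0) = φ (some i) ∧
      φ' (some (Fin.last (m + 2))) = φ (some j) := by
  obtain ⟨φ', h1, h2, h3⟩ := exists_iso_of_rim_adj φ h
  refine ⟨(wheelIso (Equiv.neg _) fun a b => ?_).trans φ', h1, ?_, ?_⟩
  · simp only [Equiv.neg_apply, neg_sub_neg]
    exact or_comm
  · rw [← h2]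
    change φ' (some (-0)) = _
    rw [neg_zero]
  · rw [← h3]
    change φ' (some (-Fin.last (m + 2))) = _
    congr 2
    rw [neg_eq_iff_add_eq_zero]
    simp

/-- The smallest wheel is a tetrahedron, where any vertex may serve as hub. -/
theorem exists_iso_hub (φ : wheel (0 + 3) ≃g G) (a : W) :
    ∃ φ' : wheel (0 + 3) ≃g G, φ' none = a := by
  classical
  refine ⟨(⟨Equiv.swap none (φ.symm a), ?_⟩ : wheel (0 + 3) ≃g wheel (0 + 3)).trans φ, ?_⟩
  · intro a b
    rw [wheel_three_adj, wheel_three_adj, (Equiv.injective _).ne_iff]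
  · change φ (Equiv.swap none (φ.symm a) none) = a
    rw [Equiv.swap_apply_left, φ.apply_symm_apply]

/-- A triangle in a wheel consists of a possible hub and two neighbours on the rim. -/
theorem IsWheel.exists_iso_of_clique (h : IsWheel G) {a b c : W} (hab : G.Adj a b)
    (hac : G.Adj a c) (hbc : G.Adj b c) : ∃ (m : ℕ) (φ : wheel (m + 3) ≃g G),
      ({a, b, c} : Set W) = {φ none, φ (some 0), φ (some 1)} := by
  have key : ∀ {m} (φ : wheel (m + 3) ≃g G) {b c : W}, φ none ≠ b → φ none ≠ c → G.Adj b c →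
      ∃ (m : ℕ) (φ' : wheel (m + 3) ≃g G),
        ({φ none, b, c} : Set W) = {φ' none, φ' (some 0), φ' (some 1)} := by
    intro m φ b c hb hc hbc
    obtain ⟨i, rfl⟩ := φ.surjective b
    obtain ⟨j, rfl⟩ := φ.surjective c
    rcases i with _ | i
    · exact absurd rfl hb
    rcases j with _ | j
    · exact absurd rfl hc
    obtain ⟨φ', h1, h2, h3⟩ := exists_iso_of_rim_adj φ (φ.map_adj_iff.1 hbc)
    exact ⟨m, φ', by rw [h1, h2, h3]⟩
  obtain ⟨m, ⟨φ⟩⟩ := h.exists_iso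
  by_cases ha : φ none = a
  · subst ha
    exact key φ hab.ne hac.ne hbc
  by_cases hb : φ none = b
  · subst hb
    obtain ⟨m', φ', h'⟩ := key φ hab.ne' hbc.ne hac
    exact ⟨m', φ', by rw [← h', Set.insert_comm]⟩
  by_cases hc : φ none = c
  · subst hc
    obtain ⟨m', φ', h'⟩ := key φ hac.ne' hbc.ne' hab
    exact ⟨m', φ', by rw [← h', Set.pair_comm b, Set.insert_comm]⟩
  -- A triangle that avoids the hub lies on the rim, which then has length three.
  have hm : m = 0 := by
    obtain ⟨i, rfl⟩ := φ.surjective a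
    obtain ⟨j, rfl⟩ := φ.surjective b
    obtain ⟨k, rfl⟩ := φ.surjective c
    rcases i with _ | i
    · exact absurd rfl ha
    rcases j with _ | j
    · exact absurd rfl hb
    rcases k with _ | k
    · exact absurd rfl hc
    exact wheel_rim_clique (φ.map_adj_iff.1 hab) (φ.map_adj_iff.1 hac) (φ.map_adj_iff.1 hbc)
  subst hm
  obtain ⟨φ', rfl⟩ := exists_iso_hub φ a
  exact key φ' hab.ne hac.ne hbc

/-- A degree-three vertex `x` of a wheel with neighbours `a, b, c`, where `a` is adjacent to `b`
and `c`, is a rim vertex of the wheel with hub `a`. -/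
theorem IsWheel.exists_iso_of_degree (h : IsWheel G) {x a b c : W}
    (hx : ∀ y, G.Adj x y ↔ y = a ∨ y = b ∨ y = c) (hab : G.Adj a b) (hac : G.Adj a c) (hbc : b ≠ c) :
    ∃ (m : ℕ) (φ : wheel (m + 3) ≃g G),
      φ none = a ∧ φ (some 0) = b ∧ φ (some (Fin.last (m + 2))) = x := by
  have xa : G.Adj x a := (hx a).2 (.inl rfl)
  have xb : G.Adj x b := (hx b).2 (.inr (.inl rfl))
  have xc : G.Adj x c := (hx c).2 (.inr (.inr rfl))
  have key : ∀ {m} (φ : wheel (m + 3) ≃g G), φ none = a → ∃ (m : ℕ) (φ : wheel (m + 3) ≃g G),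
      φ none = a ∧ φ (some 0) = b ∧ φ (some (Fin.last (m + 2))) = x := by
    rintro m φ rfl
    obtain ⟨i, rfl⟩ := φ.surjective b
    obtain ⟨j, rfl⟩ := φ.surjective x
    rcases i with _ | i
    · exact absurd rfl hab.ne
    rcases j with _ | j
    · exact absurd rfl xa.ne
    obtain ⟨φ', h1, h2, h3⟩ := exists_iso_of_rim_adj' φ (φ.map_adj_iff.1 xb.symm)
    exact ⟨m, φ', h1, h2, h3⟩
  obtain ⟨m, ⟨φ⟩⟩ := h.exists_iso
  by_cases ha : φ none = a
  · exact key φ ha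
  have clique : ∀ {b}, φ none ≠ b → φ none ≠ x → G.Adj x b → G.Adj a b → m = 0 := by
    intro b hb hx' xb hab
    obtain ⟨i, rfl⟩ := φ.surjective a
    obtain ⟨j, rfl⟩ := φ.surjective b
    obtain ⟨k, rfl⟩ := φ.surjective x
    rcases i with _ | i
    · exact absurd rfl ha
    rcases j with _ | j
    · exact absurd rfl hb
    rcases k with _ | k
    · exact absurd rfl hx'
    exact wheel_rim_clique (φ.map_adj_iff.1 hab) (φ.map_adj_iff.1 xa.symm) (φ.map_adj_iff.1 xb.symm)
  -- If `x` is the hub, the rim has at most three vertices. Otherwise one of the triangles `x a b`,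
  -- `x a c` avoids the hub.
  have hm : m = 0 := by
    by_cases h1 : φ none = x
    · have hsub : (φ '' Set.range some : Set W) ⊆ {a, b, c} := by
        rintro _ ⟨_, ⟨i, rfl⟩, rfl⟩
        exact (hx _).1 (by rw [← h1, φ.map_adj_iff]; exact wheel_adj_hub i)
      have := Set.ncard_le_ncard hsub (Set.toFinite _)
      rw [Set.ncard_image_of_injective _ φ.injective, ← Set.image_univ,
        Set.ncard_image_of_injective _ (Option.some_injective _), Set.ncard_univ, Nat.card_fin] at this
      have h3 := (Set.ncard_insert_le a {b, c}).trans (Nat.succ_le_succ (Set.ncard_insert_le b {c}))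
      rw [Set.ncard_singleton] at h3
      omega
    by_cases h2 : φ none = b
    · exact clique (fun h3 => hbc (h2.symm.trans h3)) h1 xc hac
    · exact clique h2 h1 xb hab
  subst hm
  obtain ⟨φ', h'⟩ := exists_iso_hub φ a
  exact key φ' h'

end Normalize

theorem isWheel_induce {W : Type v} {H : SimpleGraph W} {S : Set W} {m : ℕ}
    (f : Option (Fin (m + 3)) → W) (hf : Function.Injective f) (hr : Set.range f = S)
    (hadj : ∀ a b, H.Adj (f a) (f b) ↔ (wheel (m + 3)).Adj a b) : IsWheel (H.induce S) := by
  subst hr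
  refine ⟨m + 3, by omega, ⟨SimpleGraph.Iso.symm ⟨Equiv.ofInjective f hf, ?_⟩⟩⟩
  intro a b
  exact hadj a b

/-- Subdividing a rim edge `xb` of a wheel with hub `a`, where `x` has degree three, and joining
the new vertex to the hub gives a wheel. -/
theorem IsWheel.grow {W : Type v} {H : SimpleGraph W} {H' : SimpleGraph (Option W)} {S : Set W}
    (h : IsWheel (H.induce S)) {x a b c : W} (xS : x ∈ S) (aS : a ∈ S) (bS : b ∈ S) (cS : c ∈ S)
    (hx : ∀ y ∈ S, H.Adj x y ↔ y = a ∨ y = b ∨ y = c) (hab : H.Adj a b) (hac : H.Adj a c)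
    (hbc : b ≠ c) (hnone : ∀ y ∈ S, H'.Adj none (some y) ↔ y = a ∨ y = b ∨ y = x)
    (hsome : ∀ y ∈ S, ∀ z ∈ S, H'.Adj (some y) (some z) ↔
      H.Adj y z ∧ ¬ (y = x ∧ z = b) ∧ ¬ (y = b ∧ z = x)) :
    IsWheel (H'.induce (insert none (some '' S))) := by
  obtain ⟨m, φ, rfl', h0, hl⟩ := IsWheel.exists_iso_of_degree (x := ⟨x, xS⟩) (a := ⟨a, aS⟩)
    (b := ⟨b, bS⟩) (c := ⟨c, cS⟩) h
    (fun y => by simp only [Subtype.ext_iff]; exact hx y.1 y.2) hab hac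
    (fun h => hbc (congrArg Subtype.val h))
  have ea : (φ none).1 = a := congrArg Subtype.val rfl'
  have eb : (φ (some 0)).1 = b := congrArg Subtype.val h0
  have ex : (φ (some (Fin.last (m + 2)))).1 = x := congrArg Subtype.val hl
  have einj : ∀ {u v}, (φ u).1 = (φ v).1 ↔ u = v := fun {u v} =>
    Subtype.val_injective.eq_iff.trans φ.injective.eq_iff
  have eadj : ∀ {u v}, H.Adj (φ u).1 (φ v).1 ↔ (wheel (m + 3)).Adj u v := φ.map_adj_iff
  -- On the old rim `b` has number `0` and `x` has number `m + 2`; the new vertex gets the number `m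
  -- + 3` between them.
  let f : Option (Fin (m + 1 + 3)) → Option W := fun u => u.elim (some (φ none).1) fun i =>
    if hi : i.val < m + 3 then some (φ (some ⟨i.val, hi⟩)).1 else none
  have f0 : f none = some (φ none).1 := rfl
  have f1 : ∀ i (hi : i.val < m + 3), f (some i) = some (φ (some ⟨i.val, hi⟩)).1 :=
    fun i hi => dif_pos hi
  have f2 : ∀ i, ¬ i.val < m + 3 → f (some i) = none := fun i hi => dif_neg hi
  have last : ∀ {i : Fin (m + 1 + 3)}, ¬ i.val < m + 3 → i.val = m + 3 := by
    intro i hi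
    have := i.isLt
    omega
  refine isWheel_induce (m := m + 1) f ?_ ?_ ?_
  · rintro (_ | i) (_ | j) hij
    · rfl
    · by_cases hj : j.val < m + 3
      · rw [f0, f1 j hj, Option.some.injEq, einj] at hij
        cases hij
      · rw [f0, f2 j hj] at hij
        cases hij
    · by_cases hj : i.val < m + 3
      · rw [f0, f1 i hj, Option.some.injEq, einj] at hij
        cases hij
      · rw [f0, f2 i hj] at hij
        cases hij
    · by_cases hi : i.val < m + 3 <;> by_cases hj : j.val < m + 3
      · rw [f1 i hi, f1 j hj, Option.some.injEq, einj, Option.some.injEq, Fin.mk.injEq] at hij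
        rw [Fin.ext hij]
      · rw [f1 i hi, f2 j hj] at hij
        cases hij
      · rw [f2 i hi, f1 j hj] at hij
        cases hij
      · rw [Fin.ext ((last hi).trans (last hj).symm)]
  · ext y
    constructor
    · rintro ⟨_ | i, rfl⟩
      · exact .inr ⟨_, (φ none).2, rfl⟩
      · by_cases hi : i.val < m + 3
        · rw [f1 i hi]
          exact .inr ⟨_, (φ _).2, rfl⟩
        · rw [f2 i hi]
          exact .inl rfl
    · rintro (rfl | ⟨y, hy, rfl⟩)
      · exact ⟨some (Fin.last _), f2 _ (by simp)⟩
      · obtain ⟨u, hu⟩ := φ.surjective ⟨y, hy⟩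
        rcases u with _ | i
        · exact ⟨none, by rw [f0, hu]⟩
        · refine ⟨some ⟨i.val, by have := i.isLt; omega⟩, ?_⟩
          rw [f1 _ i.isLt, Fin.eta, hu]
  · have mixed : ∀ i j : Fin (m + 1 + 3), ∀ hi : i.val < m + 3, ¬ j.val < m + 3 →
        (H'.Adj none (some (φ (some ⟨i.val, hi⟩)).1) ↔
          (wheel (m + 1 + 3)).Adj (some j) (some i)) := by
      intro i j hi hj
      have hj' := last hj
      rw [hnone _ (φ _).2, wheel_adj_rim, ← ea, ← eb, ← ex, einj, einj, einj]
      simp only [reduceCtorEq, false_or, Option.some.injEq, Fin.ext_iff, Fin.val_last, Fin.val_zero]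
      omega
    have hub : ∀ j, H'.Adj (some (φ none).1) (f (some j)) := by
      intro j
      by_cases hj : j.val < m + 3
      · rw [f1 j hj, hsome _ (φ _).2 _ (φ _).2, eadj, ← ex, ← eb, einj, einj, einj, einj]
        exact ⟨trivial, fun h => by simpa using h.1, fun h => by simpa using h.1⟩
      · rw [f2 j hj, SimpleGraph.adj_comm, hnone _ (φ _).2, ← ea]
        exact .inl rfl
    rintro (_ | i) (_ | j)
    · exact iff_of_false (SimpleGraph.irrefl _) (SimpleGraph.irrefl _)
    · exact iff_of_true (hub j) trivial
    · exact iff_of_true (hub i).symm trivial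
    · by_cases hi : i.val < m + 3 <;> by_cases hj : j.val < m + 3
      · rw [f1 i hi, f1 j hj, hsome _ (φ _).2 _ (φ _).2, eadj, ← ex, ← eb, einj, einj, einj, einj,
          wheel_adj_rim, wheel_adj_rim]
        simp only [Option.some.injEq, Fin.ext_iff, Fin.val_last, Fin.val_zero]
        omega
      · rw [f1 i hi, f2 j hj, SimpleGraph.adj_comm, mixed i j hi hj, SimpleGraph.adj_comm]
      · rw [f1 j hj, f2 i hi, mixed j i hj hi]
      · rw [f2 i hi, f2 j hj]
        refine iff_of_false (SimpleGraph.irrefl _) ?_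
        rw [Fin.ext ((last hi).trans (last hj).symm)]
        exact SimpleGraph.irrefl _

/-! ### Trees of wheels -/

/-- The tree obtained from `T` by attaching a new leaf `none` at `i₀`. -/
def leafTree {ι : Type u} (T : SimpleGraph ι) (i₀ : ι) : SimpleGraph (Option ι) where
  Adj
    | none, none => False
    | none, some i => i = i₀
    | some i, none => i = i₀
    | some i, some j => T.Adj i j
  symm := by
    constructor
    rintro (_ | i) (_ | j) h
    · exact h
    · exact h
    · exact h
    · exact T.adj_symm h
  loopless := by
    constructor
    rintro (_ | i) h
    · exact h
    · exact T.irrefl h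

def leafTreeHom {ι : Type u} (T : SimpleGraph ι) (i₀ : ι) : T →g leafTree T i₀ where
  toFun := some
  map_rel' := fun h => h

/-- The new graph is connected, and it has one more vertex and one more edge. -/
theorem leafTree_isTree {ι : Type u} [Finite ι] {T : SimpleGraph ι} (h : T.IsTree) (i₀ : ι) :
    (leafTree T i₀).IsTree := by
  have hcard := (SimpleGraph.isTree_iff_connected_and_card.1 h).2
  rw [SimpleGraph.isTree_iff_connected_and_card]
  constructor
  · have key : ∀ i, (leafTree T i₀).Reachable (some i₀) i := by
      rintro (_ | i)
      · exact SimpleGraph.Adj.reachable (show i₀ = i₀ from rfl)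
      · exact (h.1.preconnected i₀ i).map (leafTreeHom T i₀)
    exact { preconnected := fun i j => (key i).symm.trans (key j), nonempty := ⟨none⟩ }
  · have : (leafTree T i₀).edgeSet = insert s(none, some i₀) (Sym2.map some '' T.edgeSet) := by
      ext e
      induction e using Sym2.ind with
      | _ a b =>
        rw [SimpleGraph.mem_edgeSet, Set.mem_insert_iff]
        constructor
        · intro hab
          rcases a with _ | a <;> rcases b with _ | b
          · exact hab.elim
          · exact .inl (by rw [show b = i₀ from hab])
          · exact .inl (by rw [show a = i₀ from hab, Sym2.eq_swap])
          · exact .inr ⟨s(a, b), hab, rfl⟩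
        · rintro (h | ⟨e, he, hab⟩)
          · rcases Sym2.eq_iff.1 h with ⟨rfl, rfl⟩ | ⟨rfl, rfl⟩
            · exact (rfl : i₀ = i₀)
            · exact (rfl : i₀ = i₀)
          · induction e using Sym2.ind with
            | _ x y =>
              rw [Sym2.map_mk] at hab
              rcases Sym2.eq_iff.1 hab with ⟨rfl, rfl⟩ | ⟨rfl, rfl⟩
              · exact he
              · exact T.adj_symm he
    rw [Nat.card_coe_set_eq, this, Set.ncard_insert_of_notMem, Set.ncard_image_of_injective _
      (Sym2.map.injective (Option.some_injective _)), ← Nat.card_coe_set_eq, hcard,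
      Finite.card_option]
    rintro ⟨e, -, he⟩
    induction e using Sym2.ind with
    | _ x y =>
      rw [Sym2.map_mk] at he
      rcases Sym2.eq_iff.1 he with ⟨h, -⟩ | ⟨-, h⟩ <;> cases h

/-- A tree of wheels in `H`: induced wheels on the sets `S i` covering the graph, arranged in a
tree such that adjacent wheels share a triangle, all these triangles in one wheel are different,
and the wheels containing a given vertex are connected in the tree. -/
structure WheelTree {W : Type u} {ι : Type v} (H : SimpleGraph W) (T : SimpleGraph ι)
    (S : ι → Set W) : Prop where
  isTree : T.IsTree
  wheel : ∀ i, IsWheel (H.induce (S i))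
  mem : ∀ x, ∃ i, x ∈ S i
  cover : ∀ x y, H.Adj x y → ∃ i, x ∈ S i ∧ y ∈ S i
  chain : ∀ i j x, x ∈ S i → x ∈ S j → ∃ p : T.Walk i j, ∀ k ∈ p.support, x ∈ S k
  ncard : ∀ i j, T.Adj i j → (S i ∩ S j).ncard = 3
  clique : ∀ i j, T.Adj i j → ∀ x ∈ S i ∩ S j, ∀ y ∈ S i ∩ S j, x ≠ y → H.Adj x y
  once : ∀ i j k, T.Adj i j → T.Adj i k → S i ∩ S j = S i ∩ S k → j = k

theorem IsWheel.exists_three {W : Type v} {G : SimpleGraph W} (h : IsWheel G) (x : W) :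
    ∃ a b c, G.Adj x a ∧ G.Adj x b ∧ G.Adj x c ∧ a ≠ b ∧ a ≠ c ∧ b ≠ c := by
  obtain ⟨m, ⟨φ⟩⟩ := h.exists_iso
  obtain ⟨u, rfl⟩ := φ.surjective x
  have key : ∃ a b c, (wheel (m + 3)).Adj u a ∧ (wheel (m + 3)).Adj u b ∧
      (wheel (m + 3)).Adj u c ∧ a ≠ b ∧ a ≠ c ∧ b ≠ c := by
    rcases u with _ | i
    · refine ⟨some 0, some 1, some ⟨2, by omega⟩, trivial, trivial, trivial, ?_, ?_, ?_⟩ <;>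
        simp [Fin.ext_iff]
    · refine ⟨none, some (i + 1), some (i - 1), trivial,
        wheel_adj_rim_iff_sub.2 (.inr (by rw [add_sub_cancel_left])),
        wheel_adj_rim_iff_sub.2 (.inl (by rw [sub_sub_cancel])), by simp, by simp, ?_⟩
      intro h
      rw [Option.some.injEq, ← sub_eq_zero, add_sub_sub_cancel, Fin.ext_iff, Fin.val_add] at h
      have : 2 % (m + 3) = 2 := Nat.mod_eq_of_lt (by omega)
      exact absurd h (by simp [this])
  obtain ⟨a, b, c, h1, h2, h3, h4, h5, h6⟩ := key
  exact ⟨φ a, φ b, φ c, φ.map_adj_iff.2 h1, φ.map_adj_iff.2 h2, φ.map_adj_iff.2 h3,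
    φ.injective.ne h4, φ.injective.ne h5, φ.injective.ne h6⟩

namespace WheelTree

variable {W : Type u} {ι : Type v} {H : SimpleGraph W} {T : SimpleGraph ι} {S : ι → Set W}

/-- The walk given by `chain` shortens, within its support, to the only path from `i` to `j`. -/
theorem mem_of_isPath (h : WheelTree H T S) {i j k : ι} {x : W} (hi : x ∈ S i) (hj : x ∈ S j)
    {p : T.Walk i j} (hp : p.IsPath) (hk : k ∈ p.support) : x ∈ S k := by
  classical
  obtain ⟨q, hq⟩ := h.chain i j x hi hj
  have : p = q.bypass := congrArg Subtype.val
    ((h.isTree.isAcyclic.subsingleton_path i j).elim ⟨p, hp⟩ q.toPath)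
  rw [this] at hk
  exact hq k (q.support_bypass_subset_support hk)

/-- A vertex of degree three lies in only one wheel. -/
theorem eq_of_degreeThree (h : WheelTree H T S) {x : W} (hx : DegreeThree H x) {i j : ι}
    (hi : x ∈ S i) (hj : x ∈ S j) : i = j := by
  -- A wheel through `x` contains at least three neighbours of `x`, hence all of them. So two
  -- adjacent wheels through `x` would share four vertices.
  have sub : ∀ k, x ∈ S k → insert x (H.neighborSet x) ⊆ S k := by
    intro k hk
    obtain ⟨a, b, c, ha, hb, hc, hab, hac, hbc⟩ := (h.wheel k).exists_three ⟨x, hk⟩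
    have h3 : ({a.1, b.1, c.1} : Set W).ncard = 3 := Set.ncard_eq_three.2
      ⟨_, _, _, Subtype.val_injective.ne hab, Subtype.val_injective.ne hac,
        Subtype.val_injective.ne hbc, rfl⟩
    have : ({a.1, b.1, c.1} : Set W) = H.neighborSet x := by
      refine Set.eq_of_subset_of_ncard_le ?_ (by rw [h3]; exact hx.le)
        (Set.finite_of_ncard_ne_zero (by rw [hx]; simp))
      rintro _ (rfl | rfl | rfl)
      · exact ha
      · exact hb
      · exact hc
    rw [← this]
    rintro _ (rfl | rfl | rfl | rfl)
    exacts [hk, a.2, b.2, c.2]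
  have h4 : (insert x (H.neighborSet x)).ncard = 4 := by
    rw [Set.ncard_insert_of_notMem (by simp) (Set.finite_of_ncard_ne_zero (by rw [hx]; simp)), hx]
  by_contra hne
  obtain ⟨p, hp⟩ := h.chain i j x hi hj
  cases p with
  | nil => exact hne rfl
  | @cons _ l _ hil q =>
    have hl : x ∈ S l := hp l (by simp)
    have h3 := h.ncard i l hil
    have := Set.ncard_le_ncard (Set.subset_inter (sub i hi) (sub l hl))
      (Set.finite_of_ncard_ne_zero (by omega))
    omega

/-- Attaching a tetrahedron at an unused triangle. -/
theorem attach [Finite ι] (h : WheelTree H T S) {H' : SimpleGraph (Option W)} {N : Set W}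
    (hN : N.ncard = 3) (hclique : ∀ x ∈ N, ∀ y ∈ N, x ≠ y → H.Adj x y)
    (hnone : ∀ y, H'.Adj none (some y) ↔ y ∈ N)
    (hsome : ∀ y z, H'.Adj (some y) (some z) ↔ H.Adj y z) {i₀ : ι} (hi₀ : N ⊆ S i₀)
    (hunused : ∀ j, T.Adj i₀ j → N ≠ S i₀ ∩ S j) :
    WheelTree H' (leafTree T i₀)
      (fun i => i.elim (insert none (some '' N)) fun i => some '' S i) where
  isTree := leafTree_isTree h.isTree i₀
  wheel := by
    rintro (_ | i)
    · obtain ⟨a, b, c, hab, hac, hbc, rfl⟩ := Set.ncard_eq_three.1 hN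
      let g : Fin (0 + 3) → W := ![a, b, c]
      have gN : ∀ i, g i ∈ ({a, b, c} : Set W) := by
        intro i; fin_cases i <;> simp [g]
      have ginj : Function.Injective g := by
        intro i j hij
        fin_cases i <;> fin_cases j <;> simp_all [g]
      refine isWheel_induce (m := 0) (fun u => u.map g) (Option.map_injective ginj) ?_ ?_
      · ext y
        constructor
        · rintro ⟨_ | i, rfl⟩
          · exact .inl rfl
          · exact .inr ⟨g i, gN i, rfl⟩
        · rintro (rfl | ⟨y, rfl | rfl | rfl, rfl⟩)
          exacts [⟨none, rfl⟩, ⟨some 0, rfl⟩, ⟨some 1, rfl⟩, ⟨some 2, rfl⟩]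
      · intro u v
        rw [wheel_three_adj]
        refine ⟨fun h' e => H'.irrefl (e ▸ h'), fun h' => ?_⟩
        rcases u with _ | i <;> rcases v with _ | j
        · exact absurd rfl h'
        · exact (hnone _).2 (gN j)
        · exact ((hnone _).2 (gN i)).symm
        · exact (hsome _ _).2 (hclique _ (gN i) _ (gN j) fun e => h' (by rw [ginj e]))
    · obtain ⟨m, ⟨φ⟩⟩ := (h.wheel i).exists_iso
      refine isWheel_induce (fun u => some (φ u).1) ((Option.some_injective _).comp
        (Subtype.val_injective.comp φ.injective)) ?_ fun a b => ?_
      · ext y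
        constructor
        · rintro ⟨u, rfl⟩
          exact ⟨_, (φ u).2, rfl⟩
        · rintro ⟨y, hy, rfl⟩
          obtain ⟨u, hu⟩ := φ.surjective ⟨y, hy⟩
          exact ⟨u, congrArg (fun z => some z.1) hu⟩
      · rw [hsome]
        exact φ.map_adj_iff
  mem := by
    rintro (_ | x)
    · exact ⟨none, .inl rfl⟩
    · obtain ⟨i, hi⟩ := h.mem x
      exact ⟨some i, x, hi, rfl⟩
  cover := by
    rintro (_ | x) (_ | y) hxy
    · exact absurd hxy (H'.irrefl)
    · exact ⟨none, .inl rfl, .inr ⟨y, (hnone y).1 hxy, rfl⟩⟩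
    · exact ⟨none, .inr ⟨x, (hnone x).1 hxy.symm, rfl⟩, .inl rfl⟩
    · obtain ⟨i, hx, hy⟩ := h.cover x y ((hsome x y).1 hxy)
      exact ⟨some i, ⟨x, hx, rfl⟩, ⟨y, hy, rfl⟩⟩
  chain := by
    have old : ∀ i j x, x ∈ S i → x ∈ S j → ∃ p : (leafTree T i₀).Walk (some i) (some j),
        ∀ k ∈ p.support, some x ∈ (Option.elim k (insert none (some '' N)) fun i => some '' S i :
          Set (Option W)) := by
      intro i j x hi hj
      obtain ⟨p, hp⟩ := h.chain i j x hi hj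
      refine ⟨p.map (leafTreeHom T i₀), fun k hk => ?_⟩
      obtain ⟨l, hl, rfl⟩ := List.mem_map.1 ((congrArg (k ∈ ·)
        (SimpleGraph.Walk.support_map (leafTreeHom T i₀) p)).mp hk)
      exact ⟨x, hp l hl, rfl⟩
    have adj : (leafTree T i₀).Adj none (some i₀) := (rfl : i₀ = i₀)
    rintro (_ | i) (_ | j) x hi hj
    · refine ⟨.nil, fun k hk => ?_⟩
      rw [SimpleGraph.Walk.support_nil, List.mem_singleton] at hk
      rwa [hk]
    · obtain ⟨x, hx, rfl⟩ := hj
      have hxN : x ∈ N := by simpa using hi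
      obtain ⟨p, hp⟩ := old i₀ j x (hi₀ hxN) hx
      refine ⟨.cons adj p, fun k hk => ?_⟩
      rw [SimpleGraph.Walk.support_cons, List.mem_cons] at hk
      rcases hk with rfl | hk
      · exact hi
      · exact hp k hk
    · obtain ⟨x, hx, rfl⟩ := hi
      have hxN : x ∈ N := by simpa using hj
      obtain ⟨p, hp⟩ := old i₀ i x (hi₀ hxN) hx
      refine ⟨(SimpleGraph.Walk.cons adj p).reverse, fun k hk => ?_⟩
      rw [SimpleGraph.Walk.support_reverse, List.mem_reverse, SimpleGraph.Walk.support_cons,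
        List.mem_cons] at hk
      rcases hk with rfl | hk
      · exact hj
      · exact hp k hk
    · obtain ⟨x, hx, rfl⟩ := hi
      exact old i j x hx (by simpa using hj)
  ncard := by
    have key : (insert none (some '' N) ∩ some '' S i₀ : Set (Option W)).ncard = 3 := by
      rw [Set.insert_inter_of_notMem (by simp), ← Set.image_inter (Option.some_injective _),
        Set.inter_eq_left.2 hi₀, Set.ncard_image_of_injective _ (Option.some_injective _), hN]
    rintro (_ | i) (_ | j) hij
    · exact hij.elim
    · obtain rfl : j = i₀ := hij
      exact key
    · obtain rfl : i = i₀ := hij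
      rw [Set.inter_comm]
      exact key
    · change (some '' S i ∩ some '' S j : Set (Option W)).ncard = 3
      rw [← Set.image_inter (Option.some_injective _),
        Set.ncard_image_of_injective _ (Option.some_injective _)]
      exact h.ncard i j hij
  clique := by
    have key : ∀ x ∈ (insert none (some '' N) ∩ some '' S i₀ : Set (Option W)),
        ∀ y ∈ (insert none (some '' N) ∩ some '' S i₀ : Set (Option W)), x ≠ y → H'.Adj x y := by
      rintro _ ⟨hx, x, -, rfl⟩ _ ⟨hy, y, -, rfl⟩ hxy
      exact (hsome x y).2 (hclique x (by simpa using hx) y (by simpa using hy)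
        fun h => hxy (by rw [h]))
    rintro (_ | i) (_ | j) hij
    · exact hij.elim
    · obtain rfl : j = i₀ := hij
      exact key
    · obtain rfl : i = i₀ := hij
      intro x hx y hy
      exact key x hx.symm y hy.symm
    · rintro _ ⟨⟨x, hx, rfl⟩, hx'⟩ _ ⟨⟨y, hy, rfl⟩, hy'⟩ hxy
      exact (hsome x y).2 (h.clique i j hij x ⟨hx, by simpa using hx'⟩ y ⟨hy, by simpa using hy'⟩
        fun h => hxy (by rw [h]))
  once := by
    have key : ∀ j, T.Adj i₀ j →
        (some '' S i₀ ∩ insert none (some '' N) : Set (Option W)) ≠ some '' S i₀ ∩ some '' S j := by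
      intro j hj he
      rw [Set.inter_comm, Set.insert_inter_of_notMem (by simp),
        ← Set.image_inter (Option.some_injective _), ← Set.image_inter (Option.some_injective _),
        Set.inter_eq_left.2 hi₀] at he
      exact hunused j hj ((Option.some_injective W).image_injective he)
    rintro (_ | i) (_ | j) (_ | k) hj hk he
    · rfl
    · exact hj.elim
    · exact hk.elim
    · rw [show j = i₀ from hj, show k = i₀ from hk]
    · rfl
    · obtain rfl : i = i₀ := hj
      exact absurd he (key k hk)
    · obtain rfl : i = i₀ := hk
      exact absurd he.symm (key j hj)
    · change (some '' S i ∩ some '' S j : Set (Option W)) = some '' S i ∩ some '' S k at he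
      rw [← Set.image_inter (Option.some_injective _),
        ← Set.image_inter (Option.some_injective _)] at he
      rw [h.once i j k hj hk ((Option.some_injective W).image_injective he)]

/-- Growing the wheel that contains the degree-three vertex `x`. -/
theorem grow (h : WheelTree H T S) {H' : SimpleGraph (Option W)} {x a b c : W} {i₀ : ι}
    (hi₀ : x ∈ S i₀) (hx : ∀ y, H.Adj x y ↔ y = a ∨ y = b ∨ y = c) (hab : H.Adj a b)
    (hac : H.Adj a c) (hbc : b ≠ c) (hnone : ∀ y, H'.Adj none (some y) ↔ y = a ∨ y = b ∨ y = x)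
    (hsome : ∀ y z, H'.Adj (some y) (some z) ↔
      H.Adj y z ∧ ¬ (y = x ∧ z = b) ∧ ¬ (y = b ∧ z = x)) :
    WheelTree H' T (fun i => some '' S i ∪ {z | z = none ∧ i = i₀}) := by
  have hdeg : DegreeThree H x := by
    rw [DegreeThree, Set.ncard_eq_three]
    refine ⟨a, b, c, hab.ne, hac.ne, hbc, ?_⟩
    ext y
    exact hx y
  -- Only the wheel `i₀` sees the change of the edge from `x` to `b`.
  have uniq : ∀ i, x ∈ S i → i = i₀ := fun i hi => h.eq_of_degreeThree hdeg hi hi₀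
  have nbr : ∀ y, H.Adj x y → y ∈ S i₀ := by
    intro y hy
    obtain ⟨i, h1, h2⟩ := h.cover x y hy
    rwa [uniq i h1] at h2
  have other : ∀ i, i ≠ i₀ → (some '' S i ∪ {z | z = none ∧ i = i₀} : Set (Option W)) =
      some '' S i := by
    intro i hi
    ext z
    simp [hi]
  have inter : ∀ i j, i ≠ j → ((some '' S i ∪ {z | z = none ∧ i = i₀}) ∩
      (some '' S j ∪ {z | z = none ∧ j = i₀}) : Set (Option W)) = some '' (S i ∩ S j) := by
    intro i j hij
    ext z
    rcases z with _ | z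
    · simp only [Set.mem_inter_iff, Set.mem_union, Set.mem_image, reduceCtorEq, and_false,
        exists_false, Set.mem_ofPred_eq, true_and, false_or, iff_false]
      rintro ⟨rfl, rfl⟩
      exact hij rfl
    · simp
  refine ⟨h.isTree, fun i => ?_, ?_, ?_, ?_, ?_, ?_, ?_⟩
  · by_cases hi : i = i₀
    · subst hi
      have : (some '' S i ∪ {z | z = none ∧ i = i} : Set (Option W)) = insert none (some '' S i) := by
        ext z
        simp
      rw [this]
      exact (h.wheel i).grow hi₀ (nbr a ((hx a).2 (.inl rfl))) (nbr b ((hx b).2 (.inr (.inl rfl))))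
        (nbr c ((hx c).2 (.inr (.inr rfl)))) (fun y _ => hx y) hab hac hbc (fun y _ => hnone y)
        (fun y _ z _ => hsome y z)
    · rw [other i hi]
      obtain ⟨m, ⟨φ⟩⟩ := (h.wheel i).exists_iso
      refine isWheel_induce (fun u => some (φ u).1) ((Option.some_injective _).comp
        (Subtype.val_injective.comp φ.injective)) ?_ fun u v => ?_
      · ext y
        constructor
        · rintro ⟨u, rfl⟩
          exact ⟨_, (φ u).2, rfl⟩
        · rintro ⟨y, hy, rfl⟩
          obtain ⟨u, hu⟩ := φ.surjective ⟨y, hy⟩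
          exact ⟨u, congrArg (fun z => some z.1) hu⟩
      · have hne : ∀ u, (φ u).1 ≠ x := fun u hu => hi (uniq i (hu ▸ (φ u).2))
        rw [hsome, ← φ.map_adj_iff]
        exact ⟨fun h => h.1, fun h => ⟨h, fun h => hne _ h.1, fun h => hne _ h.2⟩⟩
  · rintro (_ | y)
    · exact ⟨i₀, .inr ⟨rfl, rfl⟩⟩
    · obtain ⟨i, hi⟩ := h.mem y
      exact ⟨i, .inl ⟨y, hi, rfl⟩⟩
  · have key : ∀ y, H'.Adj none (some y) → y ∈ S i₀ := by
      intro y hy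
      rcases (hnone y).1 hy with rfl | rfl | rfl
      · exact nbr _ ((hx _).2 (.inl rfl))
      · exact nbr _ ((hx _).2 (.inr (.inl rfl)))
      · exact hi₀
    rintro (_ | y) (_ | z) hyz
    · exact absurd hyz H'.irrefl
    · exact ⟨i₀, .inr ⟨rfl, rfl⟩, .inl ⟨z, key z hyz, rfl⟩⟩
    · exact ⟨i₀, .inl ⟨y, key y hyz.symm, rfl⟩, .inr ⟨rfl, rfl⟩⟩
    · obtain ⟨i, hy, hz⟩ := h.cover y z ((hsome y z).1 hyz).1
      exact ⟨i, .inl ⟨y, hy, rfl⟩, .inl ⟨z, hz, rfl⟩⟩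
  · rintro i j (_ | y) hi hj
    · obtain rfl : i = i₀ := by simpa using hi
      obtain rfl : j = i := by simpa using hj
      refine ⟨.nil, fun k hk => ?_⟩
      rw [SimpleGraph.Walk.support_nil, List.mem_singleton] at hk
      rwa [hk]
    · obtain ⟨p, hp⟩ := h.chain i j y (by simpa using hi) (by simpa using hj)
      exact ⟨p, fun k hk => .inl ⟨y, hp k hk, rfl⟩⟩
  · intro i j hij
    rw [inter i j hij.ne, Set.ncard_image_of_injective _ (Option.some_injective _)]
    exact h.ncard i j hij
  · intro i j hij
    rw [inter i j hij.ne]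
    have hne : ∀ y ∈ S i ∩ S j, y ≠ x := by
      rintro y hy rfl
      exact hij.ne ((uniq i hy.1).trans (uniq j hy.2).symm)
    rintro _ ⟨y, hy, rfl⟩ _ ⟨z, hz, rfl⟩ hyz
    exact (hsome y z).2 ⟨h.clique i j hij y hy z hz fun h => hyz (by rw [h]),
      fun h => hne y hy h.1, fun h => hne z hz h.2⟩
  · intro i j k hij hik he
    rw [inter i j hij.ne, inter i k hik.ne] at he
    exact h.once i j k hij hik ((Option.some_injective W).image_injective he)

end WheelTree

/-! ### Duals of truncated and split maps are trees of wheels -/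

namespace PolyMap

variable {D V F : Type} {M : PolyMap D V F}

theorem dual_adj_of_inc {v : V} (hv : M.Tri v) {f g : F} (hf : M.Inc v f) (hg : M.Inc v g)
    (hne : f ≠ g) : M.dual.Adj f g := by
  obtain ⟨d, rfl, rfl⟩ := hf
  have h1 : M.dual.Adj (M.left d) (M.left (M.rot d)) := by
    rw [M.left_rot]; exact M.dual_adj_rev d
  have h2 : M.dual.Adj (M.left (M.rot (M.rot d))) (M.left d) := by
    have := M.left_rot (M.rot (M.rot d))
    rw [hv d rfl] at this
    rw [this]
    exact M.dual_adj_rev _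
  rcases hv.inc_iff.1 hg with rfl | rfl | rfl
  · exact absurd rfl hne
  · exact h1
  · exact h2.symm

theorem Tri.ncard_inc {v : V} (hv : M.Tri v) : {f | M.Inc v f}.ncard = 3 := by
  obtain ⟨d, rfl⟩ := M.tail_surjective v
  rw [Set.ncard_eq_three]
  refine ⟨M.left d, M.left (M.rot d), M.left (M.rot (M.rot d)), ?_, ?_, ?_, ?_⟩
  · exact fun h => M.rot_ne d (M.corner _ _ (M.tail_rot d) h.symm)
  · exact fun h => M.rot_rot_ne d (M.corner _ _ (by simp only [M.tail_rot]) h.symm)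
  · exact fun h => M.rot_ne _ (M.corner _ _ (M.tail_rot _) h.symm)
  · ext f
    exact hv.inc_iff

theorem Tri.inc_head_iff {d : D} (h : M.Tri (M.tail (M.rev d))) {f : F} :
    M.Inc (M.tail (M.rev d)) f ↔
      f = M.left d ∨ f = M.left (M.rev d) ∨ f = M.left (M.rev (M.next d)) := by
  rw [h.inc_iff, M.left_rot, M.left_rot, M.rev_rev]
  exact or_left_comm

theorem Tri.inc_tail_iff {p : D} (h : M.Tri (M.tail (M.next p))) {f : F} :
    M.Inc (M.tail (M.next p)) f ↔
      f = M.left p ∨ f = M.left (M.rev p) ∨ f = M.left (M.rev (M.next p)) := by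
  rw [M.tail_next] at h ⊢
  exact h.inc_head_iff

theorem Splittable.dual_left {d : D} (h : M.Splittable d) {y : F} :
    M.dual.Adj (M.left d) y ↔ y = M.left (M.rev d) ∨ y = M.left (M.rev (M.next d)) ∨
      y = M.left (M.rev (M.next (M.next d))) := by
  constructor
  · rintro ⟨e, he, rfl⟩
    rcases face_cases h.triangle he with rfl | rfl | rfl <;> simp
  · rintro (rfl | rfl | rfl)
    · exact M.dual_adj_rev d
    · exact ⟨_, M.left_next d, rfl⟩
    · exact ⟨_, left_next_next d, rfl⟩

theorem Splittable.inc_tail {d : D} (h : M.Splittable d) {f : F} : M.Inc (M.tail d) f ↔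
    f = M.left d ∨ f = M.left (M.rev d) ∨ f = M.left (M.rev (M.next (M.next d))) := by
  have h1 : M.Tri (M.tail (M.next (M.next (M.next d)))) := by
    rw [h.triangle]
    exact h.tri_tail
  have := h1.inc_tail_iff (f := f)
  rw [h.triangle, left_next_next] at this
  rw [this, or_comm (a := f = M.left (M.rev d))]

/-- The invariant of the construction: the dual graph is a tree of wheels, and the triangle of
faces around each vertex of degree three is not shared by two wheels. -/
def IsWheelTree (M : PolyMap D V F) : Prop :=
  ∃ (ι : Type) (_ : Finite ι) (T : SimpleGraph ι) (S : ι → Set F), WheelTree M.dual T S ∧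
    ∀ v, M.Tri v → ∃ i, {f | M.Inc v f} ⊆ S i ∧ ∀ j, T.Adj i j → {f | M.Inc v f} ≠ S i ∩ S j

theorem tetrahedron_isWheelTree : tetrahedron.IsWheelTree := by
  refine ⟨Unit, inferInstance, ⊥, fun _ => Set.univ,
    ⟨.of_subsingleton, fun _ => ?_, fun _ => ⟨(), trivial⟩, fun _ _ _ => ⟨(), trivial, trivial⟩,
      fun _ _ _ _ _ => ⟨.nil, fun _ _ => trivial⟩, fun _ _ h => h.elim, fun _ _ h => h.elim,
      fun _ _ _ _ _ _ => rfl⟩, fun _ _ => ⟨(), Set.subset_univ _, fun _ h => h.elim⟩⟩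
  refine isWheel_induce (m := 0) (finSuccEquiv 3).symm (Equiv.injective _)
    (Set.range_eq_univ.2 (Equiv.surjective _)) fun a b => ?_
  rw [wheel_three_adj, tetrahedron_dual, SimpleGraph.top_adj, (Equiv.injective _).ne_iff]

/-- A tetrahedron is attached along the triangle of faces around `t`, which is unused by the
invariant. The triangles of the other vertices of degree three are different from it by
`Tri.eq_of_inc`, and those of the new vertices contain the new face, so none of them becomes shared.
-/
theorem IsWheelTree.trunc {t : V} (ht : M.Tri t) (h : M.IsWheelTree) :
    (M.trunc t ht).IsWheelTree := by
  obtain ⟨ι, hι, T, S, hS, htri⟩ := h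
  obtain ⟨i₀, hi₀, hu⟩ := htri t ht
  refine ⟨Option ι, inferInstance, leafTree T i₀, _, hS.attach (N := {f | M.Inc t f}) ht.ncard_inc
    (fun x hx y hy => dual_adj_of_inc ht hx hy) (fun y => trunc_dual_none ht)
    (fun y z => trunc_dual_some ht) hi₀ hu, ?_⟩
  rintro (v | e) hv
  · have hv' : M.Tri v.1 := (trunc_tri_old ht).1 hv
    obtain ⟨i, hi, hj⟩ := htri v.1 hv'
    have him : {f | (M.trunc t ht).Inc (.inl v) f} = some '' {f | M.Inc v.1 f} := by
      ext f
      rw [Set.mem_ofPred_eq, trunc_inc_some]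
      constructor
      · rintro ⟨g, rfl, hg⟩; exact ⟨g, hg, rfl⟩
      · rintro ⟨g, hg, rfl⟩; exact ⟨g, rfl, hg⟩
    refine ⟨some i, by rw [him]; exact Set.image_mono hi, ?_⟩
    rintro (_ | j) hij he
    · obtain rfl : i = i₀ := hij
      rw [him] at he
      change _ = some '' S i ∩ insert none (some '' {f | M.Inc t f}) at he
      rw [Set.inter_comm, Set.insert_inter_of_notMem (by simp),
        ← Set.image_inter (Option.some_injective _), Set.inter_eq_left.2 hi₀] at he
      exact v.2 (hv'.eq_of_inc ht (Set.ext_iff.1 ((Option.some_injective F).image_injective he)))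
    · rw [him] at he
      change _ = some '' S i ∩ some '' S j at he
      rw [← Set.image_inter (Option.some_injective _)] at he
      exact hj j hij ((Option.some_injective F).image_injective he)
  · refine ⟨none, ?_, ?_⟩
    · intro f hf
      rcases (trunc_inc_new ht).1 hf with rfl | rfl | rfl
      · exact .inl rfl
      · exact .inr ⟨_, ⟨e.1, e.2, rfl⟩, rfl⟩
      · exact .inr ⟨_, ⟨M.rot e.1, (M.tail_rot _).trans e.2, rfl⟩, rfl⟩
    · rintro (_ | j) hij he
      · exact hij.elim
      · have : none ∈ {f | (M.trunc t ht).Inc (.inr e) f} := (trunc_inc_new ht).2 (.inl rfl)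
        rw [he] at this
        obtain ⟨-, y, -, hy⟩ := this
        cases hy

/-- The triangle `left d` is a vertex of degree three of the dual, so it lies in only one wheel,
where it is a rim vertex for the hub `left (rev d)`. The split subdivides the rim edge towards the
face across `next d`. Triangles that contain the new face lie in one wheel only, and the others are
as before. -/
theorem IsWheelTree.split {d : D} (hd : M.Splittable d) (h : M.IsWheelTree) :
    (M.split d hd).IsWheelTree := by
  obtain ⟨ι, hι, T, S, hS, htri⟩ := h
  obtain ⟨i₀, hi₀, -⟩ := htri _ hd.tri_tail
  have xi₀ : M.left d ∈ S i₀ := hi₀ (M.inc_left d)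
  have tri_head : M.Tri (M.tail (M.next d)) := by rw [M.tail_next]; exact hd.tri_head
  have inc_head : ∀ f, M.Inc (M.tail (M.next d)) f ↔
      f = M.left d ∨ f = M.left (M.rev d) ∨ f = M.left (M.rev (M.next d)) :=
    fun f => tri_head.inc_tail_iff
  have nab : M.left (M.rev d) ≠ M.left (M.rev (M.next d)) := fun h =>
    next_ne d (M.left_injective _ _ (M.left_next d) h.symm)
  have nac : M.left (M.rev d) ≠ M.left (M.rev (M.next (M.next d))) := fun h =>
    next_ne (M.next (M.next d)) (by
      rw [hd.triangle]; exact M.left_injective _ _ (left_next_next d).symm h)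
  have nbc : M.left (M.rev (M.next d)) ≠ M.left (M.rev (M.next (M.next d))) := fun h =>
    next_ne (M.next d) (M.left_injective _ _ (M.left_next _) h.symm)
  have nxa : M.left (M.rev d) ≠ M.left d := M.left_rev_ne d
  have nxb : M.left (M.rev (M.next d)) ≠ M.left d := by
    have := M.left_rev_ne (M.next d)
    rwa [M.left_next] at this
  have hab : M.dual.Adj (M.left (M.rev d)) (M.left (M.rev (M.next d))) :=
    dual_adj_of_inc tri_head ((inc_head _).2 (.inr (.inl rfl)))
      ((inc_head _).2 (.inr (.inr rfl))) nab
  have hac : M.dual.Adj (M.left (M.rev d)) (M.left (M.rev (M.next (M.next d)))) :=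
    dual_adj_of_inc hd.tri_tail (hd.inc_tail.2 (.inr (.inl rfl)))
      (hd.inc_tail.2 (.inr (.inr rfl))) nac
  have left : ∀ y, (M.split d hd).dual.Adj (some (M.left d)) (some y) ↔
      M.dual.Adj (M.left d) y ∧ y ≠ M.left (M.rev (M.next d)) := by
    intro y
    by_cases hy : y = M.left d
    · subst hy
      exact iff_of_false (SimpleGraph.irrefl _) (fun h => SimpleGraph.irrefl _ h.1)
    rw [split_dual_left hd hy, hd.dual_left]
    constructor
    · rintro (rfl | rfl)
      · exact ⟨.inl rfl, nab⟩
      · exact ⟨.inr (.inr rfl), nbc.symm⟩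
    · rintro ⟨rfl | h1 | rfl, h2⟩
      · exact .inl rfl
      · exact absurd h1 h2
      · exact .inr rfl
  have hS' := hS.grow (H' := (M.split d hd).dual) xi₀ (fun y => hd.dual_left) hab hac nbc ?_ ?_
  · have inter : ∀ i j, T.Adj i j → ((some '' S i ∪ {z | z = none ∧ i = i₀}) ∩
        (some '' S j ∪ {z | z = none ∧ j = i₀}) : Set (Option F)) = some '' (S i ∩ S j) := by
      intro i j hij
      ext z
      rcases z with _ | z
      · simp only [Set.mem_inter_iff, Set.mem_union, Set.mem_image, reduceCtorEq, and_false,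
          exists_false, Set.mem_ofPred_eq, true_and, false_or, iff_false]
        rintro ⟨rfl, rfl⟩
        exact hij.ne rfl
      · simp
    have new : ∀ v, (M.split d hd).Inc v none → {f | (M.split d hd).Inc v f} ⊆
        (some '' S i₀ ∪ {z | z = none ∧ i₀ = i₀}) → ∃ i, {f | (M.split d hd).Inc v f} ⊆
          (some '' S i ∪ {z | z = none ∧ i = i₀}) ∧ ∀ j, T.Adj i j → {f | (M.split d hd).Inc v f} ≠
            (some '' S i ∪ {z | z = none ∧ i = i₀}) ∩ (some '' S j ∪ {z | z = none ∧ j = i₀}) := by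
      refine fun v hv hsub => ⟨i₀, hsub, fun j hij he => ?_⟩
      rw [inter i₀ j hij] at he
      have : none ∈ {f | (M.split d hd).Inc v f} := hv
      rw [he] at this
      obtain ⟨y, -, hy⟩ := this
      cases hy
    have ai₀ : M.left (M.rev d) ∈ S i₀ := hi₀ (hd.inc_tail.2 (.inr (.inl rfl)))
    have bi₀ : M.left (M.rev (M.next d)) ∈ S i₀ := by
      obtain ⟨i, h1, h2⟩ := hS.cover _ _ (hd.dual_left.2 (.inr (.inl rfl)))
      have hdeg : DegreeThree M.dual (M.left d) := by
        rw [DegreeThree, Set.ncard_eq_three]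
        exact ⟨_, _, _, nab, nac, nbc, Set.ext fun y => hd.dual_left⟩
      rwa [hS.eq_of_degreeThree hdeg h1 xi₀] at h2
    refine ⟨ι, hι, T, _, hS', ?_⟩
    rintro (_ | v) hv
    · refine new none ((split_inc_none hd).2 (.inl rfl)) fun f hf => ?_
      rcases (split_inc_none hd).1 hf with rfl | rfl | rfl
      · exact .inr ⟨rfl, rfl⟩
      · exact .inl ⟨_, xi₀, rfl⟩
      · exact .inl ⟨_, ai₀, rfl⟩
    · obtain ⟨hv', hne⟩ := (split_tri_some hd).1 hv
      by_cases hvh : v = M.tail (M.next d)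
      · subst hvh
        refine new _ ((split_inc_some_none hd).2 (.inl rfl)) ?_
        rintro (_ | f) hf
        · exact .inr ⟨rfl, rfl⟩
        · rcases (inc_head f).1 ((split_inc_some hd).1 hf).1 with rfl | rfl | rfl
          · exact .inl ⟨_, xi₀, rfl⟩
          · exact .inl ⟨_, ai₀, rfl⟩
          · exact .inl ⟨_, bi₀, rfl⟩
      · obtain ⟨i, hi, hj⟩ := htri v hv'
        have him : {f | (M.split d hd).Inc (some v) f} = some '' {f | M.Inc v f} := by
          ext f
          rcases f with _ | f
          · rw [Set.mem_ofPred_eq, split_inc_some_none]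
            exact iff_of_false (fun h => h.elim hvh hne) (by simp)
          · rw [Set.mem_ofPred_eq, split_inc_some, (Option.some_injective F).mem_set_image]
            exact ⟨fun h => h.1, fun h => ⟨h, fun h => hvh h.2⟩⟩
        refine ⟨i, ?_, fun j hij he => ?_⟩
        · rw [him]
          exact (Set.image_mono hi).trans Set.subset_union_left
        · rw [him, inter i j hij] at he
          exact hj j hij ((Option.some_injective F).image_injective he)
  · intro y
    by_cases hy : y = M.left d
    · subst hy
      exact iff_of_true (split_dual_new hd) (.inr (.inr rfl))
    · rw [split_dual_none hd hy]
      simp [hy]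
  · intro y z
    by_cases hy : y = M.left d
    · subst hy
      rw [left]
      exact and_congr_right fun h => ⟨fun h => ⟨fun h' => h h'.2, fun h' => nxb h'.1.symm⟩,
        fun h h' => h.1 ⟨rfl, h'⟩⟩
    by_cases hz : z = M.left d
    · subst hz
      rw [SimpleGraph.adj_comm, left, M.dual.adj_comm]
      exact and_congr_right fun h => ⟨fun h => ⟨fun h' => nxb h'.2.symm, fun h' => h h'.1⟩,
        fun h h' => h.2 ⟨h', rfl⟩⟩
    rw [split_dual_some hd hy hz]
    exact ⟨fun h => ⟨h, fun h => hy h.1, fun h => hz h.2⟩, fun h => h.1⟩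

end PolyMap

/-- Every reducible graph is the graph of a polyhedral map whose dual is a tree of wheels. -/
theorem Reducible.exists_map {X : Type} {G : SimpleGraph X} (h : Reducible G) :
    ∃ (D V F : Type) (M : PolyMap D V F), Nonempty (G ≃g M.primal) ∧ M.IsWheelTree := by
  induction h with
  | complete G h =>
    refine ⟨_, _, _, tetrahedron, ?_, PolyMap.tetrahedron_isWheelTree⟩
    rw [tetrahedron_primal]
    exact h
  | triangle G p q r h _ ih =>
    obtain ⟨D, V, F, M, ⟨ψ⟩, hM⟩ := ih
    obtain ⟨t, ht, hψ⟩ := PolyMap.exists_trunc_iso h ψ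
    exact ⟨_, _, _, _, hψ, hM.trunc ht⟩
  | path G p q r s h _ ih =>
    obtain ⟨D, V, F, M, ⟨ψ⟩, hM⟩ := ih
    obtain ⟨d, hd, hψ⟩ := PolyMap.exists_split_iso h ψ
    exact ⟨_, _, _, _, hψ, hM.split hd⟩

/-! ### Recognizing splittable darts by the dual graph -/

namespace PolyMap

variable {D V F : Type} {M : PolyMap D V F}

theorem Tri.exists_dart {t : V} (ht : M.Tri t) {f g : F} (hf : M.Inc t f) (hg : M.Inc t g)
    (hne : f ≠ g) : ∃ e, M.tail e = t ∧
      ((M.left e = f ∧ M.left (M.rot e) = g) ∨ (M.left e = g ∧ M.left (M.rot e) = f)) := by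
  obtain ⟨d, rfl, rfl⟩ := hf
  rcases ht.inc_iff.1 hg with rfl | rfl | rfl
  · exact absurd rfl hne
  · exact ⟨d, rfl, .inl ⟨rfl, rfl⟩⟩
  · exact ⟨M.rot (M.rot d), by simp only [M.tail_rot], .inr ⟨rfl, by rw [ht d rfl]⟩⟩

/-- Two faces around a vertex of degree three are separated by an edge at this vertex, which by
`left_injective` is the edge of `d`. -/
theorem Tri.eq_end {d : D} {v : V} (hv : M.Tri v) (h1 : M.Inc v (M.left d))
    (h2 : M.Inc v (M.left (M.rev d))) : v = M.tail d ∨ v = M.tail (M.rev d) := by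
  obtain ⟨e, rfl, he | he⟩ := hv.exists_dart h1 h2 (M.left_rev_ne d).symm
  · exact .inl (congrArg M.tail (M.left_injective e d he.1 (by rw [← M.left_rot, he.2])))
  · exact .inr (congrArg M.tail (M.left_injective e (M.rev d) he.1
      (by rw [← M.left_rot, he.2, M.rev_rev])))

theorem next_next_ne (d : D) : M.next (M.next d) ≠ d := fun h => by
  have h1 : M.tail (M.rev (M.next d)) = M.tail d := by rw [← M.tail_next, h]
  have h2 : M.next d = M.rev d := M.tail_injective (M.tail_next d) (by rw [h1, M.rev_rev])
  have h3 := M.left_next d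
  rw [h2] at h3
  exact M.left_rev_ne d h3

/-- Along the face to the left of `d`, the preceding dart borders `c` and the following one borders
`b`. The dart after that must border one of the three neighbours; by `left_injective` it is the
preceding one, so the face is a triangle. -/
theorem splittable_of_dual {d : D} (ht : M.Tri (M.tail d)) (hh : M.Tri (M.tail (M.rev d)))
    {b c : F} (hd : ∀ y, M.dual.Adj (M.left d) y → y = M.left (M.rev d) ∨ y = b ∨ y = c)
    (hb : M.Inc (M.tail (M.rev d)) b) (hc : M.Inc (M.tail d) c) (hbx : b ≠ M.left d)
    (hba : b ≠ M.left (M.rev d)) (hcx : c ≠ M.left d) (hca : c ≠ M.left (M.rev d)) :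
    M.Splittable d ∧ M.left (M.rev (M.next d)) = b ∧
      M.left (M.rev (M.next (M.next d))) = c := by
  have hb' : M.left (M.rev (M.next d)) = b := by
    rcases hh.inc_head_iff.1 hb with h | h | h
    · exact absurd h hbx
    · exact absurd h hba
    · exact h.symm
  obtain ⟨p, rfl⟩ : ∃ p, M.next p = d := ⟨M.rev (M.rot.symm d), by
    rw [next, M.rev_rev, Equiv.apply_symm_apply]⟩
  have hc' : M.left (M.rev p) = c := by
    rcases ht.inc_tail_iff.1 hc with h | h | h
    · exact absurd (h.trans (M.left_next p).symm) hcx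
    · exact h.symm
    · exact absurd h hca
  have h3 : M.next (M.next (M.next p)) = p := by
    rcases hd (M.left (M.rev (M.next (M.next (M.next p))))) ⟨_, left_next_next _, rfl⟩ with
      h | h | h
    · exact absurd (M.left_injective _ _ (left_next_next _) h) (next_next_ne _)
    · rw [← hb'] at h
      exact absurd (M.left_injective _ _ (M.left_next _) h) (next_ne _)
    · rw [← hc'] at h
      exact M.left_injective _ _ (by simp only [M.left_next]) h
  exact ⟨⟨by rw [h3], ht, hh⟩, hb', by rw [h3, hc']⟩

end PolyMap

/-! ### Realizing graphs as duals of reducible maps -/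

/-- The restriction of the graph `E` to `B` is the dual of a polyhedral map with reducible graph,
in which the sets in `𝒯` are the sets of faces around vertices of degree three. -/
def Realizes {W : Type u} (E : SimpleGraph W) (B : Set W) (𝒯 : Set (Set W)) : Prop :=
  ∃ (D V F : Type) (M : PolyMap D V F) (l : F → W), Reducible M.primal ∧ Function.Injective l ∧
    Set.range l = B ∧ (∀ f g, M.dual.Adj f g ↔ E.Adj (l f) (l g)) ∧
    ∀ T ∈ 𝒯, ∃ v, M.Tri v ∧ T = l '' {f | M.Inc v f}

namespace Realizes

variable {W : Type u} {E E' : SimpleGraph W} {B : Set W} {𝒯 𝒯' : Set (Set W)}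

/-- Realized by truncating the vertex of the triangle `T`. That triangle is used up, and each pair
of its corners forms a new triangle with `w`. -/
theorem attach (h : Realizes E B 𝒯) {T : Set W} (hT : T ∈ 𝒯) {w : W} (hw : w ∉ B)
    (hE : ∀ x ∈ B, ∀ y ∈ B, E'.Adj x y ↔ E.Adj x y) (hE' : ∀ y ∈ B, E'.Adj w y ↔ y ∈ T)
    (h𝒯 : ∀ T' ∈ 𝒯', (T' ∈ 𝒯 ∧ T' ≠ T) ∨ ∃ y ∈ T, ∃ z ∈ T, y ≠ z ∧ T' = {w, y, z}) :
    Realizes E' (insert w B) 𝒯' := by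
  obtain ⟨D, V, F, M, l, hM, hl, rfl, hadj, htri⟩ := h
  obtain ⟨t, ht, rfl⟩ := htri T hT
  refine ⟨_, _, _, M.trunc t ht, fun o => o.elim w l, PolyMap.trunc_reducible ht hM, ?_, ?_, ?_, ?_⟩
  · rintro (_ | f) (_ | g) hfg
    · rfl
    · exact absurd ⟨g, hfg.symm⟩ hw
    · exact absurd ⟨f, hfg⟩ hw
    · exact congrArg some (hl hfg)
  · ext y
    constructor
    · rintro ⟨_ | f, rfl⟩
      · exact .inl rfl
      · exact .inr ⟨f, rfl⟩
    · rintro (rfl | ⟨f, rfl⟩)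
      · exact ⟨none, rfl⟩
      · exact ⟨some f, rfl⟩
  · have new : ∀ g, (M.trunc t ht).dual.Adj none (some g) ↔ E'.Adj w (l g) := fun g => by
      rw [PolyMap.trunc_dual_none, hE' _ ⟨g, rfl⟩, hl.mem_set_image]
      exact Iff.rfl
    rintro (_ | f) (_ | g)
    · exact iff_of_false (SimpleGraph.irrefl _) (SimpleGraph.irrefl _)
    · exact new g
    · rw [SimpleGraph.adj_comm, E'.adj_comm]
      exact new f
    · rw [PolyMap.trunc_dual_some, hadj]
      exact (hE _ ⟨f, rfl⟩ _ ⟨g, rfl⟩).symm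
  · intro T' hT'
    rcases h𝒯 T' hT' with ⟨hT', hne⟩ | ⟨y, ⟨f, hf, rfl⟩, z, ⟨g, hg, rfl⟩, hne, rfl⟩
    · obtain ⟨v, hv, rfl⟩ := htri T' hT'
      have hvt : v ≠ t := fun h => hne (by rw [h])
      refine ⟨.inl ⟨v, hvt⟩, (PolyMap.trunc_tri_old ht).2 hv, ?_⟩
      ext y
      constructor
      · rintro ⟨f, hf, rfl⟩
        exact ⟨some f, (PolyMap.trunc_inc_some ht).2 ⟨f, rfl, hf⟩, rfl⟩
      · rintro ⟨f, hf, rfl⟩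
        obtain ⟨g, rfl, hg⟩ := (PolyMap.trunc_inc_some ht).1 hf
        exact ⟨g, hg, rfl⟩
    · obtain ⟨e, he, hfg⟩ := ht.exists_dart hf hg fun h => hne (by rw [h])
      refine ⟨.inr ⟨e, he⟩, PolyMap.trunc_tri_new ht _, ?_⟩
      have : {x | (M.trunc t ht).Inc (.inr ⟨e, he⟩) x} = {none, some f, some g} := by
        ext x
        rw [Set.mem_ofPred_eq, PolyMap.trunc_inc_new]
        rcases hfg with ⟨rfl, rfl⟩ | ⟨rfl, rfl⟩
        · exact Iff.rfl
        · exact or_congr Iff.rfl or_comm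
      rw [this, Set.image_insert_eq, Set.image_pair]
      rfl

/-- The half of the triangle at the head of `d` is labelled `p` and the half at the tail `q`. Both
names are left free so that either half can inherit the label `x`. -/
theorem of_split {D V F : Type} {M : PolyMap D V F} {d : D} (hd : M.Splittable d)
    (hM : Reducible M.primal) {l : F → W} (hl : Function.Injective l)
    (hadj : ∀ f g, M.dual.Adj f g ↔ E.Adj (l f) (l g))
    (htri : ∀ T ∈ 𝒯, ∃ v, M.Tri v ∧ T = l '' {f | M.Inc v f}) {x a b c p q : W}
    (hx : l (M.left d) = x) (ha : l (M.left (M.rev d)) = a)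
    (hb : l (M.left (M.rev (M.next d))) = b) (hc : l (M.left (M.rev (M.next (M.next d)))) = c)
    (hpq : E'.Adj p q) (hp : ∀ f, l f ≠ x → l f ≠ p) (hq : ∀ f, l f ≠ x → l f ≠ q)
    (hE : ∀ y ∈ Set.range l, ∀ z ∈ Set.range l, y ≠ x → z ≠ x → (E'.Adj y z ↔ E.Adj y z))
    (hEp : ∀ y ∈ Set.range l, y ≠ x → (E'.Adj p y ↔ y = a ∨ y = b))
    (hEq : ∀ y ∈ Set.range l, y ≠ x → (E'.Adj q y ↔ y = a ∨ y = c))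
    (h𝒯 : ∀ T' ∈ 𝒯', (T' ∈ 𝒯 ∧ x ∉ T') ∨ T' = {q, a, c} ∨ T' = {p, a, b} ∨ T' = {p, q, a}) :
    Realizes E' (insert p (insert q (Set.range l \ {x}))) 𝒯' := by
  classical
  let l' : Option F → W := fun o => o.elim p fun f => if f = M.left d then q else l f
  have l0 : l' none = p := rfl
  have l1 : l' (some (M.left d)) = q := if_pos rfl
  have l2 : ∀ f, f ≠ M.left d → l' (some f) = l f := fun f hf => if_neg hf
  have lx : ∀ {f}, f ≠ M.left d → l f ≠ x := fun hf h => hf (hl (h.trans hx.symm))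
  have na : M.left (M.rev d) ≠ M.left d := M.left_rev_ne d
  have nb : M.left (M.rev (M.next d)) ≠ M.left d := by
    have := M.left_rev_ne (M.next d)
    rwa [M.left_next] at this
  have nc : M.left (M.rev (M.next (M.next d))) ≠ M.left d := by
    have := M.left_rev_ne (M.next (M.next d))
    rwa [PolyMap.left_next_next] at this
  have tri_head : M.Tri (M.tail (M.next d)) := by rw [M.tail_next]; exact hd.tri_head
  refine ⟨_, _, _, M.split d hd, l', PolyMap.split_reducible hd hM, ?_, ?_, ?_, ?_⟩
  · rintro (_ | f) (_ | g) hfg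
    · rfl
    · by_cases hg : g = M.left d
      · rw [hg, l0, l1] at hfg
        exact absurd hfg hpq.ne
      · rw [l0, l2 g hg] at hfg
        exact absurd hfg.symm (hp g (lx hg))
    · by_cases hg : f = M.left d
      · rw [hg, l0, l1] at hfg
        exact absurd hfg hpq.ne'
      · rw [l0, l2 f hg] at hfg
        exact absurd hfg (hp f (lx hg))
    · by_cases hf : f = M.left d <;> by_cases hg : g = M.left d
      · rw [hf, hg]
      · rw [hf, l1, l2 g hg] at hfg
        exact absurd hfg.symm (hq g (lx hg))
      · rw [hg, l1, l2 f hf] at hfg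
        exact absurd hfg (hq f (lx hf))
      · rw [l2 f hf, l2 g hg] at hfg
        rw [hl hfg]
  · ext y
    constructor
    · rintro ⟨_ | f, rfl⟩
      · exact .inl rfl
      · by_cases hf : f = M.left d
        · rw [hf, l1]
          exact .inr (.inl rfl)
        · rw [l2 f hf]
          exact .inr (.inr ⟨⟨f, rfl⟩, lx hf⟩)
    · rintro (rfl | rfl | ⟨⟨f, rfl⟩, hf⟩)
      · exact ⟨none, rfl⟩
      · exact ⟨_, l1⟩
      · exact ⟨some f, l2 f fun h => hf (by rw [h]; exact hx)⟩
  · have new : ∀ g, (M.split d hd).dual.Adj none (some g) ↔ E'.Adj (l' none) (l' (some g)) := by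
      intro g
      by_cases hg : g = M.left d
      · rw [hg, l0, l1]
        exact iff_of_true (PolyMap.split_dual_new hd) hpq
      · rw [l0, l2 g hg, PolyMap.split_dual_none hd hg, hEp _ ⟨g, rfl⟩ (lx hg), ← ha, ← hb,
          hl.eq_iff, hl.eq_iff]
    have old : ∀ g, g ≠ M.left d → ((M.split d hd).dual.Adj (some (M.left d)) (some g) ↔
        E'.Adj (l' (some (M.left d))) (l' (some g))) := by
      intro g hg
      rw [l1, l2 g hg, PolyMap.split_dual_left hd hg, hEq _ ⟨g, rfl⟩ (lx hg), ← ha, ← hc,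
        hl.eq_iff, hl.eq_iff]
    rintro (_ | f) (_ | g)
    · exact iff_of_false (SimpleGraph.irrefl _) (SimpleGraph.irrefl _)
    · exact new g
    · rw [SimpleGraph.adj_comm, E'.adj_comm]
      exact new f
    · by_cases hf : f = M.left d <;> by_cases hg : g = M.left d
      · rw [hf, hg]
        exact iff_of_false (SimpleGraph.irrefl _) (SimpleGraph.irrefl _)
      · rw [hf]
        exact old g hg
      · rw [hg, SimpleGraph.adj_comm, E'.adj_comm]
        exact old f hf
      · rw [l2 f hf, l2 g hg, PolyMap.split_dual_some hd hf hg,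
          hE _ ⟨f, rfl⟩ _ ⟨g, rfl⟩ (lx hf) (lx hg), hadj]
  · intro T' hT'
    rcases h𝒯 T' hT' with ⟨hT', hxT⟩ | rfl | rfl | rfl
    · obtain ⟨v, hv, rfl⟩ := htri T' hT'
      have hvx : ¬ M.Inc v (M.left d) := fun h => hxT ⟨_, h, hx⟩
      have n1 : v ≠ M.tail (M.next d) := by
        rintro rfl
        exact hvx (tri_head.inc_tail_iff.2 (.inl rfl))
      have n2 : v ≠ M.tail (M.next (M.next d)) := by
        rintro rfl
        exact hvx ⟨_, rfl, PolyMap.left_next_next d⟩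
      refine ⟨some v, (PolyMap.split_tri_some hd).2 ⟨hv, n2⟩, ?_⟩
      have ne : ∀ {f}, M.Inc v f → f ≠ M.left d := fun hf h => hvx (h ▸ hf)
      ext y
      constructor
      · rintro ⟨f, hf, rfl⟩
        exact ⟨some f, (PolyMap.split_inc_some hd).2 ⟨hf, fun h => n1 h.2⟩, l2 f (ne hf)⟩
      · rintro ⟨_ | f, hf, rfl⟩
        · exact ((PolyMap.split_inc_some_none hd).1 hf).elim (fun h => absurd h n1)
            fun h => absurd h n2
        · have hf' := ((PolyMap.split_inc_some hd).1 hf).1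
          exact ⟨f, hf', (l2 f (ne hf')).symm⟩
    · refine ⟨some (M.tail d), (PolyMap.split_tri_some hd).2
        ⟨hd.tri_tail, hd.apex_ne_tail.symm⟩, ?_⟩
      have : {f | (M.split d hd).Inc (some (M.tail d)) f} =
          {some (M.left d), some (M.left (M.rev d)), some (M.left (M.rev (M.next (M.next d))))} := by
        ext f
        rcases f with _ | f
        · rw [Set.mem_ofPred_eq, PolyMap.split_inc_some_none]
          refine iff_of_false ?_ (by simp)
          rintro (h | h)
          · exact PolyMap.Splittable.head_ne_tail h.symm
          · exact hd.apex_ne_tail h.symm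
        · rw [Set.mem_ofPred_eq, PolyMap.split_inc_some, hd.inc_tail]
          simp only [Set.mem_insert_iff, Set.mem_singleton_iff, Option.some.injEq]
          exact ⟨fun h => h.1, fun h => ⟨h, fun h =>
            PolyMap.Splittable.head_ne_tail h.2.symm⟩⟩
      rw [this, Set.image_insert_eq, Set.image_pair, l1, l2 _ na, l2 _ nc, ha, hc]
    · refine ⟨some (M.tail (M.next d)), (PolyMap.split_tri_some hd).2
        ⟨tri_head, PolyMap.Splittable.apex_ne_head.symm⟩, ?_⟩
      have : {f | (M.split d hd).Inc (some (M.tail (M.next d))) f} =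
          {none, some (M.left (M.rev d)), some (M.left (M.rev (M.next d)))} := by
        ext f
        rcases f with _ | f
        · exact iff_of_true ((PolyMap.split_inc_some_none hd).2 (.inl rfl)) (.inl rfl)
        · rw [Set.mem_ofPred_eq, PolyMap.split_inc_some, tri_head.inc_tail_iff]
          simp only [Set.mem_insert_iff, Set.mem_singleton_iff, Option.some.injEq, reduceCtorEq,
            false_or, and_true]
          constructor
          · rintro ⟨h | h, h'⟩
            · exact absurd h h'
            · exact h
          · rintro (rfl | rfl)
            · exact ⟨.inr (.inl rfl), na⟩
            · exact ⟨.inr (.inr rfl), nb⟩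
      rw [this, Set.image_insert_eq, Set.image_pair, l0, l2 _ na, l2 _ nb, ha, hb]
    · refine ⟨none, PolyMap.split_tri_none hd, ?_⟩
      have : {f | (M.split d hd).Inc none f} =
          {none, some (M.left d), some (M.left (M.rev d))} := by
        ext f
        exact PolyMap.split_inc_none hd
      rw [this, Set.image_insert_eq, Set.image_pair, l0, l1, l2 _ na, ha]

/-- The vertices with triangles `x a b` and `x a c` both have degree three and lie on the two faces
`x` and `a`, so they are the ends of the edge between these faces, which is to be split. Which of
them is the tail decides which half of the triangle keeps the label `x`. -/
theorem grow (h : Realizes E B 𝒯) {x a b c w : W} (hw : w ∉ B) (hab : {x, a, b} ∈ 𝒯)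
    (hac : {x, a, c} ∈ 𝒯) (hxa : x ≠ a) (hxb : x ≠ b) (hxc : x ≠ c) (hab' : a ≠ b) (hac' : a ≠ c)
    (hbc : b ≠ c) (hdeg : ∀ y ∈ B, E.Adj x y → y = a ∨ y = b ∨ y = c)
    (hE : ∀ y ∈ B, ∀ z ∈ B, y ≠ x → z ≠ x → (E'.Adj y z ↔ E.Adj y z)) (hwx : E'.Adj w x)
    (hEw : ∀ y ∈ B, y ≠ x → (E'.Adj w y ↔ y = a ∨ y = b))
    (hEx : ∀ y ∈ B, y ≠ x → (E'.Adj x y ↔ y = a ∨ y = c))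
    (h𝒯 : ∀ T' ∈ 𝒯', (T' ∈ 𝒯 ∧ x ∉ T') ∨ T' = {x, a, c} ∨ T' = {w, a, b} ∨ T' = {w, x, a}) :
    Realizes E' (insert w B) 𝒯' := by
  obtain ⟨D, V, F, M, l, hM, hl, rfl, hadj, htri⟩ := h
  obtain ⟨v₁, hv₁, e₁⟩ := htri _ hab
  obtain ⟨v₂, hv₂, e₂⟩ := htri _ hac
  obtain ⟨x, hx1, rfl⟩ : x ∈ l '' {f | M.Inc v₁ f} := by rw [← e₁]; exact .inl rfl
  obtain ⟨a, ha1, rfl⟩ : a ∈ l '' {f | M.Inc v₁ f} := by rw [← e₁]; exact .inr (.inl rfl)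
  obtain ⟨b, hb1, rfl⟩ : b ∈ l '' {f | M.Inc v₁ f} := by rw [← e₁]; exact .inr (.inr rfl)
  obtain ⟨c, hc2, rfl⟩ : c ∈ l '' {f | M.Inc v₂ f} := by rw [← e₂]; exact .inr (.inr rfl)
  have hx2 : M.Inc v₂ x := by rw [← Set.mem_ofPred_eq (p := M.Inc v₂), ← hl.mem_set_image]; rw [← e₂]; exact .inl rfl
  have ha2 : M.Inc v₂ a := by rw [← Set.mem_ofPred_eq (p := M.Inc v₂), ← hl.mem_set_image]; rw [← e₂]; exact .inr (.inl rfl)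
  have hne : v₁ ≠ v₂ := by
    rintro rfl
    have : l b ∈ l '' {f | M.Inc v₁ f} := ⟨b, hb1, rfl⟩
    rw [← e₂] at this
    rcases this with h | h | h
    exacts [hxb h.symm, hab' h.symm, hbc h]
  have hwl : ∀ f, l f ≠ w := fun f h => hw ⟨f, h⟩
  have hB : insert w (insert (l x) (Set.range l \ {l x})) = insert w (Set.range l) := by
    rw [Set.insert_sdiff_singleton, Set.insert_eq_of_mem (Set.mem_range_self x)]
  obtain ⟨d, rfl, rfl⟩ := PolyMap.dual_adj_of_inc hv₁ hx1 ha1 fun h => hxa (by rw [h])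
  have hd : ∀ y, M.dual.Adj (M.left d) y → y = M.left (M.rev d) ∨ y = b ∨ y = c := by
    intro y hy
    simpa only [hl.eq_iff] using hdeg (l y) ⟨y, rfl⟩ ((hadj _ _).1 hy)
  have hd' : ∀ y, M.dual.Adj (M.left d) y → y = M.left (M.rev d) ∨ y = c ∨ y = b := by
    intro y hy
    rw [or_comm (a := y = c)]
    exact hd y hy
  have n : ∀ {f g}, l f ≠ l g → f ≠ g := fun h h' => h (by rw [h'])
  rcases hv₁.eq_end hx1 ha1 with rfl | rfl <;> rcases hv₂.eq_end hx2 ha2 with rfl | rfl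
  · exact absurd rfl hne
  · obtain ⟨hs, sb, sc⟩ := PolyMap.splittable_of_dual hv₁ hv₂ hd' hc2 hb1 (n hxc).symm (n hac').symm
      (n hxb).symm (n hab').symm
    have := of_split (E' := E') (𝒯' := 𝒯') (p := l (M.left d)) (q := w) hs hM hl hadj htri rfl rfl
      (by rw [sb]) (by rw [sc]) hwx.symm (fun f hf => hf) (fun f _ => hwl f) hE hEx hEw ?_
    · rwa [Set.insert_comm, hB] at this
    · intro T' hT'
      rcases h𝒯 T' hT' with h | h | h | h
      · exact .inl h
      · exact .inr (.inr (.inl h))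
      · exact .inr (.inl h)
      · exact .inr (.inr (.inr (by rw [h, Set.insert_comm])))
  · obtain ⟨hs, sb, sc⟩ := PolyMap.splittable_of_dual hv₂ hv₁ hd hb1 hc2 (n hxb).symm (n hab').symm
      (n hxc).symm (n hac').symm
    have := of_split (E' := E') (𝒯' := 𝒯') (p := w) (q := l (M.left d)) hs hM hl hadj htri rfl rfl
      (by rw [sb]) (by rw [sc]) hwx (fun f _ => hwl f) (fun f hf => hf) hE hEw hEx h𝒯
    rwa [hB] at this
  · exact absurd rfl hne

end Realizes

/-- The graph `E₀` together with the wheel with hub `h` and rim `r 0, …, r k`. -/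
def fan {W : Type u} (E₀ : SimpleGraph W) (h : W) (r : ℕ → W) (k : ℕ) : SimpleGraph W :=
  SimpleGraph.fromRel fun x y => E₀.Adj x y ∨ (x = h ∧ ∃ i ≤ k, y = r i) ∨
    (∃ i < k, x = r i ∧ y = r (i + 1)) ∨ (x = r k ∧ y = r 0)

/-- The vertices `h` and `r 0, …, r n` are different, and just `h`, `r 0`, `r 1` lie in `B₀`. -/
structure IsFan {W : Type u} (E₀ : SimpleGraph W) (B₀ : Set W) (h : W) (r : ℕ → W) (n : ℕ) :
    Prop where
  inj : ∀ i ≤ n, ∀ j ≤ n, r i = r j → i = j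
  ne : ∀ i ≤ n, r i ≠ h
  mem : ∀ x y, E₀.Adj x y → x ∈ B₀
  hub : h ∈ B₀
  zero : r 0 ∈ B₀
  one : r 1 ∈ B₀
  notMem : ∀ i ≤ n, 2 ≤ i → r i ∉ B₀

/-- The vertex set of `fan`. -/
def fanSet {W : Type u} (B₀ : Set W) (r : ℕ → W) (k : ℕ) : Set W :=
  B₀ ∪ {x | ∃ i ≤ k, x = r i}

/-- The triangular faces of `fan`. -/
def fanFaces {W : Type u} (𝒯₀ : Set (Set W)) (h : W) (r : ℕ → W) (k : ℕ) : Set (Set W) :=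
  -- The index `i` starts at `1`: the triangle `h, r 0, r 1`, along which the wheel is attached, is
  -- a face only if it belongs to `𝒯₀`. For `k = 2` the wheel is a tetrahedron and its rim is one
  -- more triangle.
  {T | T ∈ 𝒯₀ ∨ (∃ i, 1 ≤ i ∧ i < k ∧ T = {h, r i, r (i + 1)}) ∨ T = {h, r k, r 0} ∨
    (k = 2 ∧ T = {r 0, r 1, r 2})}

namespace IsFan

variable {W : Type u} {E₀ : SimpleGraph W} {B₀ : Set W} {h : W} {r : ℕ → W} {n : ℕ}

theorem fanSet_succ (k : ℕ) : fanSet B₀ r (k + 1) = insert (r (k + 1)) (fanSet B₀ r k) := by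
  ext x
  constructor
  · rintro (hx | ⟨i, hi, rfl⟩)
    · exact .inr (.inl hx)
    · rcases Nat.le_succ_iff.1 hi with hi | rfl
      · exact .inr (.inr ⟨i, hi, rfl⟩)
      · exact .inl rfl
  · rintro (rfl | hx | ⟨i, hi, rfl⟩)
    · exact .inr ⟨_, le_rfl, rfl⟩
    · exact .inl hx
    · exact .inr ⟨i, by omega, rfl⟩

theorem notMem_fanSet (hf : IsFan E₀ B₀ h r n) {k : ℕ} (hk : 2 ≤ k + 1) (hkn : k + 1 ≤ n) :
    r (k + 1) ∉ fanSet B₀ r k := by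
  rintro (hx | ⟨i, hi, hx⟩)
  · exact hf.notMem _ hkn hk hx
  · have := hf.inj _ hkn _ (by omega) hx
    omega

theorem fan_adj_rim (hf : IsFan E₀ B₀ h r n) {j k : ℕ} (hj : 2 ≤ j) (hjn : j ≤ n) (hkn : k ≤ n)
    {y : W} : (fan E₀ h r k).Adj (r j) y ↔
      j ≤ k ∧ (y = h ∨ y = r (j - 1) ∨ (j < k ∧ y = r (j + 1)) ∨ (j = k ∧ y = r 0)) := by
  rw [fan, SimpleGraph.fromRel_adj]
  have hjB : r j ∉ B₀ := hf.notMem j hjn hj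
  constructor
  · rintro ⟨hne, (h1 | ⟨h1, -⟩ | ⟨i, hi, h1, rfl⟩ | ⟨h1, rfl⟩) |
      (h1 | ⟨rfl, i, hi, h1⟩ | ⟨i, hi, rfl, h1⟩ | ⟨-, h1⟩)⟩
    · exact absurd (hf.mem _ _ h1) hjB
    · exact absurd h1 (hf.ne j hjn)
    · obtain rfl := hf.inj _ hjn _ (by omega) h1
      exact ⟨hi.le, .inr (.inr (.inl ⟨hi, rfl⟩))⟩
    · obtain rfl := hf.inj _ hjn _ hkn h1
      exact ⟨le_rfl, .inr (.inr (.inr ⟨rfl, rfl⟩))⟩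
    · exact absurd (hf.mem _ _ h1.symm) hjB
    · obtain rfl := hf.inj _ hjn _ (by omega) h1
      exact ⟨hi, .inl rfl⟩
    · obtain rfl := hf.inj _ hjn _ (by omega) h1
      exact ⟨by omega, .inr (.inl rfl)⟩
    · have := hf.inj _ hjn _ (by omega) h1
      omega
  · rintro ⟨hjk, rfl | rfl | ⟨h1, rfl⟩ | ⟨rfl, rfl⟩⟩
    · exact ⟨hf.ne j hjn, .inr (.inr (.inl ⟨rfl, j, hjk, rfl⟩))⟩
    · refine ⟨fun h => ?_, .inr (.inr (.inr (.inl ⟨j - 1, by omega, rfl, ?_⟩)))⟩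
      · have := hf.inj _ hjn _ (by omega) h
        omega
      · rw [Nat.sub_add_cancel (by omega)]
    · refine ⟨fun h => ?_, .inl (.inr (.inr (.inl ⟨j, h1, rfl, rfl⟩)))⟩
      have := hf.inj _ hjn _ (by omega) h
      omega
    · refine ⟨fun h => ?_, .inl (.inr (.inr (.inr ⟨rfl, rfl⟩)))⟩
      have := hf.inj _ hjn _ (by omega) h
      omega

/-- Inserting `r (k + 1)` into the rim only affects edges at `r k` and at the new vertex. -/
theorem fan_succ_adj {k : ℕ} {y z : W} (hy : y ≠ r k) (hz : z ≠ r k) (hy' : y ≠ r (k + 1))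
    (hz' : z ≠ r (k + 1)) : (fan E₀ h r (k + 1)).Adj y z ↔ (fan E₀ h r k).Adj y z := by
  have key : ∀ y z, y ≠ r k → z ≠ r k → y ≠ r (k + 1) → z ≠ r (k + 1) →
      ((E₀.Adj y z ∨ (y = h ∧ ∃ i ≤ k + 1, z = r i) ∨
        (∃ i < k + 1, y = r i ∧ z = r (i + 1)) ∨ (y = r (k + 1) ∧ z = r 0)) ↔
      (E₀.Adj y z ∨ (y = h ∧ ∃ i ≤ k, z = r i) ∨
        (∃ i < k, y = r i ∧ z = r (i + 1)) ∨ (y = r k ∧ z = r 0))) := by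
    intro y z hy hz hy' hz'
    refine or_congr Iff.rfl (or_congr (and_congr_right fun _ => ?_) (or_congr ?_ ?_))
    · constructor
      · rintro ⟨i, hi, rfl⟩
        rcases Nat.le_succ_iff.1 hi with hi | rfl
        · exact ⟨i, hi, rfl⟩
        · exact absurd rfl hz'
      · rintro ⟨i, hi, rfl⟩
        exact ⟨i, by omega, rfl⟩
    · constructor
      · rintro ⟨i, hi, rfl, rfl⟩
        rcases Nat.lt_succ_iff_lt_or_eq.1 hi with hi | rfl
        · exact ⟨i, hi, rfl, rfl⟩
        · exact absurd rfl hy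
      · rintro ⟨i, hi, rfl, rfl⟩
        exact ⟨i, by omega, rfl, rfl⟩
    · exact iff_of_false (fun h => hy' h.1) (fun h => hy h.1)
  rw [fan, fan, SimpleGraph.fromRel_adj, SimpleGraph.fromRel_adj, key y z hy hz hy' hz',
    key z y hz hy hz' hy']

/-- The closing rim edge from `r k` to `r 0` is subdivided by `r (k + 1)`. For `2 ≤ k` the vertex `r
k` is outside `B₀`, so its only neighbours are the hub and the two adjacent rim vertices. -/
theorem realizes_succ (hf : IsFan E₀ B₀ h r n) {𝒯₀ : Set (Set W)} (h𝒯₀ : ∀ T ∈ 𝒯₀, T ⊆ B₀) {k : ℕ}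
    (hk : 2 ≤ k) (hkn : k + 1 ≤ n)
    (hR : Realizes (fan E₀ h r k) (fanSet B₀ r k) (fanFaces 𝒯₀ h r k)) :
    Realizes (fan E₀ h r (k + 1)) (fanSet B₀ r (k + 1)) (fanFaces 𝒯₀ h r (k + 1)) := by
  rw [fanSet_succ]
  have hw := hf.notMem_fanSet (by omega) hkn
  have hne : ∀ {i j}, i ≤ n → j ≤ n → i ≠ j → r i ≠ r j := fun hi hj hij h =>
    hij (hf.inj _ hi _ hj h)
  have hk1 : r (k - 1 + 1) = r k := by rw [Nat.sub_add_cancel (by omega)]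
  refine hR.grow (x := r k) (a := h) (b := r 0) (c := r (k - 1)) hw ?_ ?_ (hf.ne k (by omega))
    (hne (by omega) (by omega) (by omega)) (hne (by omega) (by omega) (by omega))
    (hf.ne 0 (by omega)).symm (hf.ne (k - 1) (by omega)).symm
    (hne (by omega) (by omega) (by omega)) ?_ ?_ ?_ ?_ ?_ ?_
  · exact .inr (.inr (.inl (Set.insert_comm _ _ _)))
  · refine .inr (.inl ⟨k - 1, by omega, by omega, ?_⟩)
    rw [hk1, Set.insert_comm, Set.pair_comm (r k)]
  · intro y _ hy
    rcases ((hf.fan_adj_rim hk (by omega) (by omega)).1 hy).2 with h1 | h1 | h1 | h1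
    · exact .inl h1
    · exact .inr (.inr h1)
    · exact absurd h1.1 (by omega)
    · exact .inr (.inl h1.2)
  · intro y hy z hz hy' hz'
    exact fan_succ_adj hy' hz' (fun h => hw (h ▸ hy)) (fun h => hw (h ▸ hz))
  · exact (hf.fan_adj_rim (by omega) hkn hkn).2 ⟨le_rfl, .inr (.inl (by rw [Nat.add_sub_cancel]))⟩
  · intro y hy hy'
    rw [hf.fan_adj_rim (by omega) hkn hkn, Nat.add_sub_cancel]
    constructor
    · rintro ⟨-, h1 | h1 | h1 | h1⟩
      · exact .inl h1
      · exact absurd h1 hy'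
      · exact absurd h1.1 (by omega)
      · exact .inr h1.2
    · rintro (h1 | h1)
      · exact ⟨le_rfl, .inl h1⟩
      · exact ⟨le_rfl, .inr (.inr (.inr ⟨rfl, h1⟩))⟩
  · intro y hy hy'
    rw [hf.fan_adj_rim hk (by omega) hkn]
    constructor
    · rintro ⟨-, h1 | h1 | h1 | h1⟩
      · exact .inl h1
      · exact .inr h1
      · exact absurd (h1.2 ▸ hy) hw
      · exact absurd h1.1 (by omega)
    · rintro (h1 | h1)
      · exact ⟨by omega, .inl h1⟩
      · exact ⟨by omega, .inr (.inl h1)⟩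
  · have hkB : r k ∉ B₀ := hf.notMem k (by omega) hk
    rintro T (hT | ⟨i, hi, hik, rfl⟩ | rfl | ⟨h2, -⟩)
    · exact .inl ⟨.inl hT, fun h => hkB (h𝒯₀ T hT h)⟩
    · by_cases h1 : i + 1 < k
      · refine .inl ⟨.inr (.inl ⟨i, hi, by omega, rfl⟩), ?_⟩
        rintro (h2 | h2 | h2)
        · exact hf.ne k (by omega) h2
        · exact hne (by omega) (by omega) (by omega) h2
        · exact hne (i := k) (j := i + 1) (by omega) (by omega) (by omega) h2
      · by_cases h2 : i = k
        · subst h2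
          refine .inr (.inr (.inr ?_))
          rw [Set.pair_comm (r i), Set.insert_comm, Set.pair_comm h]
        · obtain rfl : i = k - 1 := by omega
          refine .inr (.inl ?_)
          rw [hk1, Set.pair_comm (r (k - 1)), Set.insert_comm]
    · exact .inr (.inr (.inl (Set.insert_comm _ _ _)))
    · omega

theorem realizes (hf : IsFan E₀ B₀ h r n) {𝒯₀ : Set (Set W)} (h𝒯₀ : ∀ T ∈ 𝒯₀, T ⊆ B₀) (hn : 2 ≤ n)
    (hR : Realizes (fan E₀ h r 2) (fanSet B₀ r 2) (fanFaces 𝒯₀ h r 2)) :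
    Realizes (fan E₀ h r n) (fanSet B₀ r n) (fanFaces 𝒯₀ h r n) := by
  have key : ∀ k, 2 ≤ k → k ≤ n →
      Realizes (fan E₀ h r k) (fanSet B₀ r k) (fanFaces 𝒯₀ h r k) := by
    intro k hk
    induction k, hk using Nat.le_induction with
    | base => exact fun _ => hR
    | succ k hk ih => exact fun hkn => hf.realizes_succ h𝒯₀ hk hkn (ih (by omega))
  exact key n hn le_rfl

/-- Attaching a wheel at the triangle `h, r 0, r 1`. -/
theorem realizes_attach (hf : IsFan E₀ B₀ h r n) {𝒯 𝒯₀ : Set (Set W)}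
    (h𝒯 : {h, r 0, r 1} ∈ 𝒯) (h𝒯₀ : ∀ T ∈ 𝒯₀, T ∈ 𝒯 ∧ T ⊆ B₀ ∧ T ≠ {h, r 0, r 1}) (hn : 2 ≤ n)
    (e₀ : E₀.Adj h (r 0)) (e₁ : E₀.Adj h (r 1)) (e₂ : E₀.Adj (r 0) (r 1)) (hR : Realizes E₀ B₀ 𝒯) :
    Realizes (fan E₀ h r n) (fanSet B₀ r n) (fanFaces 𝒯₀ h r n) := by
  refine hf.realizes (fun T hT => (h𝒯₀ T hT).2.1) hn ?_
  have hset : fanSet B₀ r 1 = B₀ := by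
    refine Set.union_eq_left.2 ?_
    rintro _ ⟨i, hi, rfl⟩
    rcases Nat.le_one_iff_eq_zero_or_eq_one.1 hi with rfl | rfl
    · exact hf.zero
    · exact hf.one
  have hw := hf.notMem_fanSet (k := 1) le_rfl hn
  rw [fanSet_succ, hset]
  rw [hset] at hw
  have hne : ∀ {i j}, i ≤ n → j ≤ n → i ≠ j → r i ≠ r j := fun hi hj hij h =>
    hij (hf.inj _ hi _ hj h)
  refine hR.attach h𝒯 hw ?_ ?_ ?_
  · have key : ∀ x ∈ B₀, ∀ y ∈ B₀, (E₀.Adj x y ∨ (x = h ∧ ∃ i ≤ 2, y = r i) ∨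
        (∃ i < 2, x = r i ∧ y = r (i + 1)) ∨ (x = r 2 ∧ y = r 0)) → E₀.Adj x y := by
      rintro x hx y hy (h1 | ⟨rfl, i, hi, rfl⟩ | ⟨i, hi, rfl, rfl⟩ | ⟨rfl, -⟩)
      · exact h1
      · have : i ≠ 2 := by rintro rfl; exact hw hy
        rcases show i = 0 ∨ i = 1 by omega with rfl | rfl
        · exact e₀
        · exact e₁
      · have : i ≠ 1 := by rintro rfl; exact hw hy
        obtain rfl : i = 0 := by omega
        exact e₂
      · exact absurd hx hw
    intro x hx y hy
    rw [fan, SimpleGraph.fromRel_adj]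
    constructor
    · rintro ⟨-, h1 | h1⟩
      · exact key x hx y hy h1
      · exact (key y hy x hx h1).symm
    · exact fun h1 => ⟨h1.ne, .inl (.inl h1)⟩
  · intro y hy
    rw [hf.fan_adj_rim le_rfl hn hn]
    simp only [Set.mem_insert_iff, Set.mem_singleton_iff, le_refl, lt_irrefl, false_and, false_or,
      true_and, Nat.add_one_sub_one]
    rw [or_comm (a := y = r 1)]
  · rintro T (hT | ⟨i, hi, hi2, rfl⟩ | rfl | ⟨-, rfl⟩)
    · exact .inl ⟨(h𝒯₀ T hT).1, (h𝒯₀ T hT).2.2⟩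
    · obtain rfl : i = 1 := by omega
      refine .inr ⟨h, .inl rfl, r 1, .inr (.inr rfl), (hf.ne 1 (by omega)).symm, ?_⟩
      rw [Set.pair_comm (r 1), Set.insert_comm]
    · exact .inr ⟨h, .inl rfl, r 0, .inr (.inl rfl), (hf.ne 0 (by omega)).symm,
        Set.insert_comm _ _ _⟩
    · refine .inr ⟨r 0, .inr (.inl rfl), r 1, .inr (.inr rfl),
        hne (by omega) (by omega) (by omega), ?_⟩
      rw [Set.pair_comm (r 1), Set.insert_comm]

end IsFan

theorem Realizes.mono {W : Type u} {E : SimpleGraph W} {B : Set W} {𝒯 𝒯' : Set (Set W)}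
    (h : Realizes E B 𝒯) (h' : 𝒯' ⊆ 𝒯) : Realizes E B 𝒯' := by
  obtain ⟨D, V, F, M, l, h1, h2, h3, h4, h5⟩ := h
  exact ⟨D, V, F, M, l, h1, h2, h3, h4, fun T hT => h5 T (h' hT)⟩

/-- A single wheel. -/
theorem IsFan.realizes_bot {W : Type u} {h : W} {r : ℕ → W} {n : ℕ}
    (hf : IsFan ⊥ {h, r 0, r 1} h r n) (hn : 2 ≤ n) :
    Realizes (fan ⊥ h r n) (fanSet {h, r 0, r 1} r n) (fanFaces {{h, r 0, r 1}} h r n) := by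
  refine hf.realizes (fun T hT => by rw [Set.mem_singleton_iff.1 hT]) hn ?_
  have hne : ∀ {i j}, i ≤ n → j ≤ n → i ≠ j → r i ≠ r j := fun hi hj hij h =>
    hij (hf.inj _ hi _ hj h)
  have n01 : r 0 ≠ r 1 := hne (by omega) (by omega) (by omega)
  have n02 : r 0 ≠ r 2 := hne (by omega) (by omega) (by omega)
  have n12 : r 1 ≠ r 2 := hne (by omega) (by omega) (by omega)
  have m0 : h ≠ r 0 := (hf.ne 0 (by omega)).symm
  have m1 : h ≠ r 1 := (hf.ne 1 (by omega)).symm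
  have m2 : h ≠ r 2 := (hf.ne 2 (by omega)).symm
  -- The base of the growth is the tetrahedron on the hub and the first three rim vertices.
  let l : Fin 4 → W := ![h, r 0, r 1, r 2]
  have hl : Function.Injective l := by
    intro i j hij
    fin_cases i <;> fin_cases j <;> first | rfl | (exfalso; revert hij; simp [l]; try tauto)
  have adj : ∀ i j : Fin 4, i < j → (fan ⊥ h r 2).Adj (l i) (l j) := by
    have a : ∀ k, (⊥ : SimpleGraph W).Adj h (r k) ∨ (h = h ∧ ∃ i ≤ 2, r k = r i) ∨
        (∃ i < 2, h = r i ∧ r k = r (i + 1)) ∨ (h = r 2 ∧ r k = r 0) ↔ ∃ i ≤ 2, r k = r i := by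
      intro k
      refine ⟨?_, fun h => .inr (.inl ⟨rfl, h⟩)⟩
      rintro (h1 | ⟨-, h1⟩ | ⟨i, hi, h1, -⟩ | ⟨h1, -⟩)
      · exact h1.elim
      · exact h1
      · exact absurd h1.symm (hf.ne i (by omega))
      · exact absurd h1 m2
    have b : ∀ k ≤ 2, (fan ⊥ h r 2).Adj h (r k) := fun k hk => by
      rw [fan, SimpleGraph.fromRel_adj]
      exact ⟨(hf.ne k (by omega)).symm, .inl ((a k).2 ⟨k, hk, rfl⟩)⟩
    have c01 : (fan ⊥ h r 2).Adj (r 0) (r 1) := by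
      rw [fan, SimpleGraph.fromRel_adj]
      exact ⟨n01, .inl (.inr (.inr (.inl ⟨0, by omega, rfl, rfl⟩)))⟩
    have c12 : (fan ⊥ h r 2).Adj (r 1) (r 2) := by
      rw [fan, SimpleGraph.fromRel_adj]
      exact ⟨n12, .inl (.inr (.inr (.inl ⟨1, by omega, rfl, rfl⟩)))⟩
    have c02 : (fan ⊥ h r 2).Adj (r 0) (r 2) := by
      rw [fan, SimpleGraph.fromRel_adj]
      exact ⟨n02, .inr (.inr (.inr (.inr ⟨rfl, rfl⟩)))⟩
    intro i j hij
    fin_cases i <;> fin_cases j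
    all_goals first
      | exact b 0 (by omega)
      | exact b 1 (by omega)
      | exact b 2 (by omega)
      | exact c01
      | exact c02
      | exact c12
      | exact absurd hij (by decide)
  refine ⟨_, _, _, tetrahedron, l, PolyMap.tetrahedron_reducible, hl, ?_, ?_, ?_⟩
  · ext x
    constructor
    · rintro ⟨i, rfl⟩
      fin_cases i
      · exact .inl (.inl rfl)
      · exact .inl (.inr (.inl rfl))
      · exact .inl (.inr (.inr rfl))
      · exact .inr ⟨2, le_rfl, rfl⟩
    · rintro ((rfl | rfl | rfl) | ⟨i, hi, rfl⟩)
      · exact ⟨0, rfl⟩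
      · exact ⟨1, rfl⟩
      · exact ⟨2, rfl⟩
      · interval_cases i
        exacts [⟨1, rfl⟩, ⟨2, rfl⟩, ⟨3, rfl⟩]
  · intro i j
    rw [tetrahedron_dual, SimpleGraph.top_adj]
    refine ⟨fun hij => ?_, fun hij h => hij.ne (by rw [h])⟩
    rcases lt_or_gt_of_ne hij with h | h
    · exact adj i j h
    · exact (adj j i h).symm
  · have img : ∀ v a b c : Fin 4, {f | tetrahedron.Inc v f} = {a, b, c} →
        ∃ v, tetrahedron.Tri v ∧ ({l a, l b, l c} : Set W) = l '' {f | tetrahedron.Inc v f} :=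
      fun v a b c hv => ⟨v, tetrahedron_tri v, by rw [hv, Set.image_insert_eq, Set.image_pair]⟩
    have inc : ∀ v a b c : Fin 4, (∀ f, v ≠ f ↔ f = a ∨ f = b ∨ f = c) →
        {f | tetrahedron.Inc v f} = {a, b, c} := by
      intro v a b c hv
      ext f
      exact tetrahedron_inc.trans (hv f)
    rintro T (rfl | ⟨i, hi, hi2, rfl⟩ | rfl | ⟨-, rfl⟩)
    · exact img 3 0 1 2 (inc _ _ _ _ (by decide))
    · obtain rfl : i = 1 := by omega
      exact img 1 0 2 3 (inc _ _ _ _ (by decide))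
    · exact img 2 0 3 1 (inc _ _ _ _ (by decide))
    · exact img 0 1 2 3 (inc _ _ _ _ (by decide))

/-! ### Induced wheels as fans -/

section Wheel

variable {W : Type u} {H : SimpleGraph W} {S : Set W} {m : ℕ} (φ : wheel (m + 3) ≃g H.induce S)

/-- The hub of a wheel. -/
def hubOf : W := (φ none).1

/-- The rim of a wheel. -/
def rimOf (i : ℕ) : W := if hi : i < m + 3 then (φ (some ⟨i, hi⟩)).1 else (φ none).1

variable {φ}

theorem rimOf_eq (i : Fin (m + 3)) : rimOf φ i.val = (φ (some i)).1 := dif_pos i.isLt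

theorem exists_rimOf {i : ℕ} (hi : i ≤ m + 2) :
    ∃ j : Fin (m + 3), j.val = i ∧ rimOf φ i = (φ (some j)).1 :=
  ⟨⟨i, by omega⟩, rfl, dif_pos (by omega)⟩

theorem rimOf_mem {i : ℕ} (hi : i ≤ m + 2) : rimOf φ i ∈ S := by
  obtain ⟨j, -, h⟩ := exists_rimOf (φ := φ) hi
  rw [h]
  exact (φ _).2

theorem rimOf_inj : ∀ i ≤ m + 2, ∀ j ≤ m + 2, rimOf φ i = rimOf φ j → i = j := by
  intro i hi j hj hij
  obtain ⟨i, rfl, h1⟩ := exists_rimOf (φ := φ) hi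
  obtain ⟨j, rfl, h2⟩ := exists_rimOf (φ := φ) hj
  rw [h1, h2] at hij
  rw [Option.some.inj (φ.injective (Subtype.ext hij))]

theorem rimOf_ne : ∀ i ≤ m + 2, rimOf φ i ≠ hubOf φ := by
  intro i hi h
  obtain ⟨j, -, h'⟩ := exists_rimOf (φ := φ) hi
  rw [h', hubOf] at h
  exact absurd (φ.injective (Subtype.ext h)) (by simp)

theorem fan_wheel_adj {E₀ : SimpleGraph W} {x y : W} :
    (fan E₀ (hubOf φ) (rimOf φ) (m + 2)).Adj x y ↔
      E₀.Adj x y ∨ (x ∈ S ∧ y ∈ S ∧ H.Adj x y) := by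
  have adj : ∀ {u v}, H.Adj (φ u).1 (φ v).1 ↔ (wheel (m + 3)).Adj u v := φ.map_adj_iff
  have key : ∀ x y, (E₀.Adj x y ∨ (x = hubOf φ ∧ ∃ i ≤ m + 2, y = rimOf φ i) ∨
      (∃ i < m + 2, x = rimOf φ i ∧ y = rimOf φ (i + 1)) ∨
      (x = rimOf φ (m + 2) ∧ y = rimOf φ 0)) → E₀.Adj x y ∨ (x ∈ S ∧ y ∈ S ∧ H.Adj x y) := by
    rintro x y (h | ⟨rfl, i, hi, rfl⟩ | ⟨i, hi, rfl, rfl⟩ | ⟨rfl, rfl⟩)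
    · exact .inl h
    · refine .inr ⟨(φ none).2, rimOf_mem hi, ?_⟩
      obtain ⟨j, -, h⟩ := exists_rimOf (φ := φ) hi
      rw [h, hubOf, adj]
      trivial
    · refine .inr ⟨rimOf_mem hi.le, rimOf_mem hi, ?_⟩
      obtain ⟨j, h1, h⟩ := exists_rimOf (φ := φ) hi.le
      obtain ⟨j', h1', h'⟩ := exists_rimOf (φ := φ) (show i + 1 ≤ m + 2 from hi)
      rw [h, h', adj, wheel_adj_rim]
      omega
    · refine .inr ⟨rimOf_mem le_rfl, rimOf_mem (by omega), ?_⟩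
      obtain ⟨j, h1, h⟩ := exists_rimOf (φ := φ) (le_refl (m + 2))
      obtain ⟨j', h1', h'⟩ := exists_rimOf (φ := φ) (show 0 ≤ m + 2 by omega)
      rw [h, h', adj, wheel_adj_rim]
      omega
  rw [fan, SimpleGraph.fromRel_adj]
  constructor
  · rintro ⟨-, h | h⟩
    · exact key x y h
    · rcases key y x h with h | ⟨h1, h2, h3⟩
      · exact .inl h.symm
      · exact .inr ⟨h2, h1, h3.symm⟩
  · rintro (h | ⟨hx, hy, h⟩)
    · exact ⟨h.ne, .inl (.inl h)⟩
    · refine ⟨h.ne, ?_⟩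
      obtain ⟨u, hu⟩ := φ.surjective ⟨x, hx⟩
      obtain ⟨v, hv⟩ := φ.surjective ⟨y, hy⟩
      have hu' : x = (φ u).1 := by rw [hu]
      have hv' : y = (φ v).1 := by rw [hv]
      have huv : (wheel (m + 3)).Adj u v := by rw [← adj, ← hu', ← hv']; exact h
      rcases u with _ | i <;> rcases v with _ | j
      · exact huv.elim
      · exact .inl (.inr (.inl ⟨hu', j.val, by omega, by rw [rimOf_eq, hv']⟩))
      · exact .inr (.inr (.inl ⟨hv', i.val, by omega, by rw [rimOf_eq, hu']⟩))
      · rw [wheel_adj_rim] at huv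
        rw [← rimOf_eq] at hu' hv'
        rcases huv with h1 | h1 | ⟨h1, h2⟩ | ⟨h1, h2⟩
        · exact .inl (.inr (.inr (.inl ⟨i.val, by omega, hu', by rw [h1, hv']⟩)))
        · exact .inr (.inr (.inr (.inl ⟨j.val, by omega, hv', by rw [h1, hu']⟩)))
        · exact .inr (.inr (.inr (.inr ⟨by rw [hv', h2], by rw [hu', h1]⟩)))
        · exact .inl (.inr (.inr (.inr ⟨by rw [hu', h2], by rw [hv', h1]⟩)))

theorem fanSet_wheel {B₀ : Set W} (h : hubOf φ ∈ B₀) :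
    fanSet B₀ (rimOf φ) (m + 2) = B₀ ∪ S := by
  ext x
  constructor
  · rintro (hx | ⟨i, hi, rfl⟩)
    · exact .inl hx
    · exact .inr (rimOf_mem hi)
  · rintro (hx | hx)
    · exact .inl hx
    · obtain ⟨u, hu⟩ := φ.surjective ⟨x, hx⟩
      have hu' : x = (φ u).1 := by rw [hu]
      rcases u with _ | i
      · exact .inl (by rw [hu']; exact h)
      · exact .inr ⟨i.val, by omega, by rw [rimOf_eq, hu']⟩

/-- A triangle in a wheel consists of the hub and a rim edge, or it is the rim of a tetrahedron. -/
theorem mem_fanFaces_wheel {𝒯₀ : Set (Set W)} {T : Set W} (hT : T ⊆ S) (h3 : T.ncard = 3)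
    (hc : ∀ x ∈ T, ∀ y ∈ T, x ≠ y → H.Adj x y)
    (hT0 : T ≠ {hubOf φ, rimOf φ 0, rimOf φ 1}) :
    T ∈ fanFaces 𝒯₀ (hubOf φ) (rimOf φ) (m + 2) := by
  have adj : ∀ {u v}, H.Adj (φ u).1 (φ v).1 ↔ (wheel (m + 3)).Adj u v := φ.map_adj_iff
  have hub : ∀ i j : Fin (m + 3), (wheel (m + 3)).Adj (some i) (some j) →
      T = {hubOf φ, rimOf φ i.val, rimOf φ j.val} →
      T ∈ fanFaces 𝒯₀ (hubOf φ) (rimOf φ) (m + 2) := by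
    have step : ∀ i j : Fin (m + 3), i.val + 1 = j.val →
        T = {hubOf φ, rimOf φ i.val, rimOf φ j.val} →
        T ∈ fanFaces 𝒯₀ (hubOf φ) (rimOf φ) (m + 2) := by
      intro i j hij hT
      rcases Nat.eq_zero_or_pos i.val with h0 | h0
      · rw [← hij, h0] at hT
        exact absurd hT hT0
      · exact .inr (.inl ⟨i.val, h0, by omega, by rw [hT, hij]⟩)
    intro i j hij hT
    rw [wheel_adj_rim] at hij
    rcases hij with h1 | h1 | ⟨h1, h2⟩ | ⟨h1, h2⟩
    · exact step i j h1 hT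
    · exact step j i h1 (by rw [hT, Set.pair_comm (rimOf φ i.val)])
    · exact .inr (.inr (.inl (by rw [hT, h1, h2, Set.pair_comm (rimOf φ 0)])))
    · exact .inr (.inr (.inl (by rw [hT, h1, h2])))
  obtain ⟨a, b, c, hab, hac, hbc, rfl⟩ := Set.ncard_eq_three.1 h3
  have aab := hc a (.inl rfl) b (.inr (.inl rfl)) hab
  have aac := hc a (.inl rfl) c (.inr (.inr rfl)) hac
  have abc := hc b (.inr (.inl rfl)) c (.inr (.inr rfl)) hbc
  have lab : ∀ x ∈ ({a, b, c} : Set W), ∃ u, x = (φ u).1 := by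
    intro x hx
    obtain ⟨u, hu⟩ := φ.surjective ⟨x, hT hx⟩
    exact ⟨u, by rw [hu]⟩
  obtain ⟨u, rfl⟩ := lab a (.inl rfl)
  obtain ⟨v, rfl⟩ := lab b (.inr (.inl rfl))
  obtain ⟨w, rfl⟩ := lab c (.inr (.inr rfl))
  rw [adj] at aab aac abc
  rcases u with _ | i
  · rcases v with _ | j
    · exact aab.elim
    rcases w with _ | k
    · exact aac.elim
    exact hub j k abc (by rw [rimOf_eq, rimOf_eq]; rfl)
  rcases v with _ | j
  · rcases w with _ | k
    · exact abc.elim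
    exact hub i k aac (by rw [rimOf_eq, rimOf_eq]; exact Set.insert_comm _ _ _)
  rcases w with _ | k
  · refine hub i j aab ?_
    rw [rimOf_eq, rimOf_eq, Set.pair_comm (φ (some j)).1, Set.insert_comm]
    rfl
  have hm : m = 0 := wheel_rim_clique aab aac abc
  subst hm
  refine .inr (.inr (.inr ⟨rfl, Set.eq_of_subset_of_ncard_le ?_ ?_ (Set.toFinite _)⟩))
  · have key : ∀ i : Fin (0 + 3), (φ (some i)).1 ∈
        ({rimOf φ 0, rimOf φ 1, rimOf φ 2} : Set W) := by
      intro i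
      rw [← rimOf_eq]
      have := i.isLt
      rcases show i.val = 0 ∨ i.val = 1 ∨ i.val = 2 by omega with h | h | h <;> rw [h] <;> simp
    rintro _ (rfl | rfl | rfl) <;> exact key _
  · rw [h3]
    exact (Set.ncard_insert_le _ _).trans (Nat.succ_le_succ ((Set.ncard_insert_le _ _).trans
      (by rw [Set.ncard_singleton])))

end Wheel

/-! ### Realizing a tree of wheels one wheel at a time -/

namespace WheelTree

variable {W : Type u} {ι : Type v} {H : SimpleGraph W} {T : SimpleGraph ι} {S : ι → Set W}

/-- The union of the wheels in `J`. -/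
def part (H : SimpleGraph W) (S : ι → Set W) (J : Set ι) : SimpleGraph W where
  Adj x y := ∃ k ∈ J, x ∈ S k ∧ y ∈ S k ∧ H.Adj x y
  symm := ⟨fun _ _ ⟨k, hk, hx, hy, h⟩ => ⟨k, hk, hy, hx, h.symm⟩⟩
  loopless := ⟨fun _ ⟨_, _, _, _, h⟩ => H.irrefl h⟩

def partSet (S : ι → Set W) (J : Set ι) : Set W := {x | ∃ k ∈ J, x ∈ S k}

/-- The triangles in the wheels of `J` that do not separate two wheels in `J`. -/
def partFaces (H : SimpleGraph W) (T : SimpleGraph ι) (S : ι → Set W) (J : Set ι) : Set (Set W) :=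
  {X | ∃ k ∈ J, X ⊆ S k ∧ X.ncard = 3 ∧ (∀ x ∈ X, ∀ y ∈ X, x ≠ y → H.Adj x y) ∧
    ∀ l ∈ J, T.Adj k l → X ≠ S k ∩ S l}

/-- A triangle in the wheel `k` can be taken as the triangle `h, r 0, r 1`. -/
theorem exists_frame {k : ι} (hk : IsWheel (H.induce (S k))) {X : Set W} (hX : X ⊆ S k)
    (h3 : X.ncard = 3) (hc : ∀ x ∈ X, ∀ y ∈ X, x ≠ y → H.Adj x y) :
    ∃ (m : ℕ) (φ : D3.wheel (m + 3) ≃g H.induce (S k)), X = {hubOf φ, rimOf φ 0, rimOf φ 1} := by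
  obtain ⟨a, b, c, hab, hac, hbc, rfl⟩ := Set.ncard_eq_three.1 h3
  have ha : a ∈ ({a, b, c} : Set W) := .inl rfl
  have hb : b ∈ ({a, b, c} : Set W) := .inr (.inl rfl)
  have hc' : c ∈ ({a, b, c} : Set W) := .inr (.inr rfl)
  obtain ⟨m, φ, h⟩ := IsWheel.exists_iso_of_clique hk (a := ⟨a, hX ha⟩) (b := ⟨b, hX hb⟩)
    (c := ⟨c, hX hc'⟩) (hc a ha b hb hab) (hc a ha c hc' hac) (hc b hb c hc' hbc)
  refine ⟨m, φ, ?_⟩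
  have h' := congrArg (Subtype.val '' ·) h
  simp only [Set.image_insert_eq, Set.image_singleton] at h'
  rw [h', hubOf, ← rimOf_eq, ← rimOf_eq]
  rfl

theorem exists_path_in {J : Set ι} (hJ : ∀ i ∈ J, ∀ j ∈ J, ∃ p : T.Walk i j, ∀ k ∈ p.support, k ∈ J)
    {i j : ι} (hi : i ∈ J) (hj : j ∈ J) : ∃ p : T.Walk i j, p.IsPath ∧ ∀ k ∈ p.support, k ∈ J := by
  classical
  obtain ⟨p, hp⟩ := hJ i hi j hj
  exact ⟨p.bypass, p.bypass_isPath, fun k hk => hp k (p.support_bypass_subset_support hk)⟩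

theorem isFan_single {k : ι} {m : ℕ} (φ : D3.wheel (m + 3) ≃g H.induce (S k)) :
    IsFan ⊥ {hubOf φ, rimOf φ 0, rimOf φ 1} (hubOf φ) (rimOf φ) (m + 2) where
  inj := rimOf_inj
  ne := rimOf_ne
  mem := fun _ _ h => h.elim
  hub := .inl rfl
  zero := .inr (.inl rfl)
  one := .inr (.inr rfl)
  notMem := by
    rintro i hi h2 (h | h | h)
    · exact rimOf_ne i hi h
    · have := rimOf_inj i hi 0 (by omega) h
      omega
    · have := rimOf_inj i hi 1 (by omega) h
      omega

/-- All triangles of a wheel are faces. -/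
theorem realizes_single {k : ι} (hk : IsWheel (H.induce (S k))) :
    Realizes (part H S {k}) (S k)
      {X | X ⊆ S k ∧ X.ncard = 3 ∧ ∀ x ∈ X, ∀ y ∈ X, x ≠ y → H.Adj x y} := by
  obtain ⟨m, ⟨φ⟩⟩ := hk.exists_iso
  have := (isFan_single φ).realizes_bot (by omega)
  have e : fan ⊥ (hubOf φ) (rimOf φ) (m + 2) = part H S {k} := by
    ext x y
    rw [fan_wheel_adj]
    constructor
    · rintro (h | h)
      · exact h.elim
      · exact ⟨k, rfl, h⟩
    · rintro ⟨_, rfl, h⟩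
      exact .inr h
  rw [fanSet_wheel (.inl rfl), Set.union_eq_right.2, e] at this
  · refine this.mono ?_
    rintro X ⟨h1, h2, h3⟩
    by_cases hX : X = {hubOf φ, rimOf φ 0, rimOf φ 1}
    · exact .inl hX
    · exact mem_fanFaces_wheel h1 h2 h3 hX
  · rintro _ (rfl | rfl | rfl)
    · exact (φ none).2
    · exact rimOf_mem (by omega)
    · exact rimOf_mem (by omega)

/-- The wheel `l` meets the union of the wheels in `J` only in the triangle shared with `k`. By
`once` this triangle is still free, so `l` can be attached there as a fan. -/
theorem realizes_insert (h : WheelTree H T S) {J : Set ι}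
    (hJ : ∀ i ∈ J, ∀ j ∈ J, ∃ p : T.Walk i j, ∀ k ∈ p.support, k ∈ J) {k l : ι} (hk : k ∈ J)
    (hl : l ∉ J) (hkl : T.Adj k l) (hR : Realizes (part H S J) (partSet S J) (partFaces H T S J)) :
    Realizes (part H S (insert l J)) (partSet S (insert l J))
      (partFaces H T S (insert l J)) := by
  -- A path inside `J` from `k` to `k'` extends to a path from `l`, so anything common to `l` and
  -- `k'` passes through `k`.
  have gate : ∀ k' ∈ J, ∀ x ∈ S k', x ∈ S l → x ∈ S k := by
    intro k' hk' x hx hxl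
    obtain ⟨p, hp, hpJ⟩ := exists_path_in hJ hk hk'
    have hp' : (SimpleGraph.Walk.cons hkl.symm p).IsPath := hp.cons fun h => hl (hpJ _ h)
    exact h.mem_of_isPath hxl hx hp' (by simp)
  have hcl : ∀ x ∈ S k ∩ S l, ∀ y ∈ S k ∩ S l, x ≠ y → H.Adj x y := h.clique k l hkl
  obtain ⟨m, φ, hφ⟩ := exists_frame (h.wheel l) Set.inter_subset_right (h.ncard k l hkl) hcl
  have m0 : hubOf φ ∈ S k ∩ S l := by rw [hφ]; exact .inl rfl
  have m1 : rimOf φ 0 ∈ S k ∩ S l := by rw [hφ]; exact .inr (.inl rfl)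
  have m2 : rimOf φ 1 ∈ S k ∩ S l := by rw [hφ]; exact .inr (.inr rfl)
  have hf : IsFan (part H S J) (partSet S J) (hubOf φ) (rimOf φ) (m + 2) :=
    { inj := rimOf_inj
      ne := rimOf_ne
      mem := fun x y ⟨k, hk, hx, _⟩ => ⟨k, hk, hx⟩
      hub := ⟨k, hk, m0.1⟩
      zero := ⟨k, hk, m1.1⟩
      one := ⟨k, hk, m2.1⟩
      notMem := by
        rintro i hi h2 ⟨k', hk', hx⟩
        have hil : rimOf φ i ∈ S l := rimOf_mem hi
        have : rimOf φ i ∈ S k ∩ S l := ⟨gate k' hk' _ hx hil, hil⟩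
        rw [hφ] at this
        exact (isFan_single φ).notMem i hi h2 this }
  have h𝒯 : S k ∩ S l ∈ partFaces H T S J := by
    refine ⟨k, hk, Set.inter_subset_left, h.ncard k l hkl, hcl, fun l' hl' hkl' he => ?_⟩
    rw [h.once k l l' hkl hkl' he] at hl
    exact hl hl'
  have adj : ∀ {x y}, x ∈ S k ∩ S l → y ∈ S k ∩ S l → x ≠ y → (part H S J).Adj x y :=
    fun hx hy hne => ⟨k, hk, hx.1, hy.1, hcl _ hx _ hy hne⟩
  have := hf.realizes_attach (𝒯₀ := {X | X ∈ partFaces H T S J ∧ X ≠ S k ∩ S l})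
    (by rw [← hφ]; exact h𝒯) ?_ (by omega) (adj m0 m1 (rimOf_ne 0 (by omega)).symm)
    (adj m0 m2 (rimOf_ne 1 (by omega)).symm)
    (adj m1 m2 fun h => by have := rimOf_inj 0 (by omega) 1 (by omega) h; omega) hR
  · have e : fan (part H S J) (hubOf φ) (rimOf φ) (m + 2) = part H S (insert l J) := by
      ext x y
      rw [fan_wheel_adj]
      constructor
      · rintro (⟨k, hk, h⟩ | h)
        · exact ⟨k, .inr hk, h⟩
        · exact ⟨l, .inl rfl, h⟩
      · rintro ⟨_, rfl | hk, h⟩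
        · exact .inr h
        · exact .inl ⟨_, hk, h⟩
    have e' : partSet S J ∪ S l = partSet S (insert l J) := by
      ext x
      constructor
      · rintro (⟨k, hk, h⟩ | h)
        · exact ⟨k, .inr hk, h⟩
        · exact ⟨l, .inl rfl, h⟩
      · rintro ⟨_, rfl | hk, h⟩
        · exact .inr h
        · exact .inl ⟨_, hk, h⟩
    rw [e, fanSet_wheel hf.hub, e'] at this
    refine this.mono ?_
    rintro X ⟨k', rfl | hk', hX, h3, hc, hu⟩
    · refine mem_fanFaces_wheel hX h3 hc ?_
      rw [← hφ, Set.inter_comm]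
      exact hu k (.inr hk) hkl.symm
    · refine .inl ⟨⟨k', hk', hX, h3, hc, fun l' hl' => hu l' (.inr hl')⟩, ?_⟩
      rintro rfl
      -- Could the triangle just used also count as free in another wheel `k'` of `J`? All wheels on
      -- the path from `k'` to `k` contain it, so it is the triangle shared by `k'` and the next
      -- wheel on this path, which excludes it.
      by_cases hkk : k' = k
      · subst hkk
        exact hu l (.inl rfl) hkl rfl
      obtain ⟨p, hp, hpJ⟩ := exists_path_in hJ hk' hk
      cases p with
      | nil => exact hkk rfl
      | @cons _ j _ hj q =>
        refine hu j (.inr (hpJ j (by simp))) hj (Set.eq_of_subset_of_ncard_le ?_ ?_ ?_)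
        · exact fun x hx => ⟨hX hx, h.mem_of_isPath (hX hx) hx.1 hp (by simp)⟩
        · rw [h.ncard _ _ hj, h3]
        · exact Set.finite_of_ncard_ne_zero (by rw [h.ncard _ _ hj]; simp)
  · rintro X ⟨hX, hne⟩
    refine ⟨hX, ?_, by rwa [← hφ]⟩
    obtain ⟨k', hk', hX, -⟩ := hX
    exact fun x hx => ⟨k', hk', hX hx⟩

/-- A connected set `J` of wheels is enlarged across an edge of the tree that leaves it, until it
contains every wheel. -/
theorem realizes [Finite ι] (h : WheelTree H T S) : Realizes H Set.univ ∅ := by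
  have key : ∀ n < Nat.card ι, ∃ J : Set ι, J.ncard = n + 1 ∧
      (∀ i ∈ J, ∀ j ∈ J, ∃ p : T.Walk i j, ∀ k ∈ p.support, k ∈ J) ∧
      Realizes (part H S J) (partSet S J) (partFaces H T S J) := by
    intro n
    induction n with
    | zero =>
      intro _
      obtain ⟨i⟩ := h.isTree.connected.nonempty
      refine ⟨{i}, Set.ncard_singleton i, ?_, ?_⟩
      · rintro _ rfl _ rfl
        exact ⟨.nil, fun k hk => by simpa using hk⟩
      · have e : partSet S {i} = S i := by
          ext x
          constructor
          · rintro ⟨_, rfl, h⟩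
            exact h
          · exact fun h => ⟨i, rfl, h⟩
        rw [e]
        refine (realizes_single (h.wheel i)).mono ?_
        rintro X ⟨_, rfl, h1, h2, h3, -⟩
        exact ⟨h1, h2, h3⟩
    | succ n ih =>
      intro hn
      obtain ⟨J, hJn, hJ, hR⟩ := ih (by omega)
      obtain ⟨i, hi⟩ : J.Nonempty := Set.nonempty_of_ncard_ne_zero (by omega)
      obtain ⟨j, hj⟩ : ∃ j, j ∉ J := by
        by_contra hall
        push Not at hall
        rw [Set.eq_univ_of_forall hall, Set.ncard_univ] at hJn
        omega
      obtain ⟨p⟩ := h.isTree.connected.preconnected i j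
      -- A walk from inside `J` to a wheel outside has a first edge leaving `J`, and its far end is
      -- the wheel to add.
      obtain ⟨d, -, hk, hl⟩ := p.exists_boundary_dart J hi hj
      refine ⟨insert d.snd J, ?_, ?_, h.realizes_insert hJ hk hl d.adj hR⟩
      · rw [Set.ncard_insert_of_notMem hl, hJn]
      · have new : ∀ a ∈ J, ∃ p : T.Walk d.snd a, ∀ k ∈ p.support, k ∈ insert d.snd J := by
          intro a ha
          obtain ⟨q, hq⟩ := hJ d.fst hk a ha
          refine ⟨.cons d.adj.symm q, fun k hk => ?_⟩
          rw [SimpleGraph.Walk.support_cons, List.mem_cons] at hk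
          exact hk.imp id (hq k)
        rintro a (rfl | ha) b (rfl | hb)
        · exact ⟨.nil, fun k hk => .inl (by simpa using hk)⟩
        · exact new b hb
        · obtain ⟨q, hq⟩ := new a ha
          exact ⟨q.reverse, fun k hk => hq k (by simpa using hk)⟩
        · obtain ⟨q, hq⟩ := hJ a ha b hb
          exact ⟨q, fun k hk => .inr (hq k hk)⟩
  obtain ⟨i⟩ := h.isTree.connected.nonempty
  have hpos : 0 < Nat.card ι := Nat.card_pos_iff.2 ⟨⟨i⟩, inferInstance⟩
  obtain ⟨J, hJn, -, hR⟩ := key (Nat.card ι - 1) (by omega)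
  have hJ : J = Set.univ := Set.eq_of_subset_of_ncard_le (Set.subset_univ J)
    (by rw [Set.ncard_univ]; omega)
  subst hJ
  have e : part H S Set.univ = H := by
    ext x y
    constructor
    · rintro ⟨-, -, -, -, h⟩
      exact h
    · intro hxy
      obtain ⟨k, hx, hy⟩ := h.cover x y hxy
      exact ⟨k, trivial, hx, hy, hxy⟩
  have e' : partSet S Set.univ = Set.univ := by
    refine Set.eq_univ_of_forall fun x => ?_
    obtain ⟨k, hk⟩ := h.mem x
    exact ⟨k, trivial, hk⟩
  rw [e, e'] at hR
  exact hR.mono (Set.empty_subset _)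

end WheelTree

/-- By `realizes_single` the wheel is the dual of a polyhedral map in which the triangle consists of
the faces around a vertex of degree three. It is thus a face of the dual embedding. -/
theorem isTriangularFace_of_isWheel {W : Type u} {H : SimpleGraph W} {S X : Set W}
    (hS : IsWheel (H.induce S)) (hX : X ⊆ S) (h3 : X.ncard = 3)
    (hc : ∀ x ∈ X, ∀ y ∈ X, x ≠ y → H.Adj x y) :
    IsTriangularFace (H.induce S) {x | x.1 ∈ X} := by
  obtain ⟨D, V, F, M, l, -, hl, hr, hadj, htri⟩ :=
    WheelTree.realizes_single (S := fun _ : Unit => S) (k := ()) hS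
  obtain ⟨v, hv, rfl⟩ := htri X ⟨hX, h3, hc⟩
  subst hr
  let e : H.induce (Set.range l) ≃g M.dual := SimpleGraph.Iso.symm ⟨Equiv.ofInjective l hl, by
    intro f g
    rw [hadj]
    exact ⟨fun h => ⟨(), rfl, ⟨f, rfl⟩, ⟨g, rfl⟩, h⟩, fun ⟨_, _, _, _, h⟩ => h⟩⟩
  convert M.isTriangularFace e hv using 1
  ext x
  obtain ⟨f, rfl⟩ := e.symm.surjective x
  rw [Set.mem_ofPred_eq, Set.mem_ofPred_eq, e.apply_symm_apply]
  exact hl.mem_set_image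

theorem IsTriangularFace.clique {V : Type u} {G : SimpleGraph V} {X : Set V}
    (h : IsTriangularFace G X) : X.ncard = 3 ∧ ∀ x ∈ X, ∀ y ∈ X, x ≠ y → G.Adj x y := by
  obtain ⟨R, -, d, hd, rfl⟩ := h
  have h1 := d.adj
  have h2 := (R.faceNext d).adj
  have h3 := (R.faceNext (R.faceNext d)).adj
  have n : ∀ d, (R.faceNext d).fst = d.snd := fun d => R.faceNext_fst d
  rw [← n] at h1 h2 h3
  rw [hd] at h3
  refine ⟨Set.ncard_eq_three.2 ⟨_, _, _, h1.ne, h3.ne', h2.ne, rfl⟩, ?_⟩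
  rintro _ (rfl | rfl | rfl) _ (rfl | rfl | rfl) hne
  exacts [absurd rfl hne, h1, h3.symm, h1.symm, absurd rfl hne, h2, h3, h2.symm, absurd rfl hne]

/-! ### From trees of wheels to gluings -/

/-- The pieces are the induced wheels, and the step along `ij` identifies the two copies of `S i ∩ S
j`. Copies of one vertex in different wheels are identified along the walk given by `chain`, and
`cover` supplies the edges. -/
theorem WheelTree.exists_gluing {W : Type u} {ι : Type v} {H : SimpleGraph W} {T : SimpleGraph ι}
    {S : ι → Set W} (h : WheelTree H T S) :
    ∃ Γ : Gluing (fun i => H.induce (S i)), Nonempty (H ≃g Γ.graph) := by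
  -- The enumeration depends only on the set, so the two faces in a step are listed in the same
  -- order. Sets that do not have three elements get an arbitrary constant function.
  have hex : ∀ X : Set W, ∃ f : Fin 3 → W, X.ncard = 3 → Set.range f = X := by
    intro X
    by_cases hX : X.ncard = 3
    · obtain ⟨a, b, c, -, -, -, rfl⟩ := Set.ncard_eq_three.1 hX
      refine ⟨![a, b, c], fun _ => ?_⟩
      ext x
      constructor
      · rintro ⟨i, rfl⟩
        fin_cases i
        exacts [.inl rfl, .inr (.inl rfl), .inr (.inr rfl)]
      · rintro (rfl | rfl | rfl)
        exacts [⟨0, rfl⟩, ⟨1, rfl⟩, ⟨2, rfl⟩]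
    · obtain ⟨i⟩ := h.isTree.connected.nonempty
      obtain ⟨n, -, ⟨e⟩⟩ := h.wheel i
      exact ⟨fun _ => (e.symm none).1, fun h => absurd h hX⟩
  choose f hf using hex
  have hfS : ∀ {i j}, T.Adj i j → Set.range (f (S i ∩ S j)) = S i ∩ S j := fun hij =>
    hf _ (h.ncard _ _ hij)
  have hfm : ∀ {i j}, T.Adj i j → ∀ m, f (S i ∩ S j) m ∈ S i := by
    intro i j hij m
    exact ((hfS hij).subset ⟨m, rfl⟩).1
  let face : ∀ {i j : ι}, T.Adj i j → Fin 3 → S i := fun {i j} hij m =>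
    ⟨f (S i ∩ S j) m, hfm hij m⟩
  have hface : ∀ {i j : ι} (hij : T.Adj i j), Set.range (face hij) = {x | x.1 ∈ S i ∩ S j} := by
    intro i j hij
    ext x
    rw [Set.mem_ofPred_eq, ← hfS hij]
    exact exists_congr fun m => Subtype.ext_iff
  let Γ : Gluing (fun i => H.induce (S i)) :=
    { tree := T
      isTree := h.isTree
      face := face
      isTriangularFace := fun {i j} hij => by
        rw [hface hij]
        exact isTriangularFace_of_isWheel (h.wheel i) Set.inter_subset_left (h.ncard i j hij)
          (h.clique i j hij)
      face_used_once := fun {i j k} hij hik he => by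
        rw [hface hij, hface hik] at he
        refine h.once i j k hij hik (Set.ext fun x => ?_)
        constructor
        · intro hx
          have : (⟨x, hx.1⟩ : S i) ∈ {x : S i | x.1 ∈ S i ∩ S j} := hx
          rw [he] at this
          exact this
        · intro hx
          have : (⟨x, hx.1⟩ : S i) ∈ {x : S i | x.1 ∈ S i ∩ S k} := hx
          rw [← he] at this
          exact this }
  have step : ∀ {i j} (hij : T.Adj i j) {x} (hi : x ∈ S i) (hj : x ∈ S j),
      Γ.vertex i ⟨x, hi⟩ = Γ.vertex j ⟨x, hj⟩ := by
    intro i j hij x hi hj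
    have : x ∈ S i ∩ S j := ⟨hi, hj⟩
    rw [← hfS hij] at this
    obtain ⟨m, rfl⟩ := this
    refine Quot.sound ⟨i, j, hij, m, rfl, ?_⟩
    congr 1
    refine Subtype.ext ?_
    change _ = f (S j ∩ S i) m
    rw [Set.inter_comm (S j)]
  have walk : ∀ {i j} (p : T.Walk i j) {x} (hi : x ∈ S i) (hj : x ∈ S j)
      (_ : ∀ k ∈ p.support, x ∈ S k), Γ.vertex i ⟨x, hi⟩ = Γ.vertex j ⟨x, hj⟩ := by
    intro i j p
    induction p with
    | nil => exact fun _ _ _ => rfl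
    | @cons i k j hik p ih =>
      intro x hi hj hp
      have hk : x ∈ S k := hp k (by simp)
      rw [step hik hi hk]
      exact ih hk hj fun l hl => hp l (by simp [hl])
  let g : Γ.Vertex → W := Quot.lift (fun x => x.2.1) (by
    rintro _ _ ⟨i, j, hij, m, rfl, rfl⟩
    change f (S i ∩ S j) m = f (S j ∩ S i) m
    rw [Set.inter_comm])
  have gv : ∀ i x, g (Γ.vertex i x) = x.1 := fun _ _ => rfl
  have hg : Function.Bijective g := by
    constructor
    · rintro ⟨i, x⟩ ⟨j, y⟩ hxy
      change x.1 = y.1 at hxy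
      obtain ⟨x, hx⟩ := x
      obtain ⟨y, hy⟩ := y
      obtain rfl : x = y := hxy
      obtain ⟨p, hp⟩ := h.chain i j x hx hy
      exact walk p hx hy hp
    · intro x
      obtain ⟨i, hi⟩ := h.mem x
      exact ⟨Γ.vertex i ⟨x, hi⟩, rfl⟩
  refine ⟨Γ, ⟨SimpleGraph.Iso.symm ⟨Equiv.ofBijective g hg, ?_⟩⟩⟩
  intro a b
  constructor
  · intro hab
    obtain ⟨i, ha, hb⟩ := h.cover _ _ hab
    refine ⟨fun hab' => hab.ne (by rw [hab']), i, ⟨_, ha⟩, ⟨_, hb⟩, hab, ?_, ?_⟩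
    · exact hg.1 (gv i ⟨_, ha⟩).symm
    · exact hg.1 (gv i ⟨_, hb⟩).symm
  · rintro ⟨-, i, x, y, hxy, rfl, rfl⟩
    exact hxy

/-! ### From gluings to trees of wheels -/

namespace Gluing

variable {ι : Type v} {X : ι → Type w} {P : ∀ i, SimpleGraph (X i)} (Γ : Gluing P)

theorem face_injective {i j : ι} (h : Γ.tree.Adj i j) : Function.Injective (Γ.face h) := by
  have h3 := (Γ.isTriangularFace h).clique.1
  rw [← Set.image_univ] at h3
  exact Set.injOn_univ.1 (Set.injOn_of_ncard_image_eq (by rw [h3, Set.ncard_univ, Nat.card_fin])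
    (Set.toFinite _))

theorem vertex_face {i j : ι} (h : Γ.tree.Adj i j) (m : Fin 3) :
    Γ.vertex i (Γ.face h m) = Γ.vertex j (Γ.face h.symm m) :=
  Quot.sound ⟨i, j, h, m, rfl, rfl⟩

open Classical in
/-- Follow a vertex of a piece through the identifications along a walk in the tree. -/
noncomputable def transfer : ∀ {j i : ι}, Γ.tree.Walk j i → X j → Option (X i)
  | _, _, .nil, x => some x
  | _, _, .cons h p, x =>
    if hm : ∃ m, x = Γ.face h m then transfer p (Γ.face h.symm hm.choose) else none

theorem transfer_face {i j k : ι} (h : Γ.tree.Adj i j) (p : Γ.tree.Walk j k) (m : Fin 3) :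
    Γ.transfer (.cons h p) (Γ.face h m) = Γ.transfer p (Γ.face h.symm m) := by
  have hm : ∃ m', Γ.face h m = Γ.face h m' := ⟨m, rfl⟩
  rw [transfer, dif_pos hm, ← Γ.face_injective h hm.choose_spec]

theorem exists_of_transfer {i j k : ι} {h : Γ.tree.Adj i j} {p : Γ.tree.Walk j k} {x : X i} {y : X k}
    (hx : Γ.transfer (.cons h p) x = some y) :
    ∃ m, x = Γ.face h m ∧ Γ.transfer p (Γ.face h.symm m) = some y := by
  rw [transfer] at hx
  split at hx
  · next hm => exact ⟨_, hm.choose_spec, hx⟩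
  · cases hx

theorem mem_of_transfer {i k : ι} (p : Γ.tree.Walk i k) {x : X i} {y : X k}
    (hx : Γ.transfer p x = some y) : ∀ l ∈ p.support, Γ.vertex i x ∈ Set.range (Γ.vertex l) := by
  induction p with
  | nil =>
    intro l hl
    obtain rfl : l = _ := by simpa using hl
    exact ⟨x, rfl⟩
  | cons h p ih =>
    obtain ⟨m, rfl, hm⟩ := Γ.exists_of_transfer hx
    intro l hl
    rw [SimpleGraph.Walk.support_cons, List.mem_cons] at hl
    rcases hl with rfl | hl
    · exact ⟨_, rfl⟩
    · rw [Γ.vertex_face]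
      exact ih hm l hl

theorem path_unique {i j : ι} {p q : Γ.tree.Walk i j} (hp : p.IsPath) (hq : q.IsPath) : p = q :=
  congrArg Subtype.val ((Γ.isTree.isAcyclic.subsingleton_path i j).elim ⟨p, hp⟩ ⟨q, hq⟩)

/-- Equal vertices of the glued graph correspond under the transfer along the path. -/
theorem transfer_of_vertex_eq {i j : ι} {x : X i} {y : X j} (h : Γ.vertex i x = Γ.vertex j y)
    {p : Γ.tree.Walk j i} (hp : p.IsPath) : Γ.transfer p y = some x := by
  classical
  choose path hpath using fun j => (Γ.isTree.existsUnique_path j i).exists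
  -- Of the paths to `i` from the adjacent indices `j` and `k`, one is the other extended by the
  -- edge between them. So the transfer to `i` respects identifications and descends to the
  -- quotient, as `g`.
  have step : ∀ {j k} (hjk : Γ.tree.Adj j k) (m : Fin 3), Γ.transfer (path j) (Γ.face hjk m) =
      Γ.transfer (path k) (Γ.face hjk.symm m) := by
    intro j k hjk m
    by_cases hj : j ∈ (path k).support
    · have e1 : (path k).takeUntil j hj = .cons hjk.symm .nil :=
        Γ.path_unique ((hpath k).takeUntil hj) (by simpa using hjk.ne')
      have e2 : (path k).dropUntil j hj = path j :=
        Γ.path_unique ((hpath k).dropUntil hj) (hpath j)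
      have e3 := (path k).take_spec hj
      rw [e1, e2] at e3
      rw [← e3]
      exact (Γ.transfer_face hjk.symm (path j) m).symm
    · rw [Γ.path_unique (hpath j) ((hpath k).cons (h := hjk) hj)]
      exact Γ.transfer_face hjk (path k) m
  let g : Γ.Vertex → Option (X i) := Quot.lift (fun x => Γ.transfer (path x.1) x.2) (by
    rintro _ _ ⟨j, k, hjk, m, rfl, rfl⟩
    exact step hjk m)
  have h1 : g (Γ.vertex j y) = Γ.transfer (path j) y := rfl
  have h2 : g (Γ.vertex i x) = Γ.transfer (path i) x := rfl
  have h3 : path i = .nil := Γ.path_unique (hpath i) .nil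
  rw [h, h3] at h2
  rw [Γ.path_unique hp (hpath j), ← h1, h2]
  rfl

/-- Transfer along the empty path is the identity. -/
theorem vertex_injective (i : ι) : Function.Injective (Γ.vertex i) := fun _ _ h =>
  (Option.some.inj (Γ.transfer_of_vertex_eq h (p := .nil) .nil)).symm

/-- A vertex shared with another piece lies on the face towards that piece. -/
theorem exists_face {i j : ι} {p : Γ.tree.Walk i j} {k : ι} {h : Γ.tree.Adj i k}
    {q : Γ.tree.Walk k j} (hp : p.IsPath) (hpq : p = .cons h q) {x : X i} {y : X j}
    (hxy : Γ.vertex i x = Γ.vertex j y) : x ∈ Set.range (Γ.face h) := by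
  have := Γ.transfer_of_vertex_eq hxy.symm hp
  rw [hpq] at this
  obtain ⟨m, hm, -⟩ := Γ.exists_of_transfer this
  exact ⟨m, hm.symm⟩

theorem inter_eq {i j : ι} (h : Γ.tree.Adj i j) :
    Set.range (Γ.vertex i) ∩ Set.range (Γ.vertex j) = Γ.vertex i '' Set.range (Γ.face h) := by
  ext a
  constructor
  · rintro ⟨⟨x, rfl⟩, ⟨y, hy⟩⟩
    exact ⟨x, Γ.exists_face (p := .cons h .nil) (by simpa using h.ne) rfl hy.symm, rfl⟩
  · rintro ⟨_, ⟨m, rfl⟩, rfl⟩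
    exact ⟨⟨_, rfl⟩, ⟨_, (Γ.vertex_face h m).symm⟩⟩

/-- The pieces are induced subgraphs. An edge from another piece with both ends in `P i` joins two
vertices of the face towards that piece, and these are already adjacent because the face is a
triangle. -/
theorem graph_adj_vertex {i : ι} {x y : X i} :
    Γ.graph.Adj (Γ.vertex i x) (Γ.vertex i y) ↔ (P i).Adj x y := by
  constructor
  · rintro ⟨hne, j, x', y', hxy, hx, hy⟩
    obtain ⟨p, hp⟩ := (Γ.isTree.existsUnique_path i j).exists
    cases p with
    | nil =>
      rw [Γ.vertex_injective i hx, Γ.vertex_injective i hy]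
      exact hxy
    | cons h q =>
      exact (Γ.isTriangularFace h).clique.2 x (Γ.exists_face hp rfl hx) y
        (Γ.exists_face hp rfl hy) fun h => hne (by rw [h])
  · intro h
    exact ⟨(Γ.vertex_injective i).ne h.ne, i, x, y, h, rfl, rfl⟩

theorem wheelTree (hP : ∀ i, IsWheel (P i)) :
    WheelTree Γ.graph Γ.tree fun i => Set.range (Γ.vertex i) where
  isTree := Γ.isTree
  wheel := by
    intro i
    obtain ⟨m, ⟨φ⟩⟩ := (hP i).exists_iso
    refine isWheel_induce (fun u => Γ.vertex i (φ u)) ((Γ.vertex_injective i).comp φ.injective) ?_ ?_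
    · exact φ.surjective.range_comp (Γ.vertex i)
    · intro a b
      rw [Γ.graph_adj_vertex]
      exact φ.map_adj_iff
  mem := by
    rintro ⟨i, x⟩
    exact ⟨i, x, rfl⟩
  cover := by
    rintro _ _ ⟨-, i, x, y, -, rfl, rfl⟩
    exact ⟨i, ⟨x, rfl⟩, ⟨y, rfl⟩⟩
  chain := by
    rintro i j _ ⟨x, rfl⟩ ⟨y, hy⟩
    obtain ⟨p, hp⟩ := (Γ.isTree.existsUnique_path i j).exists
    exact ⟨p, Γ.mem_of_transfer p (Γ.transfer_of_vertex_eq hy hp)⟩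
  ncard := by
    intro i j h
    rw [Γ.inter_eq h, Set.ncard_image_of_injective _ (Γ.vertex_injective i)]
    exact (Γ.isTriangularFace h).clique.1
  clique := by
    intro i j h
    rw [Γ.inter_eq h]
    rintro _ ⟨x, hx, rfl⟩ _ ⟨y, hy, rfl⟩ hxy
    exact Γ.graph_adj_vertex.2 ((Γ.isTriangularFace h).clique.2 x hx y hy fun h =>
      hxy (by rw [h]))
  once := by
    intro i j k hij hik h
    rw [Γ.inter_eq hij, Γ.inter_eq hik] at h
    exact Γ.face_used_once hij hik ((Γ.vertex_injective i).image_injective h)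

end Gluing

end D3

/-! ### The theorem -/

theorem mainTheorem3 {V : Type*} (G : SimpleGraph V) :
    (∃ (V' : Type) (G' : SimpleGraph V'), D3.Reducible G' ∧ D3.IsPlanarDual G G') ↔
      ∃ (ι : Type) (_ : Finite ι) (X : ι → Type) (P : ∀ i, SimpleGraph (X i)) (Γ : D3.Gluing P),
        (∀ i, D3.IsWheel (P i)) ∧ Nonempty (G ≃g Γ.graph) := by
  constructor
  · rintro ⟨V', G', hred, hdual⟩
    obtain ⟨D, V, F, M, ⟨ψ⟩, ι, hι, T, S, hS, -⟩ := hred.exists_map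
    -- Uniqueness of the embedding enters here: the given planar dual may come from any embedding of
    -- the reducible graph.
    obtain ⟨e⟩ := M.dual_iso_of_isPlanarDual hdual ψ
    obtain ⟨Γ, ⟨e'⟩⟩ := hS.exists_gluing
    exact ⟨ι, hι, _, _, Γ, hS.wheel, ⟨e.trans e'⟩⟩
  · rintro ⟨ι, hι, X, P, Γ, hP, ⟨e⟩⟩
    obtain ⟨D, V, F, M, l, hM, hl, hr, hadj, -⟩ := (Γ.wheelTree hP).realizes
    refine ⟨V, M.primal, hM, M.isPlanarDual (e.trans (SimpleGraph.Iso.symm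
      ⟨Equiv.ofBijective l ⟨hl, Set.range_eq_univ.1 hr⟩, ?_⟩))⟩
    intro f g
    exact (hadj f g).symm
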